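/- All spaces are real. For an operator $T\in B(X,Y)$ between Banach spaces and $1\le p<\infty$, $\pi_p(T)$ denotes its $p$-summing norm, and $T$ is called $p$-summing if $\pi_p(T)<\infty$. Let $(g_n)$ be independent standard Gaussian variables on a probability space $(\Omega,\mu)$ and $(e_n)$ the unit vector basis of $\ell_2$. For $T\in B(\ell_2,X)$ put $$\ell(T)=\Bigl(\int\Bigl\|\sum_{n=1}^\infty g_n(t)\,Te_n\Bigr\|^2d\mu(t)\Bigr)^{1/2}$$ whenever the series converges in $L_2(\mu,X)$, and $\ell(T)=\infty$ otherwise. A Banach space $X$ is said - to have the Gaussian average property (GAP) if there is a constant $K$ such that $\ell(T)\le K\pi_1(T^*)$ for every bounded finite rank operator $T:\ell_2\to X$; - to have $(S_p)$, where $1\le p<\infty$, if there is a constant $K$ such that every $T\in B(\ell_2,X)$ with $T^*$ $1$-summing is $p$-summing with $\pi_p(T)\le K\pi_1(T^*)$; and to have $(S)$ if it has $(S_p)$ for some $1\le p<\infty$; - to have $GL_2$ (the Gordon-Lewis property with respect to Hilbert space) if every $1$-summing operator $T:X\to\ell_2$ factors as $T=BA$ with bounded operators $A:X\to L_1(\nu)$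 and $B:L_1(\nu)\to\ell_2$ for some measure $\nu$; - to be of type $p$ if there is a constant $C$ such that $\bigl(\mathbb E\|\sum_{i=1}^n\varepsilon_ix_i\|^2\bigr)^{1/2}\le C\bigl(\sum_{i=1}^n\|x_i\|^p\bigr)^{1/p}$ for all finite families $(x_i)$ in $X$, and of cotype $q$ if there is a constant $C$ such that $\bigl(\sum_{i=1}^n\|x_i\|^q\bigr)^{1/q}\le C\bigl(\mathbb E\|\sum_{i=1}^n\varepsilon_ix_i\|^2\bigr)^{1/2}$ for all such families, where the $\varepsilon_i=\pm1$ are independent uniform random signs; and to be of finite cotype if it is of cotype $q$ for some $2\le q<\infty$. **Theorem 1.3.** Let $X$ be a Banach space. (i) If $X$ is of cotype 2, then $X$ has GAP if and only if $X$ has $GL_2$. (ii) If $X$ is of type 2, then $X$ has GAP. (iii) If $X$ is isomorphic to a subspace of a Banach lattice of finite cotype, then $X$ has $(S)$ and $X$ has GAP. -/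

import Mathlib

open MeasureTheory Filter Topology
open scoped ENNReal NNReal

noncomputable section

namespace GaussianAverage

/-- The real Hilbert space `ℓ₂`. -/
abbrev ell2 : Type := lp (fun _ : ℕ => ℝ) 2

/-- The unit vector basis `(eₙ)` of `ℓ₂`. -/
def unitVec (n : ℕ) : ell2 := lp.single 2 n (1 : ℝ)

/-! ### Type and cotype -/

section TypeCotype

variable (X : Type*) [NormedAddCommGroup X] [NormedSpace ℝ X]

/-- The Rademacher average `(𝔼 ‖∑ εᵢ xᵢ‖²)^{1/2}`, the expectation being the uniform average over
all choices of signs `εᵢ = ±1`. -/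
def rademacherAverage {X : Type*} [NormedAddCommGroup X] [NormedSpace ℝ X]
    {n : ℕ} (x : Fin n → X) : ℝ :=
  Real.sqrt (((2 : ℝ) ^ n)⁻¹ * ∑ ε : Fin n → ℤˣ, ‖∑ i, ((ε i : ℤ) : ℝ) • x i‖ ^ 2)

/-- `X` is of type `p`. -/
def HasType (p : ℝ) : Prop :=
  ∃ C : ℝ, ∀ (n : ℕ) (x : Fin n → X),
    rademacherAverage x ≤ C * (∑ i, ‖x i‖ ^ p) ^ (1 / p)

/-- `X` is of cotype `q` (for finite `q`). -/
def HasCotype (q : ℝ) : Prop :=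
  ∃ C : ℝ, ∀ (n : ℕ) (x : Fin n → X),
    (∑ i, ‖x i‖ ^ q) ^ (1 / q) ≤ C * rademacherAverage x

/-- `X` is of finite cotype: it has cotype `q` for some `2 ≤ q < ∞`. -/
def HasFiniteCotype : Prop :=
  ∃ q : ℝ, 2 ≤ q ∧ HasCotype X q

end TypeCotype

/-! ### `p`-summing operators -/

section Summing

variable {X Y : Type*} [NormedAddCommGroup X] [NormedSpace ℝ X]
  [NormedAddCommGroup Y] [NormedSpace ℝ Y]

/-- The weak `ℓ_p`-norm `sup {(∑ |x*(xᵢ)|^p)^{1/p} : ‖x*‖ ≤ 1}` of a finite family. -/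
def weakNorm (p : ℝ) {n : ℕ} (x : Fin n → X) : ℝ≥0∞ :=
  ⨆ (f : StrongDual ℝ X) (_ : ‖f‖ ≤ 1), (∑ i, ‖f (x i)‖ₑ ^ p) ^ (1 / p)

/-- The `p`-summing norm `π_p(T)`, the least constant `C` such that
`(∑ ‖T xᵢ‖^p)^{1/p} ≤ C · sup {(∑ |x*(xᵢ)|^p)^{1/p} : ‖x*‖ ≤ 1}` for all finite families;
it is `∞` when there is no finite such constant. -/
def summingNorm (p : ℝ) (T : X →L[ℝ] Y) : ℝ≥0∞ :=
  sInf {C : ℝ≥0∞ | ∀ (n : ℕ) (x : Fin n → X),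
    (∑ i, ‖T (x i)‖ₑ ^ p) ^ (1 / p) ≤ C * weakNorm p x}

/-- `T` is `p`-summing, that is, `T ∈ Π_p(X, Y)`. -/
def IsSumming (p : ℝ) (T : X →L[ℝ] Y) : Prop := summingNorm p T < ∞

/-- The (Banach space) adjoint `T* : Y* → X*`, `y* ↦ y* ∘ T`. For `X = ℓ₂` the dual `X*` is
isometric to `ℓ₂`, so that summing norms of `T*` do not depend on the identification. -/
def adj (T : X →L[ℝ] Y) : StrongDual ℝ Y →L[ℝ] StrongDual ℝ X :=
  (ContinuousLinearMap.compL ℝ X Y ℝ).flip T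

@[simp] theorem adj_apply (T : X →L[ℝ] Y) (f : StrongDual ℝ Y) (x : X) :
    adj T f x = f (T x) := rfl

end Summing

/-! ### The `ℓ`-norm -/

/-- The law of a sequence of independent standard Gaussian variables, which are realised as
the coordinates `gₙ(t) = t n` on `ℝ^ℕ`. -/
def gaussianSeq : Measure (ℕ → ℝ) :=
  Measure.infinitePi (fun _ : ℕ => ProbabilityTheory.gaussianReal 0 1)

section Properties

variable (X : Type*) [NormedAddCommGroup X] [NormedSpace ℝ X]

/-- The series `∑ gₙ T eₙ` converges to `f` in `L₂(μ, X)`. -/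
def IsGaussianSum {X : Type*} [NormedAddCommGroup X] [NormedSpace ℝ X]
    (T : ell2 →L[ℝ] X) (f : (ℕ → ℝ) → X) : Prop :=
  MemLp f 2 gaussianSeq ∧
    Tendsto (fun n : ℕ =>
        eLpNorm (fun t => (∑ j ∈ Finset.range n, t j • T (unitVec j)) - f t) 2 gaussianSeq)
      atTop (𝓝 0)

/-- The `ℓ`-norm `ℓ(T) = (∫ ‖∑ gₙ T eₙ‖² dμ)^{1/2}`, equal to `∞` if the series does not
converge in `L₂(μ, X)`. (The infimum is over the almost everywhere unique sum of the series.) -/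
def ellNorm {X : Type*} [NormedAddCommGroup X] [NormedSpace ℝ X] (T : ell2 →L[ℝ] X) : ℝ≥0∞ :=
  ⨅ (f : (ℕ → ℝ) → X) (_ : IsGaussianSum T f), eLpNorm f 2 gaussianSeq

/-! ### The properties `GAP`, `(S_p)`, `(S)` and `GL₂` -/

/-- The Gaussian average property: `ℓ(T) ≤ K π₁(T*)` for all bounded finite rank operators
`T : ℓ₂ → X`. -/
def HasGAP : Prop :=
  ∃ K : ℝ≥0, ∀ T : ell2 →L[ℝ] X, FiniteDimensional ℝ (LinearMap.range T.toLinearMap) →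
    ellNorm T ≤ K * summingNorm 1 (adj T)

/-- Property `(S_p)`. -/
def HasSp (p : ℝ) : Prop :=
  ∃ K : ℝ≥0, ∀ T : ell2 →L[ℝ] X, IsSumming 1 (adj T) →
    IsSumming p T ∧ summingNorm p T ≤ K * summingNorm 1 (adj T)

/-- Property `(S)`. -/
def HasS : Prop := ∃ p : ℝ, 1 ≤ p ∧ HasSp X p

/-- `T : X → Y` factors through `L₁(ν)` for some measure space `(Ω, ν)`. The set `Ω` may be taken
in the universe of `X`: an `L₁`-space can be replaced by its closed sublattice generated by the
image of `X`, which is again an `L₁`-space. -/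
def FactorsThroughL1.{u, v} {X : Type u} [NormedAddCommGroup X] [NormedSpace ℝ X]
    {Y : Type v} [NormedAddCommGroup Y] [NormedSpace ℝ Y] (T : X →L[ℝ] Y) : Prop :=
  ∃ (Ω : Type u) (_ : MeasurableSpace Ω) (ν : Measure Ω)
    (A : X →L[ℝ] Lp ℝ 1 ν) (B : Lp ℝ 1 ν →L[ℝ] Y), T = B.comp A

/-- The Gordon-Lewis property with respect to Hilbert space: every `1`-summing operator
`X → ℓ₂` factors through `L₁`. -/
def HasGL2 : Prop :=
  ∀ T : X →L[ℝ] ell2, IsSumming 1 T → FactorsThroughL1 T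

end Properties

end GaussianAverage

end

open MeasureTheory Filter Topology
open scoped ENNReal NNReal

noncomputable section

namespace GaussianAverage

/-! ### Summing inequalities with natural exponents and real constants -/

section SummingBounds

/-! Everything is reduced to operators `S` from a finite-dimensional Euclidean space into `X`. There
GAP says that the Gaussian second moment `gaussSq S` is bounded by a constant times the square of
any 1-summing constant of the adjoint of `S` (`HasGAP.exists_gaussSq_le`, `hasGAP_of_gaussSq_le`).
Since inserting a Gaussian vector into a summing inequality is legitimate, it is enough for GAP to
bound a `k`-summing constant of `S` for one fixed `k ≥ 2` (`hasGAP_of_summingBound`).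

Subspaces of lattices. If `T` maps a Hilbert space into a Banach lattice and its adjoint is
1-summing, then finite suprema of images of unit ball elements have bounded norm
(`norm_sup_le_of_summingBound`). Cutting such a supremum into small pieces, on which the images are
almost scalar multiples, factors `T` through `ℓ_∞^n` on each finite-dimensional subspace
(`exists_factorization_of_summingBound`). An operator from `ℓ_∞^n` into a space of cotype `p` is
dominated by an `L_{2p}`-seminorm (`CotypeBound.exists_weight`, after Pisier), so `T` is
`2p`-summing. An isomorphic embedding only changes constants. This gives both (S) and GAP.

Type 2. The adjoint of `S` is 2-summing, and its Pietsch measure may be placed on finitely many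
points `x_j` of the unit ball of `X` itself. Dualising, `S` is up to a constant controlled by a
bounded Hilbert space operator followed by `e_j ↦ √μ_j x_j`. Type 2 bounds the Gaussian average of
the second map, and the contraction principle (`gaussSq_comp_le`) absorbs the first.

Cotype 2. Both implications pass through a trace inequality `|tr (V S)| ≤ K π(V) π₁(S*)`. From GL₂
it holds with `π = π₁`, by gluing hypothetical counterexamples into one operator that cannot factor
through `L₁` (`HasGL2.exists_trace_bound`). In cotype 2 every 2-summing operator is 1-summing, and
testing with diagonal operators shows that `S` is 2-summing. Conversely, GAP and cotype 2 bound
`π₂(S)`, and trace duality gives the inequality with `π = π₂` (`HasGAP.exists_trace_bound`). For a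
1-summing `T : X → ℓ₂` the trace functional is therefore bounded by the projective norm on `C(K) ⊗
X`, with `K` the unit ball of `ℓ₂`. Hahn-Banach extends it to a bilinear form, so `T x` is the
barycentre of a signed measure on `K` that is linear in `x`. Expanding points of `K` along a
countable net turns these measures into absolutely summable coefficients, which is a factorization
through `ℓ₁`. -/

theorem sum_pow_le_sum_pow {ι : Type*} (s : Finset ι) (a : ι → ℝ) (ha : ∀ i ∈ s, 0 ≤ a i)
    {k : ℕ} (hk : k ≠ 0) : ∑ i ∈ s, a i ^ k ≤ (∑ i ∈ s, a i) ^ k := by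
  obtain ⟨m, rfl⟩ := Nat.exists_eq_succ_of_ne_zero hk
  rw [pow_succ, Finset.mul_sum]
  refine Finset.sum_le_sum fun i hi => ?_
  rw [pow_succ]
  have h1 := Finset.single_le_sum ha hi
  have h2 := ha i hi
  gcongr

variable {X Y : Type*} [NormedAddCommGroup X] [NormedSpace ℝ X]
  [NormedAddCommGroup Y] [NormedSpace ℝ Y]

/-- `T` satisfies the `k`-summing inequality with constant `c`, for a natural exponent `k`. -/
def SummingBound (k : ℕ) (T : X →L[ℝ] Y) (c : ℝ) : Prop :=
  ∀ (n : ℕ) (x : Fin n → X) (M : ℝ), 0 ≤ M →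
    (∀ f : StrongDual ℝ X, ‖f‖ ≤ 1 → ∑ i, |f (x i)| ^ k ≤ M ^ k) →
      ∑ i, ‖T (x i)‖ ^ k ≤ (c * M) ^ k

theorem sum_enorm_rpow_eq {Z : Type*} [NormedAddCommGroup Z] {n : ℕ} (k : ℕ) (z : Fin n → Z) :
    ∑ i, ‖z i‖ₑ ^ (k : ℝ) = ENNReal.ofReal (∑ i, ‖z i‖ ^ k) := by
  rw [ENNReal.ofReal_sum_of_nonneg (fun i _ => by positivity)]
  refine Finset.sum_congr rfl fun i _ => ?_
  rw [ENNReal.rpow_natCast, ENNReal.ofReal_pow (norm_nonneg _), ofReal_norm]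

theorem weakNorm_le_iff {k : ℕ} (hk : k ≠ 0) {n : ℕ} (x : Fin n → X) {M : ℝ} (hM : 0 ≤ M) :
    weakNorm (k : ℝ) x ≤ ENNReal.ofReal M ↔
      ∀ f : StrongDual ℝ X, ‖f‖ ≤ 1 → ∑ i, |f (x i)| ^ k ≤ M ^ k := by
  have hk' : (0 : ℝ) < k := by positivity
  simp only [weakNorm, iSup_le_iff]
  refine forall₂_congr fun f _ => ?_
  rw [sum_enorm_rpow_eq k (fun i => f (x i)), one_div,
    ENNReal.rpow_inv_le_iff hk', ENNReal.rpow_natCast, ← ENNReal.ofReal_pow hM,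
    ENNReal.ofReal_le_ofReal_iff (by positivity)]
  simp only [Real.norm_eq_abs]

theorem weakNorm_lt_top {k : ℕ} (hk : k ≠ 0) {n : ℕ} (x : Fin n → X) :
    weakNorm (k : ℝ) x < ∞ := by
  have h : weakNorm (k : ℝ) x ≤ ENNReal.ofReal (∑ i, ‖x i‖) := by
    rw [weakNorm_le_iff hk x (by positivity)]
    intro f hf
    calc ∑ i, |f (x i)| ^ k ≤ ∑ i, ‖x i‖ ^ k := by
          gcongr with i
          calc |f (x i)| ≤ ‖f‖ * ‖x i‖ := f.le_opNorm (x i)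
            _ ≤ 1 * ‖x i‖ := by gcongr
            _ = ‖x i‖ := one_mul _
      _ ≤ (∑ i, ‖x i‖) ^ k := sum_pow_le_sum_pow _ _ (fun i _ => norm_nonneg _) hk
  exact h.trans_lt ENNReal.ofReal_lt_top

theorem eq_zero_of_weakNorm_eq_zero {k : ℕ} (hk : k ≠ 0) {n : ℕ} (x : Fin n → X)
    (hx : weakNorm (k : ℝ) x = 0) (i : Fin n) : x i = 0 := by
  have h1 : weakNorm (k : ℝ) x ≤ ENNReal.ofReal 0 := by simp [hx]
  rw [weakNorm_le_iff hk x le_rfl] at h1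
  obtain ⟨g, hg, hgx⟩ := exists_dual_vector'' ℝ (x i)
  have h2 := h1 g hg
  rw [zero_pow hk] at h2
  have h3 := (Finset.sum_eq_zero_iff_of_nonneg (fun i _ => by positivity)).1
    (le_antisymm h2 (by positivity)) i (Finset.mem_univ _)
  have h4 : g (x i) = 0 := by simpa [hk] using h3
  rw [h4] at hgx
  simpa using hgx.symm

/-- Dividing by the weak norm shows that the infimum defining the summing norm is itself admissible.
Only a vanishing weak norm, where division is impossible, needs separate care. -/
theorem le_summingNorm_mul_weakNorm {k : ℕ} (hk : k ≠ 0) (T : X →L[ℝ] Y) {n : ℕ}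
    (x : Fin n → X) :
    (∑ i, ‖T (x i)‖ₑ ^ (k : ℝ)) ^ (1 / (k : ℝ)) ≤ summingNorm k T * weakNorm k x := by
  have hw := (weakNorm_lt_top hk x).ne
  by_cases h0 : weakNorm (k : ℝ) x = 0
  · rw [h0, mul_zero]
    by_cases hne : ∃ C : ℝ≥0∞, ∀ (n : ℕ) (x : Fin n → X),
        (∑ i, ‖T (x i)‖ₑ ^ (k : ℝ)) ^ (1 / (k : ℝ)) ≤ C * weakNorm k x
    · obtain ⟨C, hC⟩ := hne
      simpa [h0] using hC n x
    -- The constant `∞` is always admissible, because a family of weak norm zero vanishes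
    -- identically; so this case cannot occur.
    · exfalso
      refine hne ⟨∞, fun m y => ?_⟩
      by_cases hy : weakNorm (k : ℝ) y = 0
      · have hy' := eq_zero_of_weakNorm_eq_zero hk y hy
        simp [hy', hk, Nat.pos_of_ne_zero hk]
      · rw [ENNReal.top_mul hy]
        exact le_top
  · rw [← ENNReal.div_le_iff h0 hw]
    refine le_sInf fun C hC => ?_
    rw [ENNReal.div_le_iff h0 hw]
    exact hC n x

theorem summingBound_of_summingNorm_le {k : ℕ} (hk : k ≠ 0) {T : X →L[ℝ] Y} {c : ℝ}
    (hc : 0 ≤ c) (h : summingNorm k T ≤ ENNReal.ofReal c) : SummingBound k T c := by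
  intro n x M hM hx
  have hk' : (0 : ℝ) < k := by positivity
  have h1 := (le_summingNorm_mul_weakNorm hk T x).trans
    (mul_le_mul' h ((weakNorm_le_iff hk x hM).2 hx))
  rw [sum_enorm_rpow_eq k (fun i => T (x i)), ← ENNReal.ofReal_mul hc, one_div,
    ENNReal.rpow_inv_le_iff hk', ENNReal.rpow_natCast, ← ENNReal.ofReal_pow (by positivity),
    ENNReal.ofReal_le_ofReal_iff (by positivity)] at h1
  exact h1

theorem summingNorm_le_of_summingBound {k : ℕ} (hk : k ≠ 0) {T : X →L[ℝ] Y} {c : ℝ}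
    (hc : 0 ≤ c) (h : SummingBound k T c) : summingNorm k T ≤ ENNReal.ofReal c := by
  refine sInf_le fun n x => ?_
  have hk' : (0 : ℝ) < k := by positivity
  have hw := weakNorm_lt_top hk x
  have h1 := h n x (weakNorm (k : ℝ) x).toReal ENNReal.toReal_nonneg
    ((weakNorm_le_iff hk x ENNReal.toReal_nonneg).1 (by rw [ENNReal.ofReal_toReal hw.ne]))
  rw [sum_enorm_rpow_eq k (fun i => T (x i)), ← ENNReal.ofReal_toReal hw.ne,
    ← ENNReal.ofReal_mul hc, one_div, ENNReal.rpow_inv_le_iff hk', ENNReal.rpow_natCast,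
    ← ENNReal.ofReal_pow (by positivity)]
  exact ENNReal.ofReal_le_ofReal h1

theorem IsSumming.summingBound {k : ℕ} (hk : k ≠ 0) {T : X →L[ℝ] Y} (h : IsSumming k T) :
    SummingBound k T (summingNorm k T).toReal :=
  summingBound_of_summingNorm_le hk ENNReal.toReal_nonneg
    (by rw [ENNReal.ofReal_toReal (ne_of_lt h)])

theorem SummingBound.mono {k : ℕ} {T : X →L[ℝ] Y} {c c' : ℝ} (h : SummingBound k T c)
    (hc : 0 ≤ c) (hcc : c ≤ c') : SummingBound k T c' := fun n x M hM hx =>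
  (h n x M hM hx).trans (pow_le_pow_left₀ (by positivity) (by gcongr) k)

theorem SummingBound.fintype {k : ℕ} {T : X →L[ℝ] Y} {c : ℝ} (h : SummingBound k T c)
    {ι : Type*} [Fintype ι] (x : ι → X) {M : ℝ} (hM : 0 ≤ M)
    (hx : ∀ f : StrongDual ℝ X, ‖f‖ ≤ 1 → ∑ i, |f (x i)| ^ k ≤ M ^ k) :
    ∑ i, ‖T (x i)‖ ^ k ≤ (c * M) ^ k := by
  let e := Fintype.equivFin ι
  have h1 := h _ (fun i => x (e.symm i)) M hM (fun f hf => by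
    rw [e.symm.sum_comp (fun i => |f (x i)| ^ k)]
    exact hx f hf)
  rwa [e.symm.sum_comp (fun i => ‖T (x i)‖ ^ k)] at h1

theorem SummingBound.norm_le {k : ℕ} (hk : k ≠ 0) {T : X →L[ℝ] Y} {c : ℝ} (hc : 0 ≤ c)
    (h : SummingBound k T c) (x : X) : ‖T x‖ ≤ c * ‖x‖ := by
  have h1 := h 1 (fun _ => x) ‖x‖ (norm_nonneg _) (fun f hf => by
    simp only [Finset.univ_unique, Finset.sum_const, Finset.card_singleton, one_smul]
    gcongr
    calc |f x| ≤ ‖f‖ * ‖x‖ := f.le_opNorm x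
      _ ≤ 1 * ‖x‖ := by gcongr
      _ = ‖x‖ := one_mul _)
  simp only [Finset.univ_unique, Finset.sum_const, Finset.card_singleton, one_smul] at h1
  exact le_of_pow_le_pow_left₀ hk (by positivity) h1

/-- For exponent one, a bound on all signed sums controls the strong sum. -/
theorem SummingBound.sum_norm_le {T : X →L[ℝ] Y} {c : ℝ} (h : SummingBound 1 T c)
    {ι : Type*} [Fintype ι] (x : ι → X) {M : ℝ} (hM : 0 ≤ M)
    (hx : ∀ a : ι → ℝ, (∀ i, |a i| ≤ 1) → ‖∑ i, a i • x i‖ ≤ M) :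
    ∑ i, ‖T (x i)‖ ≤ c * M := by
  have h1 := h.fintype x hM (fun f hf => by
    -- The signs of the values of `f` convert the sum of their absolute values into one value of `f`
    -- on a signed sum.
    have h2 := hx (fun i => SignType.sign (f (x i))) (fun i => by
      rcases lt_trichotomy (f (x i)) 0 with h | h | h <;> simp [h])
    calc ∑ i, |f (x i)| ^ 1 = f (∑ i, ((SignType.sign (f (x i)) : SignType) : ℝ) • x i) := by
          simp [map_sum, sign_mul_self]
      _ ≤ ‖f‖ * ‖∑ i, ((SignType.sign (f (x i)) : SignType) : ℝ) • x i‖ :=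
          (le_abs_self _).trans (f.le_opNorm _)
      _ ≤ 1 * M := by gcongr
      _ = M ^ 1 := by ring)
  simpa using h1

/-- A `1`-summing operator is `2`-summing with the same constant. -/
theorem SummingBound.two_of_one {T : X →L[ℝ] Y} {c : ℝ} (h : SummingBound 1 T c) :
    SummingBound 2 T c := by
  intro n x M hM hx
  set s : ℝ := ∑ i, ‖T (x i)‖ ^ 2 with hs
  have hs0 : 0 ≤ s := by positivity
  -- With these multipliers the strong sum becomes `s`, while Cauchy-Schwarz bounds the weak sum by
  -- `√s * M`; cancelling `√s` leaves the 2-summing inequality.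
  have h1 := h n (fun i => ‖T (x i)‖ • x i) (√s * M) (by positivity) (fun f hf => by
    simp only [map_smul, smul_eq_mul, abs_mul, abs_norm, pow_one]
    calc ∑ i, ‖T (x i)‖ * |f (x i)| ≤ √(∑ i, ‖T (x i)‖ ^ 2) * √(∑ i, |f (x i)| ^ 2) :=
          Real.sum_mul_le_sqrt_mul_sqrt _ _ _
      _ ≤ √s * √(M ^ 2) := by gcongr; exact hx f hf
      _ = √s * M := by rw [Real.sqrt_sq hM])
  have h2 : s ≤ c * (√s * M) := by
    have h3 : ∑ i, ‖T (‖T (x i)‖ • x i)‖ ^ 1 = s := by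
      rw [hs]
      refine Finset.sum_congr rfl fun i _ => ?_
      rw [map_smul, norm_smul, norm_norm]; ring
    rw [h3] at h1
    linarith [h1]
  rcases hs0.eq_or_lt with h0 | h0
  · rw [← h0]; positivity
  · have h4 : √s ≤ c * M := by
      have h5 : 0 < √s := Real.sqrt_pos.2 h0
      have h6 : √s * √s ≤ √s * (c * M) := by
        rw [Real.mul_self_sqrt hs0]; linarith
      exact le_of_mul_le_mul_left h6 h5
    calc s = √s ^ 2 := (Real.sq_sqrt hs0).symm
      _ ≤ (c * M) ^ 2 := by gcongr

theorem norm_adj_le (T : X →L[ℝ] Y) : ‖adj T‖ ≤ ‖T‖ :=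
  ContinuousLinearMap.opNorm_le_bound _ (norm_nonneg _) fun f => by
    change ‖f.comp T‖ ≤ _
    rw [mul_comm]
    exact f.opNorm_comp_le T

theorem SummingBound.comp_right {Z : Type*} [NormedAddCommGroup Z] [NormedSpace ℝ Z]
    {k : ℕ} (hk : k ≠ 0) {T : X →L[ℝ] Y} {c : ℝ} (h : SummingBound k T c) (R : Z →L[ℝ] X) :
    SummingBound k (T.comp R) (c * ‖R‖) := by
  intro n x M hM hx
  have := h n (fun i => R (x i)) (‖R‖ * M) (by positivity) (fun f hf => by
    rcases (norm_nonneg R).eq_or_lt with h0 | h0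
    · have : R = 0 := norm_eq_zero.1 h0.symm
      simp [this, hk]
    · have h1 := hx (‖R‖⁻¹ • f.comp R) (by
        rw [norm_smul, norm_inv, norm_norm]
        rw [inv_mul_le_iff₀ h0]
        calc ‖f.comp R‖ ≤ ‖f‖ * ‖R‖ := f.opNorm_comp_le R
          _ ≤ 1 * ‖R‖ := by gcongr
          _ = ‖R‖ * 1 := by ring)
      have h2 : ∀ i, |f (R (x i))| ^ k = ‖R‖ ^ k * |(‖R‖⁻¹ • f.comp R) (x i)| ^ k := by
        intro i
        rw [← mul_pow]
        congr 1
        simp only [_root_.smul_apply, ContinuousLinearMap.comp_apply, smul_eq_mul,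
          abs_mul, abs_inv, abs_norm]
        field_simp
      simp_rw [h2]
      rw [← Finset.mul_sum, mul_pow]
      gcongr)
  rw [mul_assoc]
  exact this

theorem SummingBound.comp_left {Z : Type*} [NormedAddCommGroup Z] [NormedSpace ℝ Z]
    {k : ℕ} {T : X →L[ℝ] Y} {c : ℝ} (h : SummingBound k T c) (R : Y →L[ℝ] Z) :
    SummingBound k (R.comp T) (‖R‖ * c) := by
  intro n x M hM hx
  calc ∑ i, ‖R (T (x i))‖ ^ k ≤ ∑ i, (‖R‖ * ‖T (x i)‖) ^ k := by
        gcongr with i; exact R.le_opNorm _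
    _ = ‖R‖ ^ k * ∑ i, ‖T (x i)‖ ^ k := by rw [Finset.mul_sum]; simp_rw [mul_pow]
    _ ≤ ‖R‖ ^ k * (c * M) ^ k := by gcongr; exact h n x M hM hx
    _ = (‖R‖ * c * M) ^ k := by rw [← mul_pow]; ring

end SummingBounds

/-! ### Domination of `(p, 1)`-summing maps on finite-dimensional sup-norm spaces -/

section Domination

variable {X : Type*} [NormedAddCommGroup X] [NormedSpace ℝ X]

/-- The graph of a convex power lies above its tangents. In the induction, multiplying by `b` leaves
the nonnegative excess `(q + 1) a^q (b - a)²`. -/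
theorem pow_succ_tangent_le (q : ℕ) {a b : ℝ} (ha : 0 ≤ a) (hb : 0 ≤ b) :
    a ^ (q + 1) + (q + 1) * a ^ q * (b - a) ≤ b ^ (q + 1) := by
  induction q with
  | zero => simp
  | succ q ih =>
    have h1 : b * (a ^ (q + 1) + (q + 1) * a ^ q * (b - a)) ≤ b * b ^ (q + 1) := by gcongr
    have h2 : 0 ≤ (q + 1) * a ^ q * (b - a) ^ 2 := by positivity
    push_cast
    have h3 : b ^ (q + 1 + 1) - (a ^ (q + 1 + 1) + (q + 1 + 1) * a ^ (q + 1) * (b - a)) =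
        (b * b ^ (q + 1) - b * (a ^ (q + 1) + (q + 1) * a ^ q * (b - a))) +
          (q + 1) * a ^ q * (b - a) ^ 2 := by ring
    linarith

variable {J : Type*} [Fintype J]

/-- One step of Pisier's domination argument: a near-extremal family for the `(q+1, 1)`-summing
inequality provides a weight controlling `u` up to `ε`. -/
theorem exists_weight_add (u : (J → ℝ) →ₗ[ℝ] X) (q : ℕ) {D : ℝ}
    (hD : ∀ (n : ℕ) (x : Fin n → J → ℝ), (∀ j, ∑ i, |x i j| ≤ 1) →
      ∑ i, ‖u (x i)‖ ^ (q + 1) ≤ D) {ε : ℝ} (hε : 0 < ε) :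
    ∃ m : J → ℝ, (∀ j, 0 ≤ m j) ∧ ∑ j, m j ≤ 2 * D ∧
      ∀ x : J → ℝ, (∀ j, |x j| ≤ 1) → ‖u x‖ ^ (q + 1) ≤ ε + (q + 1) * ∑ j, m j * |x j| := by
  classical
  set S : Set ℝ := {t | ∃ (n : ℕ) (x : Fin n → J → ℝ), (∀ j, ∑ i, |x i j| ≤ 1) ∧
    t = ∑ i, ‖u (x i)‖ ^ (q + 1)} with hS
  have hbdd : BddAbove S := ⟨D, by rintro t ⟨n, x, hx, rfl⟩; exact hD n x hx⟩
  have hne : S.Nonempty := ⟨0, 0, fun i => i.elim0, by simp, by simp⟩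
  -- A family whose sum is within `ε` of the supremum; it cannot gain more than `ε` under any
  -- admissible modification.
  obtain ⟨t, ⟨n, x, hx, rfl⟩, ht⟩ := exists_lt_of_lt_csSup hne (sub_lt_self (sSup S) hε)
  choose ξ hξ1 hξ using fun i => exists_dual_vector'' ℝ (u (x i))
  set a : Fin n → ℝ := fun i => ‖u (x i)‖ with ha
  -- Up to the factor `q + 1`, this is the first-order change of the extremal sum when every `x i`
  -- is multiplied by a function. It is a signed weight; its absolute value is the weight used.
  set μ : J → ℝ := fun j => ∑ i, a i ^ q * ξ i (u (Pi.single j (x i j))) with hμ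
  have hμf : ∀ f : J → ℝ, ∑ j, μ j * f j = ∑ i, a i ^ q * ξ i (u (f * x i)) := by
    intro f
    have h1 : ∀ i, f * x i = ∑ j, f j • Pi.single j (x i j) := by
      intro i
      ext k
      simp [Finset.sum_apply, Pi.single_apply]
    simp_rw [h1, map_sum, map_smul, hμ, Finset.sum_mul, Finset.mul_sum]
    rw [Finset.sum_comm]
    refine Finset.sum_congr rfl fun i _ => Finset.sum_congr rfl fun j _ => ?_
    simp only [smul_eq_mul]; ring
  refine ⟨fun j => |μ j|, fun j => abs_nonneg _, ?_, ?_⟩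
  · set σ : J → ℝ := fun j => (SignType.sign (μ j) : ℝ) with hσ
    have hσ1 : ∀ j, |σ j| ≤ 1 := by
      intro j
      rcases lt_trichotomy (μ j) 0 with h | h | h <;> simp [hσ, h]
    have h1 : ∑ j, |μ j| = ∑ j, μ j * σ j := by simp [hσ, self_mul_sign]
    have h2 : ∑ i, ‖u (σ * x i)‖ ^ (q + 1) ≤ D := hD n _ fun j => by
      refine le_trans (Finset.sum_le_sum fun i _ => ?_) (hx j)
      simp only [Pi.mul_apply, abs_mul]
      exact mul_le_of_le_one_left (abs_nonneg _) (hσ1 j)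
    have h3 := hD n x hx
    rw [h1, hμf]
    calc ∑ i, a i ^ q * ξ i (u (σ * x i))
        ≤ ∑ i, (a i ^ (q + 1) + ‖u (σ * x i)‖ ^ (q + 1)) := by
          refine Finset.sum_le_sum fun i _ => ?_
          have ha0 : 0 ≤ a i := norm_nonneg _
          have hle : ξ i (u (σ * x i)) ≤ ‖u (σ * x i)‖ := by
            calc ξ i (u (σ * x i)) ≤ ‖ξ i‖ * ‖u (σ * x i)‖ :=
                  (le_abs_self _).trans ((ξ i).le_opNorm _)
              _ ≤ 1 * ‖u (σ * x i)‖ := by gcongr; exact hξ1 i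
              _ = _ := one_mul _
          refine (mul_le_mul_of_nonneg_left hle (pow_nonneg ha0 q)).trans ?_
          have hb0 : 0 ≤ ‖u (σ * x i)‖ := norm_nonneg _
          rcases le_total (a i) ‖u (σ * x i)‖ with h | h
          · calc a i ^ q * ‖u (σ * x i)‖ ≤ ‖u (σ * x i)‖ ^ q * ‖u (σ * x i)‖ := by gcongr
              _ = ‖u (σ * x i)‖ ^ (q + 1) := (pow_succ _ _).symm
              _ ≤ _ := le_add_of_nonneg_left (by positivity)
          · calc a i ^ q * ‖u (σ * x i)‖ ≤ a i ^ q * a i := by gcongr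
              _ = a i ^ (q + 1) := (pow_succ _ _).symm
              _ ≤ _ := le_add_of_nonneg_right (by positivity)
      _ = ∑ i, a i ^ (q + 1) + ∑ i, ‖u (σ * x i)‖ ^ (q + 1) := Finset.sum_add_distrib
      _ ≤ 2 * D := by linarith
  · intro y hy
    -- Shrinking the extremal family by `1 - |y|` makes room for `y` as an additional member.
    -- Near-maximality then bounds `‖u y‖^(q+1)` by `ε` plus the loss from shrinking, and the
    -- tangent inequality bounds that loss linearly in `|y|`.
    set z : Fin n → J → ℝ := fun i => (fun j => 1 - |y j|) * x i with hz
    have hmem : ‖u y‖ ^ (q + 1) + ∑ i, ‖u (z i)‖ ^ (q + 1) ≤ sSup S := by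
      refine le_csSup hbdd ⟨n + 1, Fin.cons y z, fun j => ?_, ?_⟩
      · rw [Fin.sum_univ_succ]
        simp only [Fin.cons_zero, Fin.cons_succ, hz, Pi.mul_apply, abs_mul]
        rw [← Finset.mul_sum, abs_of_nonneg (by linarith [hy j] : 0 ≤ 1 - |y j|)]
        nlinarith [hx j, hy j, abs_nonneg (y j)]
      · rw [Fin.sum_univ_succ]
        simp
    have hlow : ∀ i, a i ^ (q + 1) - (q + 1) * (a i ^ q * ξ i (u ((fun j => |y j|) * x i)))
        ≤ ‖u (z i)‖ ^ (q + 1) := by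
      intro i
      have ha0 : 0 ≤ a i := norm_nonneg _
      have h1 := pow_succ_tangent_le q ha0 (norm_nonneg (u (z i)))
      have h2 : a i - ξ i (u ((fun j => |y j|) * x i)) ≤ ‖u (z i)‖ := by
        have h3 : u (z i) = u (x i) - u ((fun j => |y j|) * x i) := by
          rw [← map_sub]; congr 1; ext j; simp [hz]; ring
        calc a i - ξ i (u ((fun j => |y j|) * x i)) = ξ i (u (z i)) := by
              rw [h3, map_sub, hξ i]; rfl
          _ ≤ ‖ξ i‖ * ‖u (z i)‖ := (le_abs_self _).trans ((ξ i).le_opNorm _)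
          _ ≤ 1 * ‖u (z i)‖ := by gcongr; exact hξ1 i
          _ = _ := one_mul _
      have h4 : (q + 1) * a i ^ q * (-(ξ i (u ((fun j => |y j|) * x i))))
          ≤ (q + 1) * a i ^ q * (‖u (z i)‖ - a i) := by
        gcongr; linarith
      linarith
    have hsum := Finset.sum_le_sum fun i (_ : i ∈ Finset.univ) => hlow i
    rw [Finset.sum_sub_distrib, ← Finset.mul_sum, ← hμf (fun j => |y j|)] at hsum
    have h5 : ∑ j, μ j * |y j| ≤ ∑ j, |μ j| * |y j| := by
      gcongr with j; exact le_abs_self _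
    have h6 : ((q : ℝ) + 1) * ∑ j, μ j * |y j| ≤ (q + 1) * ∑ j, |μ j| * |y j| := by gcongr
    linarith

/-- The weights for `ε = 1 / (n + 1)` all lie in one compact box, so a subsequence converges to a
weight without error term. -/
theorem exists_weight_of_summing (u : (J → ℝ) →ₗ[ℝ] X) (q : ℕ) {D : ℝ}
    (hD : ∀ (n : ℕ) (x : Fin n → J → ℝ), (∀ j, ∑ i, |x i j| ≤ 1) →
      ∑ i, ‖u (x i)‖ ^ (q + 1) ≤ D) :
    ∃ m : J → ℝ, (∀ j, 0 ≤ m j) ∧ ∑ j, m j ≤ 2 * D ∧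
      ∀ x : J → ℝ, (∀ j, |x j| ≤ 1) → ‖u x‖ ^ (q + 1) ≤ (q + 1) * ∑ j, m j * |x j| := by
  choose m hm0 hms hm using fun n : ℕ =>
    exists_weight_add u q hD (ε := 1 / ((n : ℝ) + 1)) (by positivity)
  have hmem : ∀ n, m n ∈ Set.Icc (0 : J → ℝ) (fun _ => 2 * D) := fun n =>
    ⟨fun j => hm0 n j, fun j => (Finset.single_le_sum (fun j _ => hm0 n j)
      (Finset.mem_univ j)).trans (hms n)⟩
  obtain ⟨w, hw, φ, hφ, hlim⟩ := isCompact_Icc.tendsto_subseq hmem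
  have hlimj : ∀ j, Tendsto (fun n => m (φ n) j) atTop (𝓝 (w j)) := fun j =>
    (continuous_apply j).continuousAt.tendsto.comp hlim
  refine ⟨w, fun j => hw.1 j, ?_, fun x hx => ?_⟩
  · exact le_of_tendsto (tendsto_finsetSum _ fun j _ => hlimj j)
      (Eventually.of_forall fun n => hms (φ n))
  · have h1 : Tendsto (fun n => 1 / ((φ n : ℝ) + 1) + (q + 1) * ∑ j, m (φ n) j * |x j|) atTop
        (𝓝 (0 + (q + 1) * ∑ j, w j * |x j|)) :=
      ((tendsto_one_div_add_atTop_nhds_zero_nat (𝕜 := ℝ)).comp hφ.tendsto_atTop).add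
        ((tendsto_finsetSum _ fun j _ => (hlimj j).mul_const _).const_mul _)
    rw [zero_add] at h1
    exact ge_of_tendsto h1 (Eventually.of_forall fun n => hm (φ n) x hx)

/-- Truncation of a function at height `t`. -/
def clamp (t : ℝ) (y : J → ℝ) : J → ℝ := fun j => max (-t) (min t (y j))

/-- Real interpolation by hand. The hypothesis is efficient only for functions close to multiples of
an indicator, so `y` is cut at the heights `2^i A`; the `L_{2(q+1)}` bound makes the contributions
of the layers decay geometrically. -/
theorem norm_le_of_weight (u : (J → ℝ) →ₗ[ℝ] X) (q : ℕ) {m : J → ℝ} (hm0 : ∀ j, 0 ≤ m j)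
    (hm : ∀ x : J → ℝ, (∀ j, |x j| ≤ 1) → ‖u x‖ ^ (q + 1) ≤ (q + 1) * ∑ j, m j * |x j|)
    {R : ℝ} (hR0 : 0 ≤ R) (hR : (q + 1) * ∑ j, m j ≤ R ^ (q + 1)) (y : J → ℝ) {A : ℝ}
    (hA : 0 < A) (hy : ∑ j, m j * |y j| ^ (2 * (q + 1)) ≤ A ^ (2 * (q + 1))) :
    ‖u y‖ ≤ (R + 4) * A := by
  have hscale : ∀ (t : ℝ), 0 < t → ∀ x : J → ℝ, (∀ j, |x j| ≤ t) →
      ‖u x‖ ^ (q + 1) ≤ (q + 1) * t ^ q * ∑ j, m j * |x j| := by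
    intro t ht x hx
    have h1 := hm (t⁻¹ • x) fun j => by
      simp only [Pi.smul_apply, smul_eq_mul, abs_mul, abs_inv, abs_of_pos ht]
      rw [inv_mul_le_iff₀ ht, mul_one]; exact hx j
    rw [map_smul, norm_smul, norm_inv, Real.norm_of_nonneg ht.le, mul_pow, inv_pow,
      inv_mul_le_iff₀ (by positivity)] at h1
    refine h1.trans (le_of_eq ?_)
    simp only [Pi.smul_apply, smul_eq_mul, abs_mul, abs_inv, abs_of_pos ht]
    have h2 : ∑ j, m j * (t⁻¹ * |x j|) = t⁻¹ * ∑ j, m j * |x j| := by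
      rw [Finset.mul_sum]; exact Finset.sum_congr rfl fun j _ => by ring
    rw [h2, pow_succ]; field_simp
  have hc0 : ‖u (clamp A y)‖ ≤ R * A := by
    have hcl : ∀ j, |clamp A y j| ≤ A := fun j => by
      rw [abs_le]; exact ⟨le_max_left _ _, max_le (by linarith) (min_le_left _ _)⟩
    have h1 := hscale A hA _ hcl
    refine le_of_pow_le_pow_left₀ (n := q + 1) (by simp) (by positivity) (h1.trans ?_)
    calc (q + 1) * A ^ q * ∑ j, m j * |clamp A y j| ≤ (q + 1) * A ^ q * ∑ j, m j * A := by
          gcongr with j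
          · exact hm0 j
          · exact hcl j
      _ = ((q + 1) * ∑ j, m j) * A ^ (q + 1) := by rw [← Finset.sum_mul]; ring
      _ ≤ R ^ (q + 1) * A ^ (q + 1) := by gcongr
      _ = _ := (mul_pow _ _ _).symm
  have hstep : ∀ i : ℕ, ‖u (clamp (2 ^ (i + 1) * A) y) - u (clamp (2 ^ i * A) y)‖
      ≤ 2 * A / 2 ^ i := by
    intro i
    set t : ℝ := 2 ^ i * A with ht
    have ht0 : 0 < t := by positivity
    have h2t : 2 ^ (i + 1) * A = 2 * t := by rw [ht]; ring
    rw [h2t, ← map_sub]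
    set d : J → ℝ := clamp (2 * t) y - clamp t y with hd
    -- The layer between heights `t` and `2t` is bounded by `t` and lives where `|y| ≥ t`. Hence
    -- each `|d j| t^(2q+1)` is at most `|y j|^(2q+2)`, a Chebyshev estimate that gains a power of
    -- `t`.
    have hdj : ∀ j, |d j| ≤ t ∧ (|d j| = 0 ∨ t ≤ |y j|) := by
      intro j
      simp only [hd, clamp, Pi.sub_apply]
      rcases le_total (y j) 0 with h0 | h0
      · rw [abs_of_nonpos h0, min_eq_right (by linarith : y j ≤ 2 * t),
          min_eq_right (by linarith : y j ≤ t)]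
        rcases le_total (-t) (y j) with h1 | h1
        · rw [max_eq_right h1, max_eq_right (by linarith)]; simp [ht0.le]
        · rw [max_eq_left h1]
          refine ⟨?_, Or.inr (by linarith)⟩
          rw [abs_le]
          exact ⟨by linarith [le_max_left (-(2 * t)) (y j)],
            by linarith [max_le (by linarith : -(2 * t) ≤ 0) h0]⟩
      · rw [abs_of_nonneg h0]
        rcases le_total (y j) t with h1 | h1
        · rw [min_eq_right h1, min_eq_right (by linarith : y j ≤ 2 * t),
            max_eq_right (by linarith), max_eq_right (by linarith)]
          simp [ht0.le]
        · rw [min_eq_left h1, max_eq_right (by linarith : -t ≤ t),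
            max_eq_right ((by linarith : -(2 * t) ≤ 0).trans (le_min (by linarith) h0))]
          refine ⟨?_, Or.inr h1⟩
          rw [abs_le]
          exact ⟨by linarith [le_min (by linarith : 0 ≤ 2 * t) h0],
            by linarith [min_le_left (2 * t) (y j)]⟩
    have h1 := hscale t ht0 d fun j => (hdj j).1
    have h2 : ∑ j, m j * |d j| * t ^ (q + (q + 1)) ≤ A ^ (2 * (q + 1)) := by
      refine le_trans (Finset.sum_le_sum fun j _ => ?_) hy
      rw [mul_assoc]
      refine mul_le_mul_of_nonneg_left ?_ (hm0 j)
      rcases (hdj j).2 with h | h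
      · rw [h, zero_mul]; positivity
      · calc |d j| * t ^ (q + (q + 1)) ≤ t * t ^ (q + (q + 1)) := by gcongr; exact (hdj j).1
          _ = t ^ (2 * (q + 1)) := by ring
          _ ≤ _ := by gcongr
    have h3 : (t * ‖u d‖) ^ (q + 1) ≤ (2 * A ^ 2) ^ (q + 1) := by
      calc (t * ‖u d‖) ^ (q + 1) = t ^ (q + 1) * ‖u d‖ ^ (q + 1) := mul_pow _ _ _
        _ ≤ t ^ (q + 1) * ((q + 1) * t ^ q * ∑ j, m j * |d j|) := by gcongr
        _ = (q + 1) * ∑ j, m j * |d j| * t ^ (q + (q + 1)) := by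
            rw [← Finset.sum_mul]; ring
        _ ≤ 2 ^ (q + 1) * A ^ (2 * (q + 1)) := by
            have h4 : ((q : ℝ) + 1) ≤ 2 ^ (q + 1) := by
              exact_mod_cast (Nat.lt_two_pow_self (n := q + 1)).le
            have h7 : 0 ≤ ∑ j, m j * |d j| * t ^ (q + (q + 1)) := Finset.sum_nonneg fun j _ =>
              mul_nonneg (mul_nonneg (hm0 j) (abs_nonneg _)) (by positivity)
            gcongr
        _ = _ := by rw [mul_pow, ← pow_mul]
    have h5 := le_of_pow_le_pow_left₀ (n := q + 1) (by simp) (by positivity) h3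
    rw [le_div_iff₀ (by positivity)]
    have h6 : A * (‖u d‖ * 2 ^ i) ≤ A * (2 * A) := by
      rw [ht] at h5; nlinarith
    exact le_of_mul_le_mul_left h6 hA
  have hind : ∀ n : ℕ, ‖u (clamp (2 ^ n * A) y)‖ ≤ R * A + (4 * A - 4 * A / 2 ^ n) := by
    intro n
    induction n with
    | zero => simpa using hc0
    | succ n ih =>
      have h1 := hstep n
      have h2 : ‖u (clamp (2 ^ (n + 1) * A) y)‖ ≤ ‖u (clamp (2 ^ n * A) y)‖ +
          ‖u (clamp (2 ^ (n + 1) * A) y) - u (clamp (2 ^ n * A) y)‖ := norm_le_insert' _ _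
      have h3 : 4 * A / 2 ^ (n + 1) = 2 * A / 2 ^ n := by rw [pow_succ]; field_simp; ring
      have h4 : 4 * A / 2 ^ n = 2 * (2 * A / 2 ^ n) := by ring
      rw [h3]; linarith
  -- The index set is finite, so truncation at a sufficiently large height changes nothing and no
  -- limit is required.
  obtain ⟨n, hn⟩ := pow_unbounded_of_one_lt ((∑ j, |y j|) / A) (one_lt_two (α := ℝ))
  have hcl : clamp (2 ^ n * A) y = y := by
    ext j
    have h1 : |y j| ≤ 2 ^ n * A := by
      have h2 := Finset.single_le_sum (fun j _ => abs_nonneg (y j)) (Finset.mem_univ j)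
      rw [div_lt_iff₀ hA] at hn
      linarith
    rw [abs_le] at h1
    simp [clamp, h1.1, h1.2]
  have h1 := hind n
  rw [hcl] at h1
  have h2 : 0 ≤ 4 * A / 2 ^ n := by positivity
  nlinarith

/-- An operator on `ℓ_∞^J` satisfying the `(p, 1)`-summing inequality is dominated by an
`L_{2p}`-seminorm. -/
theorem exists_weight_pow (u : (J → ℝ) →ₗ[ℝ] X) {p : ℕ} (hp : p ≠ 0) {D : ℝ}
    (hD : ∀ (n : ℕ) (x : Fin n → J → ℝ), (∀ j, ∑ i, |x i j| ≤ 1) →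
      ∑ i, ‖u (x i)‖ ^ p ≤ D) :
    ∃ m : J → ℝ, (∀ j, 0 ≤ m j) ∧ ∑ j, m j ≤ 2 * D ∧
      ∀ y : J → ℝ, ‖u y‖ ^ (2 * p) ≤
        (2 * p * D + 5) ^ (2 * p) * ∑ j, m j * |y j| ^ (2 * p) := by
  obtain ⟨q, rfl⟩ := Nat.exists_eq_succ_of_ne_zero hp
  obtain ⟨m, hm0, hms, hm⟩ := exists_weight_of_summing u q hD
  refine ⟨m, hm0, hms, fun y => ?_⟩
  have hD0 : 0 ≤ D := by simpa using hD 0 (fun i => i.elim0) (by simp)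
  set s := ∑ j, m j * |y j| ^ (2 * (q + 1)) with hs
  have hs0 : 0 ≤ s := Finset.sum_nonneg fun j _ => mul_nonneg (hm0 j) (by positivity)
  set R : ℝ := 2 * (q + 1 : ℕ) * D + 1 with hR
  have hR1 : 1 ≤ R := by rw [hR]; have : 0 ≤ 2 * ((q + 1 : ℕ) : ℝ) * D := by positivity
                         linarith
  have hRp : (q + 1) * ∑ j, m j ≤ R ^ (q + 1) := by
    calc (q + 1) * ∑ j, m j ≤ (q + 1) * (2 * D) := by gcongr
      _ ≤ R := by rw [hR]; push_cast; linarith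
      _ = R ^ 1 := (pow_one R).symm
      _ ≤ R ^ (q + 1) := pow_le_pow_right₀ hR1 (by omega)
  -- The perturbation `δ` keeps the truncation scale `A` positive even if the seminorm of `y`
  -- vanishes; it is removed by a limit at the end.
  have hlim : ∀ δ : ℝ, 0 < δ → ‖u y‖ ^ (2 * (q + 1)) ≤ (R + 4) ^ (2 * (q + 1)) * (s + δ) := by
    intro δ hδ
    set A : ℝ := (s + δ) ^ (((2 * (q + 1) : ℕ) : ℝ)⁻¹) with hA
    have hA0 : 0 < A := by positivity
    have hAp : A ^ (2 * (q + 1)) = s + δ :=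
      Real.rpow_inv_natCast_pow (by positivity) (by omega)
    have h1 := norm_le_of_weight u q hm0 hm (by linarith) hRp y hA0 (by rw [hAp]; linarith)
    calc ‖u y‖ ^ (2 * (q + 1)) ≤ ((R + 4) * A) ^ (2 * (q + 1)) := by gcongr
      _ = _ := by rw [mul_pow, hAp]
  have hRR : (2 : ℝ) * (q + 1 : ℕ) * D + 5 = R + 4 := by rw [hR]; ring
  rw [Nat.succ_eq_add_one, hRR]
  have hc : Tendsto (fun δ : ℝ => (R + 4) ^ (2 * (q + 1)) * (s + δ)) (𝓝[>] 0)
      (𝓝 ((R + 4) ^ (2 * (q + 1)) * (s + 0))) :=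
    ((continuous_const.mul (continuous_const.add continuous_id)).tendsto 0).mono_left
      nhdsWithin_le_nhds
  rw [add_zero] at hc
  exact ge_of_tendsto hc (by filter_upwards [self_mem_nhdsWithin] with δ hδ using hlim δ hδ)

end Domination

/-! ### Sign averages and their moments -/

section SignAverages

/-- The uniform average over all choices of signs. -/
def signAvg {n : ℕ} (F : (Fin n → ℤˣ) → ℝ) : ℝ := ((2 : ℝ) ^ n)⁻¹ * ∑ ε, F ε

theorem signAvg_mono {n : ℕ} {F G : (Fin n → ℤˣ) → ℝ} (h : ∀ ε, F ε ≤ G ε) :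
    signAvg F ≤ signAvg G := by
  unfold signAvg
  gcongr with ε
  exact h ε

theorem signAvg_const {n : ℕ} (c : ℝ) : signAvg (fun _ : Fin n → ℤˣ => c) = c := by
  simp [signAvg]

theorem signAvg_mul_left {n : ℕ} (c : ℝ) (F : (Fin n → ℤˣ) → ℝ) :
    signAvg (fun ε => c * F ε) = c * signAvg F := by
  simp only [signAvg, ← Finset.mul_sum]; ring

theorem signAvg_add {n : ℕ} (F G : (Fin n → ℤˣ) → ℝ) :
    signAvg (fun ε => F ε + G ε) = signAvg F + signAvg G := by
  simp only [signAvg, Finset.sum_add_distrib]; ring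

theorem signAvg_sum {n : ℕ} {J : Type*} (s : Finset J) (F : J → (Fin n → ℤˣ) → ℝ) :
    signAvg (fun ε => ∑ j ∈ s, F j ε) = ∑ j ∈ s, signAvg (F j) := by
  simp only [signAvg]
  rw [Finset.sum_comm, Finset.mul_sum]

theorem signAvg_nonneg {n : ℕ} {F : (Fin n → ℤˣ) → ℝ} (h : ∀ ε, 0 ≤ F ε) : 0 ≤ signAvg F :=
  mul_nonneg (by positivity) (Finset.sum_nonneg fun ε _ => h ε)

theorem signAvg_sq_le {n : ℕ} (F : (Fin n → ℤˣ) → ℝ) :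
    signAvg F ^ 2 ≤ signAvg (fun ε => F ε ^ 2) := by
  have h := sq_sum_le_card_mul_sum_sq (s := (Finset.univ : Finset (Fin n → ℤˣ))) (f := F)
  have hc : ((Finset.univ : Finset (Fin n → ℤˣ)).card : ℝ) = 2 ^ n := by simp
  rw [hc] at h
  unfold signAvg
  rw [mul_pow]
  calc ((2 : ℝ) ^ n)⁻¹ ^ 2 * (∑ ε, F ε) ^ 2
      ≤ ((2 : ℝ) ^ n)⁻¹ ^ 2 * (2 ^ n * ∑ ε, F ε ^ 2) := by gcongr
    _ = _ := by field_simp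

theorem signAvg_succ {n : ℕ} (F : (Fin (n + 1) → ℤˣ) → ℝ) :
    signAvg F = signAvg (fun ε => (F (Fin.cons 1 ε) + F (Fin.cons (-1) ε)) / 2) := by
  have h1 : ∑ ε, F ε = ∑ e : ℤˣ, ∑ ε : Fin n → ℤˣ, F (Fin.cons e ε) := by
    rw [← (Fin.consEquiv (fun _ : Fin (n + 1) => ℤˣ)).sum_comp, Fintype.sum_prod_type]
    rfl
  have h2 : ∀ G : ℤˣ → ℝ, ∑ e : ℤˣ, G e = G 1 + G (-1) := by
    intro G
    rw [show (Finset.univ : Finset ℤˣ) = {1, -1} from rfl, Finset.sum_pair (by decide)]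
  unfold signAvg
  rw [h1, h2, ← Finset.sum_add_distrib, ← Finset.sum_div, pow_succ]
  field_simp

/-- Independent signs are orthogonal: averaging over the first sign cancels its cross term with the
remaining sum. -/
theorem signAvg_sq_sum {n : ℕ} (a : Fin n → ℝ) :
    signAvg (fun ε => (∑ i, ((ε i : ℤ) : ℝ) * a i) ^ 2) = ∑ i, a i ^ 2 := by
  induction n with
  | zero => simp [signAvg]
  | succ n ih =>
    rw [signAvg_succ, Fin.sum_univ_succ, ← ih (fun i => a i.succ)]
    simp only [Fin.sum_univ_succ, Fin.cons_zero, Fin.cons_succ]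
    rw [← signAvg_const (n := n) (a 0 ^ 2), ← signAvg_add]
    congr 1
    ext ε
    push_cast
    ring

/-- Khintchine's inequality for the fourth moment. -/
theorem signAvg_fourth_sum_le {n : ℕ} (a : Fin n → ℝ) :
    signAvg (fun ε => (∑ i, ((ε i : ℤ) : ℝ) * a i) ^ 4) ≤ 3 * (∑ i, a i ^ 2) ^ 2 := by
  induction n with
  | zero => simp [signAvg]
  | succ n ih =>
    have h1 := ih (fun i => a i.succ)
    have h2 := signAvg_sq_sum (fun i => a i.succ)
    rw [signAvg_succ, Fin.sum_univ_succ (fun i => a i ^ 2)]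
    simp only [Fin.sum_univ_succ, Fin.cons_zero, Fin.cons_succ]
    set S : (Fin n → ℤˣ) → ℝ := fun ε => ∑ i, ((ε i : ℤ) : ℝ) * a i.succ with hS
    -- Averaging over the first sign removes the odd powers of `a 0`. What is left, `a₀⁴ + 6 a₀² σ +
    -- 3 σ²` with `σ` the remaining sum of squares, is at most `3 (a₀² + σ)²`.
    have h3 : (fun ε : Fin n → ℤˣ =>
        (((((1 : ℤˣ) : ℤ) : ℝ) * a 0 + ∑ i, ((ε i : ℤ) : ℝ) * a i.succ) ^ 4 +
        ((((-1 : ℤˣ) : ℤ) : ℝ) * a 0 + ∑ i, ((ε i : ℤ) : ℝ) * a i.succ) ^ 4) / 2) =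
        fun ε => (a 0 ^ 4 + (6 * a 0 ^ 2) * S ε ^ 2) + S ε ^ 4 := by
      ext ε
      simp only [hS]
      push_cast
      ring
    rw [h3, signAvg_add, signAvg_add, signAvg_const, signAvg_mul_left]
    simp only [hS]
    rw [h2]
    nlinarith [sq_nonneg (a 0), sq_nonneg (a 0 ^ 2)]

end SignAverages

/-! ### Operators from `ℓ_∞^n` into spaces of finite cotype -/

section CotypeOperators

variable {X : Type*} [NormedAddCommGroup X] [NormedSpace ℝ X]

theorem sq_rademacherAverage {n : ℕ} (x : Fin n → X) :
    rademacherAverage x ^ 2 = signAvg (fun ε => ‖∑ i, ((ε i : ℤ) : ℝ) • x i‖ ^ 2) :=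
  Real.sq_sqrt (signAvg_nonneg fun ε => by positivity)

theorem rademacherAverage_nonneg {n : ℕ} (x : Fin n → X) : 0 ≤ rademacherAverage x :=
  Real.sqrt_nonneg _

theorem rademacherAverage_le {n : ℕ} (x : Fin n → X) {M : ℝ} (hM : 0 ≤ M)
    (h : ∀ ε : Fin n → ℤˣ, ‖∑ i, ((ε i : ℤ) : ℝ) • x i‖ ≤ M) : rademacherAverage x ≤ M := by
  refine abs_le_of_sq_le_sq' ?_ hM |>.2
  rw [sq_rademacherAverage]
  calc _ ≤ signAvg (fun _ : Fin n → ℤˣ => M ^ 2) := signAvg_mono fun ε => by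
        gcongr; exact h ε
    _ = M ^ 2 := signAvg_const _

/-- The cotype inequality with a natural exponent. -/
def CotypeBound (X : Type*) [NormedAddCommGroup X] [NormedSpace ℝ X] (p : ℕ) (C : ℝ) : Prop :=
  0 ≤ C ∧ ∀ (n : ℕ) (x : Fin n → X), ∑ i, ‖x i‖ ^ p ≤ (C * rademacherAverage x) ^ p

/-- Cotype improves to larger exponents because `ℓ_p`-norms decrease in `p`. Passing to a natural
exponent and a nonnegative constant avoids real powers from here on. -/
theorem HasCotype.cotypeBound {q : ℝ} (hq : 0 < q) (h : HasCotype X q) {p : ℕ} (hp : q ≤ p) :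
    ∃ C, CotypeBound X p C := by
  obtain ⟨C, hC⟩ := h
  refine ⟨max C 0, le_max_right _ _, fun n x => ?_⟩
  have hp0 : (0 : ℝ) < p := hq.trans_le hp
  have hs : 0 ≤ ∑ i, ‖x i‖ ^ q := Finset.sum_nonneg fun i _ => by positivity
  have h1 : (∑ i, ‖x i‖ ^ q) ^ (1 / q) ≤ max C 0 * rademacherAverage x :=
    (hC n x).trans (by gcongr; exacts [rademacherAverage_nonneg x, le_max_left _ _])
  have h2 : ∀ i, ‖x i‖ ≤ (∑ i, ‖x i‖ ^ q) ^ (1 / q) := fun i => by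
    rw [one_div, Real.le_rpow_inv_iff_of_pos (norm_nonneg _) hs hq]
    exact Finset.single_le_sum (f := fun i => ‖x i‖ ^ q) (fun i _ => by positivity)
      (Finset.mem_univ i)
  set N := (∑ i, ‖x i‖ ^ q) ^ (1 / q) with hN
  have hN0 : 0 ≤ N := by positivity
  have h3 : ∑ i, ‖x i‖ ^ q = N ^ q := by
    rw [hN, ← Real.rpow_mul hs, one_div, inv_mul_cancel₀ hq.ne', Real.rpow_one]
  refine le_trans ?_ (pow_le_pow_left₀ hN0 h1 p)
  calc ∑ i, ‖x i‖ ^ p ≤ ∑ i, ‖x i‖ ^ q * N ^ ((p : ℝ) - q) := by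
        refine Finset.sum_le_sum fun i _ => ?_
        rcases (norm_nonneg (x i)).eq_or_lt with h0 | h0
        · rw [← h0, zero_pow (by rintro rfl; simp at hp0)]
          positivity
        · have h4 : ‖x i‖ ^ p = ‖x i‖ ^ q * ‖x i‖ ^ ((p : ℝ) - q) := by
            rw [← Real.rpow_add h0, ← Real.rpow_natCast]
            congr 1; ring
          rw [h4]
          exact mul_le_mul_of_nonneg_left
            (Real.rpow_le_rpow h0.le (h2 i) (by linarith)) (by positivity)
    _ = N ^ q * N ^ ((p : ℝ) - q) := by rw [← Finset.sum_mul, h3]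
    _ ≤ N ^ p := by
        rcases hN0.eq_or_lt with h0 | h0
        · rw [← h0, Real.zero_rpow hq.ne', zero_mul]; positivity
        · rw [← Real.rpow_add h0, ← Real.rpow_natCast]
          simp

/-- Operators from `ℓ_∞^J` into a space of cotype `p` are dominated by `L_{2p}`-seminorms. -/
theorem CotypeBound.exists_weight {p : ℕ} (hp : p ≠ 0) {C : ℝ} (hX : CotypeBound X p C) :
    ∃ K : ℝ, 0 ≤ K ∧ ∀ (n : ℕ) (u : (Fin n → ℝ) →ₗ[ℝ] X) (M : ℝ), 0 ≤ M →
      (∀ x : Fin n → ℝ, (∀ j, |x j| ≤ 1) → ‖u x‖ ≤ M) →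
      ∃ m : Fin n → ℝ, (∀ j, 0 ≤ m j) ∧ ∑ j, m j ≤ 1 ∧
        ∀ y : Fin n → ℝ, ‖u y‖ ^ (2 * p) ≤ (K * M) ^ (2 * p) * ∑ j, m j * |y j| ^ (2 * p) := by
  have hC := hX.1
  set K : ℝ := (2 * p * C ^ p + 5) * (2 * C ^ p + 1) with hK
  refine ⟨K, by positivity, fun n u M hM hu => ?_⟩
  -- For `M = 0` the map vanishes and cannot be normalised, so it is treated apart.
  rcases hM.eq_or_lt with h0 | h0
  · refine ⟨0, fun j => le_rfl, by simp, fun y => ?_⟩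
    have hy : ‖u y‖ = 0 := by
      set c : ℝ := ∑ j, |y j| + 1 with hc
      have hcpos : 0 < c := by positivity
      have h1 := hu (c⁻¹ • y) fun j => by
        simp only [Pi.smul_apply, smul_eq_mul, abs_mul, abs_inv, abs_of_pos hcpos]
        rw [inv_mul_le_iff₀ hcpos, mul_one, hc]
        have := Finset.single_le_sum (fun j _ => abs_nonneg (y j)) (Finset.mem_univ j)
        linarith
      rw [map_smul, norm_smul, ← h0] at h1
      have h2 : 0 < ‖c⁻¹‖ := norm_pos_iff.2 (inv_ne_zero hcpos.ne')
      nlinarith [norm_nonneg (u y)]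
    rw [hy, zero_pow (by omega)]
    simp
  -- Every signed sum of an admissible family stays in the unit ball of `ℓ_∞^n`, so the Rademacher
  -- average of its image under `M⁻¹ • u` is at most one, and cotype yields the `(p, 1)`-summing
  -- inequality.
  · have hD : ∀ (k : ℕ) (x : Fin k → Fin n → ℝ), (∀ j, ∑ i, |x i j| ≤ 1) →
        ∑ i, ‖(M⁻¹ • u) (x i)‖ ^ p ≤ C ^ p := by
      intro k x hx
      refine (hX.2 k fun i => (M⁻¹ • u) (x i)).trans ?_
      have hr : rademacherAverage (fun i => (M⁻¹ • u) (x i)) ≤ 1 := by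
        refine rademacherAverage_le _ zero_le_one fun ε => ?_
        have h1 : ∑ i, ((ε i : ℤ) : ℝ) • (M⁻¹ • u) (x i) =
            M⁻¹ • u (∑ i, ((ε i : ℤ) : ℝ) • x i) := by
          simp only [LinearMap.smul_apply, map_sum, map_smul, Finset.smul_sum]
          exact Finset.sum_congr rfl fun i _ => smul_comm _ _ _
        rw [h1, norm_smul, norm_inv, Real.norm_of_nonneg hM, inv_mul_le_iff₀ h0, mul_one]
        refine hu _ fun j => ?_
        rw [Finset.sum_apply]
        refine (Finset.abs_sum_le_sum_abs _ _).trans (le_trans (le_of_eq ?_) (hx j))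
        refine Finset.sum_congr rfl fun i _ => ?_
        rcases Int.units_eq_one_or (ε i) with h | h <;> simp [h]
      calc _ ≤ (C * 1) ^ p := by
            gcongr
            exact mul_nonneg hC (rademacherAverage_nonneg _)
        _ = C ^ p := by rw [mul_one]
    obtain ⟨m, hm0, hms, hm⟩ := exists_weight_pow (M⁻¹ • u) hp hD
    have hCp : 0 ≤ C ^ p := by positivity
    -- Dividing the weight by `L` brings its mass below one. The lost factor is paid for by the
    -- factor `L` in `K`, because `L ≤ L^(2p)`.
    set L : ℝ := 2 * C ^ p + 1 with hL
    have hL1 : 1 ≤ L := by linarith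
    refine ⟨fun j => L⁻¹ * m j, fun j => mul_nonneg (by positivity) (hm0 j), ?_, fun y => ?_⟩
    · rw [← Finset.mul_sum, inv_mul_le_iff₀ (by positivity)]
      linarith
    · have h1 := hm y
      rw [LinearMap.smul_apply, norm_smul, norm_inv, Real.norm_of_nonneg hM, mul_pow, inv_pow,
        inv_mul_le_iff₀ (by positivity)] at h1
      refine h1.trans ?_
      set s := ∑ j, m j * |y j| ^ (2 * p) with hs
      have hs0 : 0 ≤ s := Finset.sum_nonneg fun j _ => mul_nonneg (hm0 j) (by positivity)
      have h2 : ∑ j, L⁻¹ * m j * |y j| ^ (2 * p) = L⁻¹ * s := by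
        rw [hs, Finset.mul_sum]; exact Finset.sum_congr rfl fun j _ => by ring
      rw [h2, hK]
      have h3 : 1 ≤ L ^ (2 * p) * L⁻¹ := by
        rw [← div_eq_mul_inv, le_div_iff₀ (by positivity), one_mul]
        exact le_self_pow₀ hL1 (by omega)
      calc M ^ (2 * p) * ((2 * p * C ^ p + 5) ^ (2 * p) * s)
          = (M ^ (2 * p) * (2 * p * C ^ p + 5) ^ (2 * p)) * s * 1 := by ring
        _ ≤ (M ^ (2 * p) * (2 * p * C ^ p + 5) ^ (2 * p)) * s * (L ^ (2 * p) * L⁻¹) := by gcongr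
        _ = _ := by rw [mul_pow, mul_pow]; ring

/-- Operators from `ℓ_∞^n` into a space of cotype `2` are `2`-summing. -/
theorem CotypeBound.exists_two_summing {C : ℝ} (hX : CotypeBound X 2 C) :
    ∃ K : ℝ, 0 ≤ K ∧ ∀ (n : ℕ) (u : (Fin n → ℝ) →ₗ[ℝ] X) (M : ℝ), 0 ≤ M →
      (∀ x : Fin n → ℝ, (∀ j, |x j| ≤ 1) → ‖u x‖ ≤ M) →
      ∀ (k : ℕ) (y : Fin k → Fin n → ℝ) (B : ℝ), 0 ≤ B → (∀ j, ∑ i, y i j ^ 2 ≤ B ^ 2) →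
        ∑ i, ‖u (y i)‖ ^ 2 ≤ (K * M * B) ^ 2 := by
  obtain ⟨K, hK, hw⟩ := hX.exists_weight two_ne_zero
  refine ⟨C * K * 2, mul_nonneg (mul_nonneg hX.1 hK) (by norm_num),
    fun n u M hM hu k y B hB hy => ?_⟩
  obtain ⟨m, hm0, hms, hm⟩ := hw n u M hM hu
  refine (hX.2 k fun i => u (y i)).trans ?_
  rw [mul_pow]
  -- For `p = 2` the dominating seminorm is an `L₄`-seminorm, so the fourth moment of the Rademacher
  -- sum reduces coordinatewise to scalar Khintchine. The final constant uses `3 ≤ 2⁴`.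
  have h1 : rademacherAverage (fun i => u (y i)) ^ 2 ≤ (2 * K * M * B) ^ 2 := by
    refine abs_le_of_sq_le_sq' ?_ (by positivity) |>.2
    rw [sq_rademacherAverage]
    refine (signAvg_sq_le _).trans ?_
    calc signAvg (fun ε => (‖∑ i, ((ε i : ℤ) : ℝ) • u (y i)‖ ^ 2) ^ 2)
        ≤ signAvg (fun ε : Fin k → ℤˣ => (K * M) ^ 4 *
            ∑ j, m j * (∑ i, ((ε i : ℤ) : ℝ) * y i j) ^ 4) := by
          refine signAvg_mono fun ε => ?_
          have h2 := hm (∑ i, ((ε i : ℤ) : ℝ) • y i)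
          rw [map_sum] at h2
          simp_rw [map_smul] at h2
          rw [← pow_mul]
          refine h2.trans (le_of_eq ?_)
          congr 1
          refine Finset.sum_congr rfl fun j _ => ?_
          rw [Finset.sum_apply, pow_mul, sq_abs, ← pow_mul]
          simp
      _ = (K * M) ^ 4 * ∑ j, m j * signAvg (fun ε : Fin k → ℤˣ =>
            (∑ i, ((ε i : ℤ) : ℝ) * y i j) ^ 4) := by
          rw [signAvg_mul_left, signAvg_sum]
          simp_rw [signAvg_mul_left]
      _ ≤ (K * M) ^ 4 * ∑ j, m j * (3 * (B ^ 2) ^ 2) := by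
          gcongr with j
          · exact hm0 j
          · refine (signAvg_fourth_sum_le fun i => y i j).trans ?_
            have := Finset.sum_nonneg fun i (_ : i ∈ Finset.univ) => sq_nonneg (y i j)
            gcongr
            exact hy j
      _ ≤ (K * M) ^ 4 * (1 * (3 * (B ^ 2) ^ 2)) := by
          rw [← Finset.sum_mul]; gcongr
      _ ≤ ((2 * K * M * B) ^ 2) ^ 2 := by
          have : 0 ≤ (K * M * B) ^ 4 := by positivity
          nlinarith
  calc C ^ 2 * rademacherAverage (fun i => u (y i)) ^ 2 ≤ C ^ 2 * (2 * K * M * B) ^ 2 := by gcongr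
    _ = _ := by ring

end CotypeOperators

theorem smul_sup_of_pos {Z : Type*} [AddCommGroup Z] [Lattice Z] [Module ℝ Z]
    [PosSMulMono ℝ Z] {c : ℝ} (hc : 0 < c) (x y : Z) : c • (x ⊔ y) = c • x ⊔ c • y := by
  refine le_antisymm ?_ (sup_le (smul_le_smul_of_nonneg_left le_sup_left hc.le)
    (smul_le_smul_of_nonneg_left le_sup_right hc.le))
  have h1 : x ⊔ y ≤ c⁻¹ • (c • x ⊔ c • y) := by
    refine sup_le ?_ ?_
    · have := smul_le_smul_of_nonneg_left (le_sup_left : c • x ≤ c • x ⊔ c • y)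
        (inv_nonneg.2 hc.le)
      rwa [smul_smul, inv_mul_cancel₀ hc.ne', one_smul] at this
    · have := smul_le_smul_of_nonneg_left (le_sup_right : c • y ≤ c • x ⊔ c • y)
        (inv_nonneg.2 hc.le)
      rwa [smul_smul, inv_mul_cancel₀ hc.ne', one_smul] at this
  have h2 := smul_le_smul_of_nonneg_left h1 hc.le
  rwa [smul_smul, mul_inv_cancel₀ hc.ne', one_smul] at h2

/-! ### Riesz decomposition, disjointness and fine partitions in vector lattices -/

section VectorLattice

variable {Z : Type*} [AddCommGroup Z] [Lattice Z] [IsOrderedAddMonoid Z]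

/-- The Riesz decomposition property: the part `t ⊓ w a` is removed, and the remainder of `t` still
lies below the sum of the other terms. -/
theorem exists_decomposition {ι : Type*} (s : Finset ι) (w : ι → Z) (hw : ∀ j, 0 ≤ w j)
    (t : Z) (ht : 0 ≤ t) (hts : t ≤ ∑ j ∈ s, w j) :
    ∃ x : ι → Z, (∀ j, 0 ≤ x j ∧ x j ≤ w j) ∧ ∑ j ∈ s, x j = t := by
  classical
  induction s using Finset.induction_on generalizing t with
  | empty =>
    exact ⟨0, fun j => ⟨le_rfl, hw j⟩, by simpa using le_antisymm ht (by simpa using hts)⟩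
  | insert a s ha ih =>
    rw [Finset.sum_insert ha] at hts
    have h1 : t - t ⊓ w a ≤ ∑ j ∈ s, w j := by
      rw [sub_le_comm]
      refine le_inf (sub_le_self _ (Finset.sum_nonneg fun j _ => hw j)) ?_
      rw [sub_le_iff_le_add]; exact hts
    obtain ⟨x, hx, hxs⟩ := ih (t - t ⊓ w a) (sub_nonneg.2 inf_le_left) h1
    refine ⟨Function.update x a (t ⊓ w a), fun j => ?_, ?_⟩
    · by_cases hj : j = a
      · subst hj; simp [ht, hw j]
      · simp only [Function.update_of_ne hj]; exact hx j
    · rw [Finset.sum_insert ha, Function.update_self, Finset.sum_update_of_notMem ha, hxs]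
      abel

/-- Two partitions of one element have a common refinement: decompose one `t a` along the `w j`,
subtract, and continue with the rest. -/
theorem exists_refinement {ι κ : Type*} [Fintype ι] (s : Finset κ) (w : ι → Z) (t : κ → Z)
    (hw : ∀ j, 0 ≤ w j) (ht : ∀ k, 0 ≤ t k) (h : ∑ j, w j = ∑ k ∈ s, t k) :
    ∃ x : ι → κ → Z, (∀ j k, 0 ≤ x j k) ∧ (∀ j, ∑ k ∈ s, x j k = w j) ∧
      ∀ k ∈ s, ∑ j, x j k = t k := by
  classical
  induction s using Finset.induction_on generalizing w with
  | empty =>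
    refine ⟨0, fun _ _ => le_rfl, fun j => ?_, by simp⟩
    have h1 := (Finset.sum_eq_zero_iff_of_nonneg fun j _ => hw j).1 (by simpa using h) j
      (Finset.mem_univ j)
    simp [h1]
  | insert a s ha ih =>
    rw [Finset.sum_insert ha] at h
    obtain ⟨x, hx, hxs⟩ := exists_decomposition Finset.univ w hw (t a) (ht a) (by
      rw [h]; exact le_add_of_nonneg_right (Finset.sum_nonneg fun k _ => ht k))
    obtain ⟨x', hx'0, hx'w, hx't⟩ := ih (fun j => w j - x j) (fun j => sub_nonneg.2 (hx j).2)
      (by rw [Finset.sum_sub_distrib, hxs, h]; abel)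
    refine ⟨fun j => Function.update (x' j) a (x j), fun j k => ?_, fun j => ?_, fun k hk => ?_⟩
    · by_cases hk : k = a
      · subst hk; simp [(hx j).1]
      · simp only [Function.update_of_ne hk]; exact hx'0 j k
    · change ∑ k ∈ insert a s, Function.update (x' j) a (x j) k = w j
      rw [Finset.sum_insert ha, Function.update_self, Finset.sum_update_of_notMem ha, hx'w]
      abel
    · by_cases hka : k = a
      · subst hka; simpa using hxs
      · simp only [Function.update_of_ne hka]
        exact hx't k ((Finset.mem_insert.1 hk).resolve_left hka)

/-- Whatever part of `a ⊓ (b + c)` is not accounted for by `b` lies below both `a` and `c`, hence is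
zero. -/
theorem inf_add_eq_zero {a b c : Z} (ha : 0 ≤ a) (hb : 0 ≤ b) (hc : 0 ≤ c)
    (hab : a ⊓ b = 0) (hac : a ⊓ c = 0) : a ⊓ (b + c) = 0 := by
  refine le_antisymm ?_ (le_inf ha (add_nonneg hb hc))
  set z := a ⊓ (b + c) with hz
  have hz0 : 0 ≤ z := le_inf ha (add_nonneg hb hc)
  have h1 : z ⊓ b ≤ 0 := (inf_le_inf_right b inf_le_left).trans hab.le
  have h2 : z - z ⊓ b ≤ a ⊓ c := by
    refine le_inf ((sub_le_self _ (le_inf hz0 hb)).trans inf_le_left) ?_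
    rw [sub_le_comm]
    refine le_inf (sub_le_self _ hc) ?_
    rw [sub_le_iff_le_add]
    exact inf_le_right
  rw [hac, sub_nonpos] at h2
  exact h2.trans h1

theorem inf_sum_eq_zero {ι : Type*} (s : Finset ι) {a : Z} (ha : 0 ≤ a) (b : ι → Z)
    (hb : ∀ i, 0 ≤ b i) (h : ∀ i, a ⊓ b i = 0) : a ⊓ ∑ i ∈ s, b i = 0 := by
  classical
  induction s using Finset.induction_on with
  | empty => simpa using ha
  | insert i s hi ih =>
    rw [Finset.sum_insert hi]
    exact inf_add_eq_zero ha (hb i) (Finset.sum_nonneg fun i _ => hb i) (h i) ih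

/-- The second difference `2 (y ∧ b) - y ∧ (b - d) - y ∧ (b + d)` is a tent around `y = b`. -/
theorem tent_properties {y b d : Z} (hd : 0 ≤ d) :
    0 ≤ (y ⊓ b - y ⊓ (b - d)) + (y ⊓ b - y ⊓ (b + d)) ∧
    (y ⊓ b - y ⊓ (b - d)) + (y ⊓ b - y ⊓ (b + d)) ≤ (b + d - y) ⊔ 0 ∧
    (y ⊓ b - y ⊓ (b - d)) + (y ⊓ b - y ⊓ (b + d)) ≤ (y - (b - d)) ⊔ 0 := by
  set P := y ⊓ (b - d) with hP
  set Q := y ⊓ b with hQ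
  set R := y ⊓ (b + d) with hR
  have hPQ : P ≤ Q := inf_le_inf_left _ (sub_le_self _ hd)
  have hQR : Q ≤ R := inf_le_inf_left _ (le_add_of_nonneg_right hd)
  have hQP : Q - P ≤ d := by
    rw [sub_le_comm]
    exact le_inf ((sub_le_self _ hd).trans inf_le_left) (sub_le_sub_right inf_le_right _)
  have hRQ : R - d ≤ Q :=
    le_inf ((sub_le_self _ hd).trans inf_le_left) (sub_le_iff_le_add.2 inf_le_right)
  refine ⟨?_, ?_, ?_⟩
  · have h1 : P + R - Q ≤ Q := by
      refine le_inf ?_ ?_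
      · calc P + R - Q = (P - Q) + R := by abel
          _ ≤ 0 + y := add_le_add (sub_nonpos.2 hPQ) inf_le_left
          _ = y := zero_add _
      · calc P + R - Q = P + (R - d) - Q + d := by abel
          _ ≤ (b - d) + Q - Q + d := by gcongr; exact inf_le_right
          _ = b := by abel
    have h2 : 0 ≤ Q - (P + R - Q) := sub_nonneg.2 h1
    calc (0 : Z) ≤ Q - (P + R - Q) := h2
      _ = _ := by abel
  · have h1 : b + d - R ≤ (b + d - y) ⊔ 0 := by
      rw [sub_le_comm]
      refine le_inf ?_ (sub_le_self _ le_sup_right)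
      rw [sub_le_comm]; exact le_sup_left
    calc (Q - P) + (Q - R) ≤ d + (b - R) := add_le_add hQP (sub_le_sub_right inf_le_right _)
      _ = b + d - R := by abel
      _ ≤ _ := h1
  · have h1 : y - P ≤ (y - (b - d)) ⊔ 0 := by
      rw [sub_le_comm]
      refine le_inf (sub_le_self _ le_sup_right) ?_
      rw [sub_le_comm]; exact le_sup_left
    calc (Q - P) + (Q - R) ≤ (y - P) + 0 :=
          add_le_add (sub_le_sub_right inf_le_left _) (sub_nonpos.2 hQR)
      _ = y - P := add_zero _
      _ ≤ _ := h1

theorem sup_zero_inf_neg_sup_zero (v : Z) : (v ⊔ 0) ⊓ ((-v) ⊔ 0) = 0 :=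
  posPart_inf_negPart_eq_zero v

variable [Module ℝ Z] [PosSMulMono ℝ Z]

/-- Scalar multiples are dominated by integer multiples, which are finite sums. -/
theorem smul_inf_eq_zero {a b : Z} (ha : 0 ≤ a) (hb : 0 ≤ b) (h : a ⊓ b = 0) {r : ℝ}
    (hr : 0 ≤ r) : (r • a) ⊓ b = 0 := by
  obtain ⟨n, hn⟩ := exists_nat_ge r
  have h1 : b ⊓ ∑ _i ∈ Finset.range n, a = 0 :=
    inf_sum_eq_zero _ hb _ (fun _ => ha) (fun _ => by rw [inf_comm]; exact h)
  refine le_antisymm ?_ (le_inf (smul_nonneg hr ha) hb)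
  rw [← h1, inf_comm]
  refine inf_le_inf_left _ ?_
  rw [Finset.sum_const, Finset.card_range, ← Nat.cast_smul_eq_nsmul ℝ]
  rw [← sub_nonneg, ← sub_smul]
  exact smul_nonneg (sub_nonneg.2 hn) ha

/-- A partition of `u` into pieces on which `y` is almost a multiple of `u`. -/
theorem exists_tents {u y : Z} (hyu : |y| ≤ u) {N : ℕ} (hN : N ≠ 0) :
    ∃ t : Fin (2 * N + 1) → Z, ∃ c : Fin (2 * N + 1) → ℝ, (∀ k, 0 ≤ t k) ∧ ∑ k, t k = u ∧
      ∑ k, c k • t k = y ∧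
      ∀ k, t k ⊓ ((y - (c k • u + (1 / N : ℝ) • u)) ⊔ 0) = 0 ∧
        t k ⊓ (((c k • u - (1 / N : ℝ) • u) - y) ⊔ 0) = 0 := by
  have hu : 0 ≤ u := (abs_nonneg y).trans hyu
  have hN0 : (N : ℝ) ≠ 0 := by positivity
  set d : Z := (1 / N : ℝ) • u with hd
  have hd0 : 0 ≤ d := smul_nonneg (by positivity) hu
  -- Truncations of `y` at the levels `(k - N - 1)/N`. The index shift centres the second difference
  -- `s k` at the level `(k - N)/N`, so that `0 ≤ k ≤ 2N` covers the whole range from `-u` to `u`.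
  set h : ℕ → Z := fun k => y ⊓ ((((k : ℝ) - N - 1) / N) • u) with hh
  have hb1 : ∀ k : ℕ, h k = y ⊓ ((((k : ℝ) - N) / N) • u - d) := fun k => by
    simp only [hh, hd]; congr 1; rw [← sub_smul]; congr 1; ring
  have hb2 : ∀ k : ℕ, h (k + 1) = y ⊓ ((((k : ℝ) - N) / N) • u) := fun k => by
    simp only [hh]; push_cast; congr 3; ring
  have hb3 : ∀ k : ℕ, h (k + 2) = y ⊓ ((((k : ℝ) - N) / N) • u + d) := fun k => by
    simp only [hh, hd]; push_cast; congr 1; rw [← add_smul]; congr 1; ring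
  set s : ℕ → Z := fun k => (h (k + 1) - h k) + (h (k + 1) - h (k + 2)) with hs
  have hprop : ∀ k : ℕ, 0 ≤ s k ∧ s k ≤ ((((k : ℝ) - N) / N) • u + d - y) ⊔ 0 ∧
      s k ≤ (y - ((((k : ℝ) - N) / N) • u - d)) ⊔ 0 := fun k => by
    simp only [hs, hb1 k, hb2 k, hb3 k]
    exact tent_properties hd0
  have hsum1 : ∀ n : ℕ, ∑ k ∈ Finset.range n, s k = (h 1 - h 0) - (h (n + 1) - h n) := by
    intro n
    induction n with
    | zero => simp
    | succ n ih => rw [Finset.sum_range_succ, ih]; simp only [hs]; abel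
  have hsum2 : ∀ n : ℕ, ∑ k ∈ Finset.range n, (k : ℝ) • s k =
      (n : ℝ) • h n - ((n : ℝ) - 1) • h (n + 1) - h 1 := by
    intro n
    induction n with
    | zero => simp
    | succ n ih =>
      rw [Finset.sum_range_succ, ih]; simp only [hs]; push_cast; module
  have hyle : y ≤ u := (le_abs_self y).trans hyu
  have hyge : -u ≤ y := neg_le.1 ((neg_le_abs y).trans hyu)
  have hh0 : h 0 = -u - d := by
    rw [hb1]
    have : (((0 : ℕ) : ℝ) - N) / N = -1 := by push_cast; field_simp; ring
    rw [this, neg_one_smul]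
    exact inf_eq_right.2 ((sub_le_self _ hd0).trans hyge)
  have hh1 : h 1 = -u := by
    rw [hb2 0]
    have : (((0 : ℕ) : ℝ) - N) / N = -1 := by push_cast; field_simp; ring
    rw [this, neg_one_smul]
    exact inf_eq_right.2 hyge
  have hc2N : (((2 * N : ℕ) : ℝ) - N) / N = 1 := by push_cast; field_simp; ring
  have hh2 : h (2 * N + 1) = y := by
    rw [hb2, hc2N, one_smul]; exact inf_eq_left.2 hyle
  have hh3 : h (2 * N + 1 + 1) = y := by
    rw [hb3, hc2N, one_smul]; exact inf_eq_left.2 (hyle.trans (le_add_of_nonneg_right hd0))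
  -- The tents telescope to `d = u / N`, hence the factor `N`. Summation by parts with the levels as
  -- coefficients recovers `y`. Each tent lies below the positive parts of `b + d - y` and `y - (b -
  -- d)`, where `b` is its centre, and is therefore disjoint from the opposite positive parts.
  refine ⟨fun k => (N : ℝ) • s k, fun k => ((k : ℝ) - N) / N, fun k =>
    smul_nonneg (by positivity) (hprop k).1, ?_, ?_, fun k => ⟨?_, ?_⟩⟩
  · rw [Fin.sum_univ_eq_sum_range (fun k => (N : ℝ) • s k), ← Finset.smul_sum, hsum1, hh0, hh1,
      hh2, hh3, sub_self, sub_zero]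
    have : -u - (-u - d) = d := by abel
    rw [this, hd, smul_smul, mul_one_div_cancel hN0, one_smul]
  · rw [Fin.sum_univ_eq_sum_range (fun k => (((k : ℝ) - N) / N) • (N : ℝ) • s k)]
    have h1 : ∀ k : ℕ, (((k : ℝ) - N) / N) • (N : ℝ) • s k = (k : ℝ) • s k - (N : ℝ) • s k := by
      intro k
      rw [smul_smul, ← sub_smul]; congr 1; field_simp
    simp_rw [h1]
    rw [Finset.sum_sub_distrib, ← Finset.smul_sum, hsum1, hsum2, hh0, hh1, hh2, hh3, sub_self,
      sub_zero]
    have : -u - (-u - d) = d := by abel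
    rw [this, hd, smul_smul, mul_one_div_cancel hN0, one_smul]
    push_cast
    module
  · refine smul_inf_eq_zero (hprop k).1 le_sup_right ?_ (by positivity)
    refine le_antisymm ?_ (le_inf (hprop k).1 le_sup_right)
    have h1 := sup_zero_inf_neg_sup_zero (((((k : ℕ) : ℝ) - N) / N) • u + d - y)
    rw [neg_sub] at h1
    exact (inf_le_inf_right _ (hprop k).2.1).trans h1.le
  · refine smul_inf_eq_zero (hprop k).1 le_sup_right ?_ (by positivity)
    refine le_antisymm ?_ (le_inf (hprop k).1 le_sup_right)
    have h1 := sup_zero_inf_neg_sup_zero (y - (((((k : ℕ) : ℝ) - N) / N) • u - d))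
    rw [neg_sub] at h1
    exact (inf_le_inf_right _ (hprop k).2.2).trans h1.le

/-- A common partition of `u` for finitely many elements of the order interval `[-u, u]`. -/
theorem exists_partition {d : ℕ} (y : Fin d → Z) {u : Z} (hu : 0 ≤ u) (hyu : ∀ i, |y i| ≤ u)
    {N : ℕ} (hN : N ≠ 0) :
    ∃ (n : ℕ) (w : Fin n → Z) (c : Fin n → Fin d → ℝ), (∀ j, 0 ≤ w j) ∧ ∑ j, w j = u ∧
      (∀ i, ∑ j, c j i • w j = y i) ∧
      ∀ j i, w j ⊓ ((y i - (c j i • u + (1 / N : ℝ) • u)) ⊔ 0) = 0 ∧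
        w j ⊓ (((c j i • u - (1 / N : ℝ) • u) - y i) ⊔ 0) = 0 := by
  classical
  have key : ∀ s : Finset (Fin d), ∃ (n : ℕ) (w : Fin n → Z) (c : Fin n → Fin d → ℝ),
      (∀ j, 0 ≤ w j) ∧ ∑ j, w j = u ∧ (∀ i ∈ s, ∑ j, c j i • w j = y i) ∧
      ∀ j, ∀ i ∈ s, w j ⊓ ((y i - (c j i • u + (1 / N : ℝ) • u)) ⊔ 0) = 0 ∧
        w j ⊓ (((c j i • u - (1 / N : ℝ) • u) - y i) ⊔ 0) = 0 := by
    intro s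
    induction s using Finset.induction_on with
    | empty => exact ⟨1, fun _ => u, fun _ _ => 0, fun _ => hu, by simp, by simp, by simp⟩
    | insert a s ha ih =>
      obtain ⟨n, w, c, hw0, hwu, hwy, hdis⟩ := ih
      obtain ⟨t, e, ht0, htu, hty, htd⟩ := exists_tents (hyu a) hN
      -- Refining the existing partition by the tents of the new element keeps every older
      -- disjointness relation, because the new pieces are smaller.
      obtain ⟨x, hx0, hxw, hxt⟩ := exists_refinement Finset.univ w t hw0 ht0 (hwu.trans htu.symm)
      let φ := (finProdFinEquiv (m := n) (n := 2 * N + 1)).symm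
      refine ⟨n * (2 * N + 1), fun j => x (φ j).1 (φ j).2,
        fun j i => if i = a then e (φ j).2 else c (φ j).1 i, fun j => hx0 _ _, ?_, ?_, ?_⟩
      · rw [φ.sum_comp (fun p => x p.1 p.2), Fintype.sum_prod_type]
        simp_rw [hxw, hwu]
      · intro i hi
        rw [φ.sum_comp (fun p => (if i = a then e p.2 else c p.1 i) • x p.1 p.2),
          Fintype.sum_prod_type]
        by_cases hia : i = a
        · subst hia
          simp only [if_true]
          rw [Finset.sum_comm, ← hty]
          refine Finset.sum_congr rfl fun k _ => ?_
          rw [← Finset.smul_sum, hxt k (Finset.mem_univ k)]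
        · simp only [if_neg hia]
          rw [← hwy i ((Finset.mem_insert.1 hi).resolve_left hia)]
          refine Finset.sum_congr rfl fun k _ => ?_
          rw [← Finset.smul_sum, hxw]
      · intro j i hi
        have hle1 : x (φ j).1 (φ j).2 ≤ w (φ j).1 := by
          rw [← hxw]
          exact Finset.single_le_sum (fun k _ => hx0 (φ j).1 k) (Finset.mem_univ _)
        have hle2 : x (φ j).1 (φ j).2 ≤ t (φ j).2 := by
          rw [← hxt _ (Finset.mem_univ _)]
          exact Finset.single_le_sum (f := fun k => x k (φ j).2) (fun k _ => hx0 k (φ j).2)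
            (Finset.mem_univ _)
        have mono : ∀ {p v q : Z}, 0 ≤ p → p ≤ v → 0 ≤ q → v ⊓ q = 0 → p ⊓ q = 0 := by
          intro p v q hp hpv hq hvq
          exact le_antisymm ((inf_le_inf_right _ hpv).trans hvq.le) (le_inf hp hq)
        by_cases hia : i = a
        · subst hia
          simp only [if_true]
          exact ⟨mono (hx0 _ _) hle2 le_sup_right (htd _).1,
            mono (hx0 _ _) hle2 le_sup_right (htd _).2⟩
        · simp only [if_neg hia]
          have h1 := hdis (φ j).1 i ((Finset.mem_insert.1 hi).resolve_left hia)
          exact ⟨mono (hx0 _ _) hle1 le_sup_right h1.1, mono (hx0 _ _) hle1 le_sup_right h1.2⟩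
  obtain ⟨n, w, c, h1, h2, h3, h4⟩ := key Finset.univ
  exact ⟨n, w, c, h1, h2, fun i => h3 i (Finset.mem_univ i), fun j i => h4 j i (Finset.mem_univ i)⟩

/-- Pieces of the partition whose coefficient vector violates the bound `∑ bᵢ yᵢ ≤ u` by a
definite amount vanish. -/
theorem eq_zero_of_disjoint {d : ℕ} (y : Fin d → Z) {u v : Z} (hv : 0 ≤ v) (hvu : v ≤ u)
    (c b : Fin d → ℝ) {δ η : ℝ} (hη : 0 < η) (hη1 : η ≤ 1)
    (hdis : ∀ i, v ⊓ ((y i - (c i • u + δ • u)) ⊔ 0) = 0 ∧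
      v ⊓ (((c i • u - δ • u) - y i) ⊔ 0) = 0)
    (hb : ∑ i, b i • y i ≤ u) (hbc : 1 + δ * ∑ i, |b i| + η ≤ ∑ i, b i * c i) : v = 0 := by
  have hu : 0 ≤ u := hv.trans hvu
  set p : Fin d → Z := fun i => (y i - (c i • u + δ • u)) ⊔ 0 with hp
  set p' : Fin d → Z := fun i => ((c i • u - δ • u) - y i) ⊔ 0 with hp'
  set P : Z := ∑ i, (|b i| • p i + |b i| • p' i) with hP
  have hPdis : v ⊓ P = 0 := by
    refine inf_sum_eq_zero _ hv _ (fun i => add_nonneg (smul_nonneg (abs_nonneg _) le_sup_right)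
      (smul_nonneg (abs_nonneg _) le_sup_right)) fun i => ?_
    refine inf_add_eq_zero hv (smul_nonneg (abs_nonneg _) le_sup_right)
      (smul_nonneg (abs_nonneg _) le_sup_right) ?_ ?_
    · rw [inf_comm]
      exact smul_inf_eq_zero le_sup_right hv (by rw [inf_comm]; exact (hdis i).1) (abs_nonneg _)
    · rw [inf_comm]
      exact smul_inf_eq_zero le_sup_right hv (by rw [inf_comm]; exact (hdis i).2) (abs_nonneg _)
  -- Away from the error terms `p i` and `p' i`, both disjoint from `v`, each `y i` equals `c i • u`
  -- up to `δ • u`. The sign of `b i` decides which of the two errors enters.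
  have hterm : ∀ i, b i • (c i • u - y i) ≤ (|b i| • p i + |b i| • p' i) + (|b i| * δ) • u := by
    intro i
    rcases le_total 0 (b i) with h | h
    · rw [abs_of_nonneg h]
      have h1 : b i • ((c i • u - δ • u) - y i) ≤ b i • p' i :=
        smul_le_smul_of_nonneg_left le_sup_left h
      have h2 : 0 ≤ b i • p i := smul_nonneg h le_sup_right
      calc b i • (c i • u - y i) = 0 + b i • ((c i • u - δ • u) - y i) + (b i * δ) • u := by module
        _ ≤ _ := by gcongr
    · rw [abs_of_nonpos h]
      have h' : 0 ≤ -b i := neg_nonneg.2 h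
      have h1 : (-b i) • (y i - (c i • u + δ • u)) ≤ (-b i) • p i :=
        smul_le_smul_of_nonneg_left le_sup_left h'
      have h2 : 0 ≤ (-b i) • p' i := smul_nonneg h' le_sup_right
      calc b i • (c i • u - y i)
          = (-b i) • (y i - (c i • u + δ • u)) + 0 + ((-b i) * δ) • u := by module
        _ ≤ _ := by gcongr
  have hηP : η • u ≤ P := by
    have h1 := Finset.sum_le_sum fun i (_ : i ∈ Finset.univ) => hterm i
    rw [Finset.sum_add_distrib, ← hP, ← Finset.sum_smul] at h1
    have h2 : ∑ i, b i • (c i • u - y i) = (∑ i, b i * c i) • u - ∑ i, b i • y i := by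
      simp_rw [smul_sub, smul_smul]
      rw [Finset.sum_sub_distrib, ← Finset.sum_smul]
    have h3 : (1 + δ * ∑ i, |b i| + η) • u - u ≤ ∑ i, b i • (c i • u - y i) := by
      rw [h2]
      refine sub_le_sub ?_ hb
      rw [← sub_nonneg, ← sub_smul]
      exact smul_nonneg (sub_nonneg.2 hbc) hu
    have h4 := h3.trans h1
    have h5 : (∑ i, |b i| * δ) = δ * ∑ i, |b i| := by
      rw [Finset.mul_sum]; exact Finset.sum_congr rfl fun i _ => mul_comm _ _
    rw [h5] at h4
    calc η • u = ((1 + δ * ∑ i, |b i| + η) • u - u) - (δ * ∑ i, |b i|) • u := by module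
      _ ≤ _ := sub_le_iff_le_add.2 h4
  -- The violated bound forces `η • u ≤ P`. Since `v ≤ u` is disjoint from `P`, already `η • v` must
  -- vanish.
  have h1 : η • v ≤ v ⊓ P := by
    refine le_inf ?_ ((smul_le_smul_of_nonneg_left hvu hη.le).trans hηP)
    rw [← sub_nonneg]
    have : v - η • v = (1 - η) • v := by module
    rw [this]
    exact smul_nonneg (by linarith) hv
  rw [hPdis] at h1
  have h2 := smul_le_smul_of_nonneg_left h1 (inv_nonneg.2 hη.le)
  rw [smul_smul, inv_mul_cancel₀ hη.ne', one_smul, smul_zero] at h2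
  exact le_antisymm h2 hv

end VectorLattice

/-! ### Order boundedness and factorization through `ℓ_∞^n` in Banach lattices -/

section BanachLattice

/-- A sublinear functional has a supporting linear functional at every point. -/
theorem exists_supporting_functional {E : Type*} [AddCommGroup E] [Module ℝ E] (N : E → ℝ)
    (hhom : ∀ c : ℝ, 0 < c → ∀ x, N (c • x) = c * N x) (hadd : ∀ x y, N (x + y) ≤ N x + N y)
    (x₀ : E) : ∃ g : E →ₗ[ℝ] ℝ, g x₀ = N x₀ ∧ ∀ x, g x ≤ N x := by
  have h0 : N 0 = 0 := by
    have := hhom 2 two_pos 0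
    rw [smul_zero] at this; linarith
  by_cases hx : x₀ = 0
  · obtain ⟨g, -, hg⟩ := exists_extension_of_le_sublinear (⊥ : E →ₗ.[ℝ] ℝ) N hhom hadd (by
      rintro ⟨x, hx⟩
      have : x = 0 := (Submodule.mem_bot ℝ).1 hx
      subst this
      exact (map_zero (⊥ : E →ₗ.[ℝ] ℝ).toFun).le.trans h0.ge)
    exact ⟨g, by rw [hx, map_zero, h0], hg⟩
  · obtain ⟨g, hg1, hg⟩ := exists_extension_of_le_sublinear
      (LinearPMap.mkSpanSingleton x₀ (N x₀) hx) N hhom hadd (by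
      rintro ⟨x, hx'⟩
      obtain ⟨t, rfl⟩ := Submodule.mem_span_singleton.1 hx'
      rw [LinearPMap.mkSpanSingleton'_apply, RingHom.id_apply, smul_eq_mul]
      change t * N x₀ ≤ N (t • x₀)
      rcases lt_trichotomy t 0 with ht | ht | ht
      -- For negative `t`, subadditivity gives `0 = N 0 ≤ N (t • x₀) + N (-t • x₀)`.
      · have h1 := hadd (t • x₀) ((-t) • x₀)
        rw [← add_smul, add_neg_cancel, zero_smul, h0, hhom (-t) (by linarith)] at h1
        linarith
      · simp [ht, h0]
      · rw [hhom t ht])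
    refine ⟨g, ?_, hg⟩
    have h2 := hg1 ⟨x₀, Submodule.mem_span_singleton_self x₀⟩
    rw [h2]
    exact LinearPMap.mkSpanSingleton_apply ℝ ℝ hx (N x₀)

variable {Z : Type*} [NormedAddCommGroup Z] [Lattice Z] [IsOrderedAddMonoid Z] [HasSolidNorm Z]

theorem norm_le_norm_of_nonneg_of_le {a b : Z} (ha : 0 ≤ a) (hab : a ≤ b) : ‖a‖ ≤ ‖b‖ :=
  norm_le_norm_of_abs_le_abs (by rwa [abs_of_nonneg ha, abs_of_nonneg (ha.trans hab)])

theorem norm_sup_zero_le (a : Z) : ‖a ⊔ 0‖ ≤ ‖a‖ :=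
  norm_le_norm_of_abs_le_abs (by
    rw [abs_of_nonneg le_sup_right]
    exact sup_le (le_abs_self a) (abs_nonneg a))

variable [NormedSpace ℝ Z] [PosSMulMono ℝ Z]

/-- Hahn-Banach for the sublinear functional `w ↦ ‖w ⊔ 0‖`. It vanishes on the negative cone, so
every functional below it is positive. -/
theorem exists_positive_norming {z : Z} (hz : 0 ≤ z) :
    ∃ f : Z →ₗ[ℝ] ℝ, (∀ w, 0 ≤ w → 0 ≤ f w) ∧ (∀ w, f w ≤ ‖w‖) ∧ f z = ‖z‖ := by
  obtain ⟨f, hfz, hf⟩ := exists_supporting_functional (fun w : Z => ‖w ⊔ 0‖)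
    (fun c hc w => by
      have h := smul_sup_of_pos hc w (0 : Z)
      rw [smul_zero] at h
      change ‖c • w ⊔ 0‖ = _
      rw [← h, norm_smul, Real.norm_of_nonneg hc.le])
    (fun x y => (norm_le_norm_of_nonneg_of_le le_sup_right
      (sup_le (add_le_add le_sup_left le_sup_left)
        (add_nonneg le_sup_right le_sup_right))).trans (norm_add_le _ _)) z
  refine ⟨f, fun w hw => ?_, fun w => (hf w).trans (norm_sup_zero_le w), ?_⟩
  · have h1 := hf (-w)
    simp only [map_neg] at h1
    rw [sup_eq_right.2 (neg_nonpos.2 hw), norm_zero] at h1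
    linarith
  · rw [hfz, sup_eq_left.2 hz]

/-- The order-boundedness of operators into a Banach lattice with `1`-summing adjoint. -/
theorem norm_sup_le_of_summingBound {H : Type*} [NormedAddCommGroup H] [NormedSpace ℝ H]
    (T : H →L[ℝ] Z) {c : ℝ} (hT : SummingBound 1 (adj T) c) {ι : Type*} [Fintype ι]
    [Nonempty ι] (a : ι → H) (ha : ∀ i, ‖a i‖ ≤ 1)
    (h0 : 0 ≤ Finset.univ.sup' Finset.univ_nonempty fun i => T (a i)) :
    ‖Finset.univ.sup' Finset.univ_nonempty fun i => T (a i)‖ ≤ c := by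
  classical
  set S : (ι → Z) → Z := fun w => Finset.univ.sup' Finset.univ_nonempty w with hS
  have hle : ∀ (w : ι → Z) i, w i ≤ S w := fun w i => Finset.le_sup' w (Finset.mem_univ i)
  obtain ⟨f, hf0, hf1, hfu⟩ := exists_positive_norming h0
  have hfmono : ∀ {x y : Z}, x ≤ y → f x ≤ f y := fun {x y} h => by
    have := hf0 _ (sub_nonneg.2 h); rw [map_sub] at this; linarith
  -- This linearises the supremum. The components `g i` of `φ` are positive and their sum is
  -- dominated by `f`, so they form a family in the dual whose signed sums have norm at most one.
  -- The norm of the supremum is `∑ g i (T (a i))`, which the 1-summing inequality for the adjoint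
  -- bounds.
  obtain ⟨φ, hφz, hφ⟩ := exists_supporting_functional (fun w : ι → Z => f (S w))
    (fun c hc w => by
      have h := Finset.apply_sup'_eq_sup'_comp (f := w) Finset.univ_nonempty (fun x : Z => c • x)
        (fun x y => smul_sup_of_pos hc x y)
      change f (S (c • w)) = c * f (S w)
      rw [show S (c • w) = c • S w from h.symm, map_smul, smul_eq_mul])
    (fun x y => by
      rw [← map_add]
      exact hfmono (Finset.sup'_le _ _ fun i _ => add_le_add (hle x i) (hle y i)))
    (fun i => T (a i))
  set g : ι → Z →ₗ[ℝ] ℝ := fun i => φ.comp (LinearMap.single ℝ (fun _ => Z) i) with hg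
  have hg0 : ∀ i w, 0 ≤ w → 0 ≤ g i w := by
    intro i w hw
    have h1 := hφ (-(Pi.single i w))
    have h2 : S (-(Pi.single i w)) ≤ 0 := Finset.sup'_le _ _ fun j _ => by
      by_cases hj : j = i
      · subst hj; simpa using hw
      · simp [Pi.single_eq_of_ne hj]
    have h3 := hfmono h2
    rw [map_zero] at h3
    rw [map_neg] at h1
    change 0 ≤ φ (Pi.single i w)
    linarith
  have hgsum : ∀ w : ι → Z, φ w = ∑ i, g i (w i) := by
    intro w
    conv_lhs => rw [← Finset.univ_sum_single w]
    rw [map_sum]; rfl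
  have hgf : ∀ w, ∑ i, g i w ≤ f w := by
    intro w
    have h1 := hφ (fun _ => w)
    rw [hgsum] at h1
    refine h1.trans (hfmono (Finset.sup'_le _ _ fun i _ => le_rfl))
  have hgabs : ∀ i w, |g i w| ≤ g i |w| := by
    intro i w
    rw [abs_le]
    constructor
    · have := hg0 i (w + |w|) (by
        have := neg_le_abs w
        rw [← neg_le_iff_add_nonneg']; exact this)
      rw [map_add] at this; linarith
    · have := hg0 i (|w| - w) (sub_nonneg.2 (le_abs_self w))
      rw [map_sub] at this; linarith
  have hgsumabs : ∀ w, ∑ i, |g i w| ≤ ‖w‖ := fun w =>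
    (Finset.sum_le_sum fun i _ => hgabs i w).trans
      ((hgf |w|).trans ((hf1 _).trans (norm_abs_eq_norm w).le))
  set G : ι → StrongDual ℝ Z := fun i => (g i).mkContinuous 1 fun w => by
    rw [one_mul]
    exact (Finset.single_le_sum (f := fun i => |g i w|) (fun i _ => abs_nonneg _)
      (Finset.mem_univ i)).trans (hgsumabs w)
  have hsum := hT.sum_norm_le G zero_le_one fun b hb => by
    refine ContinuousLinearMap.opNorm_le_bound _ zero_le_one fun w => ?_
    rw [one_mul, _root_.sum_apply, Real.norm_eq_abs]
    refine (Finset.abs_sum_le_sum_abs _ _).trans (le_trans (Finset.sum_le_sum fun i _ => ?_)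
      (hgsumabs w))
    change |b i * g i w| ≤ _
    rw [abs_mul]
    exact mul_le_of_le_one_left (abs_nonneg _) (hb i)
  rw [mul_one] at hsum
  calc ‖S fun i => T (a i)‖ = f (S fun i => T (a i)) := hfu.symm
    _ = φ (fun i => T (a i)) := hφz.symm
    _ = ∑ i, adj T (G i) (a i) := hgsum _
    _ ≤ ∑ i, ‖adj T (G i)‖ := by
        refine Finset.sum_le_sum fun i _ => ?_
        calc adj T (G i) (a i) ≤ ‖adj T (G i)‖ * ‖a i‖ :=
              (le_abs_self _).trans ((adj T (G i)).le_opNorm _)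
          _ ≤ ‖adj T (G i)‖ * 1 := by gcongr; exact ha i
          _ = _ := mul_one _
    _ ≤ c := hsum

theorem exists_finite_half_net (E : Type*) [NormedAddCommGroup E] [NormedSpace ℝ E]
    [FiniteDimensional ℝ E] :
    ∃ F : Finset E, (∀ b ∈ F, ‖b‖ ≤ 1) ∧ ∀ x : E, ‖x‖ ≤ 1 → ∃ b ∈ F, ‖x - b‖ ≤ 1 / 2 := by
  have := FiniteDimensional.proper ℝ E
  obtain ⟨t, ht, htf, hcov⟩ := (isCompact_closedBall (0 : E) 1).finite_cover_balls
    (by norm_num : (0 : ℝ) < 1 / 2)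
  refine ⟨htf.toFinset, fun b hb => ?_, fun x hx => ?_⟩
  · simpa using ht (htf.mem_toFinset.1 hb)
  · have h1 := hcov (show x ∈ Metric.closedBall (0 : E) 1 by simpa using hx)
    simp only [Set.mem_iUnion, Metric.mem_ball, dist_eq_norm] at h1
    obtain ⟨b, hb, hxb⟩ := h1
    exact ⟨b, htf.mem_toFinset.2 hb, hxb.le⟩

/-- An operator from a Hilbert space into a Banach lattice with `1`-summing adjoint factors on
finite dimensional subspaces through `ℓ_∞^n`. -/
theorem exists_factorization_of_summingBound {H : Type*} [NormedAddCommGroup H]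
    [InnerProductSpace ℝ H] (T : H →L[ℝ] Z) {c : ℝ} (hT : SummingBound 1 (adj T) c)
    (V : Submodule ℝ H) [FiniteDimensional ℝ V] :
    ∃ (n : ℕ) (g : Fin n → H) (L : (Fin n → ℝ) →ₗ[ℝ] Z), (∀ j, ‖g j‖ ≤ 3) ∧
      (∀ x : Fin n → ℝ, (∀ j, |x j| ≤ 1) → ‖L x‖ ≤ c) ∧
      ∀ a ∈ V, T a = L fun j => inner ℝ (g j) a := by
  classical
  set d := Module.finrank ℝ V with hd
  set e := stdOrthonormalBasis ℝ V with he
  obtain ⟨F, hF1, hF⟩ := exists_finite_half_net (EuclideanSpace ℝ (Fin d))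
  let emb : EuclideanSpace ℝ (Fin d) → H := fun b => ((∑ i, b i • e i : V) : H)
  have hemb : ∀ b, ‖emb b‖ = ‖b‖ := by
    intro b
    have h1 : (∑ i, b i • e i : V) = e.repr.symm b := by
      rw [e.sum_repr_symm]
    change ‖(∑ i, b i • e i : V)‖ = _
    rw [h1, LinearIsometryEquiv.norm_map]
  -- The net detects long coefficient vectors, the vectors `± e i` give `|T (e i)| ≤ u`, and `0`
  -- gives `u ≥ 0`.
  set F' : Finset H := F.image emb ∪ (Finset.univ.image fun i => (e i : H)) ∪
    (Finset.univ.image fun i => -(e i : H)) ∪ {0} with hF'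
  have he1 : ∀ i, ‖(e i : H)‖ = 1 := fun i => e.orthonormal.1 i
  have hF'1 : ∀ h ∈ F', ‖h‖ ≤ 1 := by
    intro h hh
    simp only [hF', Finset.mem_union, Finset.mem_image, Finset.mem_univ, true_and,
      Finset.mem_singleton] at hh
    rcases hh with ((⟨b, hb, rfl⟩ | ⟨i, rfl⟩) | ⟨i, rfl⟩) | rfl
    · rw [hemb]; exact hF1 b hb
    · exact (he1 i).le
    · rw [norm_neg]; exact (he1 i).le
    · simp
  have hne : (0 : H) ∈ F' := by simp [hF']
  have : Nonempty F' := ⟨⟨0, hne⟩⟩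
  set u : Z := Finset.univ.sup' Finset.univ_nonempty fun h : F' => T h with hu
  have hule : ∀ h ∈ F', T h ≤ u := fun h hh =>
    Finset.le_sup' (fun h : F' => T h) (Finset.mem_univ (⟨h, hh⟩ : F'))
  have hu0 : 0 ≤ u := by simpa using hule 0 hne
  have hunorm : ‖u‖ ≤ c := norm_sup_le_of_summingBound T hT _ (fun h => hF'1 h h.2) hu0
  set y : Fin d → Z := fun i => T (e i) with hy
  have hyu : ∀ i, |y i| ≤ u := by
    intro i
    refine sup_le (hule _ (by simp [hF'])) ?_
    rw [hy, ← map_neg]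
    exact hule _ (by simp [hF'])
  -- The mesh `1 / (4d + 4)` keeps the total error `δ ∑ |b i| ≤ d / (4d + 4)` below `1/4`.
  obtain ⟨n, w, k, hw0, hwu, hwy, hdis⟩ := exists_partition y hu0 hyu (N := 4 * d + 4) (by omega)
  -- If the coefficient vector were longer than `3`, a net point `b` close to its direction would
  -- pair with it to at least half its length, that is, more than `3/2 = 1 + 1/4 + 1/4`. This
  -- contradicts `T (emb b) ≤ u` unless the piece vanishes.
  have hkey : ∀ j, w j ≠ 0 → ‖WithLp.toLp 2 (k j)‖ ≤ 3 := by
    intro j hj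
    by_contra! hlt
    refine hj ?_
    set κ : EuclideanSpace ℝ (Fin d) := WithLp.toLp 2 (k j) with hκ
    have hκ0 : 0 < ‖κ‖ := by linarith
    obtain ⟨b, hbF, hb⟩ := hF (‖κ‖⁻¹ • κ) (by
      rw [norm_smul, norm_inv, norm_norm, inv_mul_cancel₀ hκ0.ne'])
    refine eq_zero_of_disjoint y (hw0 j) ?_ (k j) b (δ := 1 / (4 * d + 4 : ℕ)) (η := 1 / 4)
      (by norm_num) (by norm_num) (hdis j) ?_ ?_
    · rw [← hwu]; exact Finset.single_le_sum (fun j _ => hw0 j) (Finset.mem_univ j)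
    · have h1 := hule (emb b) (by
        simp only [hF', Finset.mem_union, Finset.mem_image]
        exact Or.inl (Or.inl (Or.inl ⟨b, hbF, rfl⟩)))
      have h2 : T (emb b) = ∑ i, b i • y i := by simp [emb, hy]
      rwa [h2] at h1
    · have h1 : inner ℝ b κ = ∑ i, b i * k j i := by
        rw [PiLp.inner_apply]
        refine Finset.sum_congr rfl fun i _ => ?_
        simp [hκ, mul_comm]
      have h2 : ‖κ‖ / 2 ≤ inner ℝ b κ := by
        have h3 : inner ℝ (‖κ‖⁻¹ • κ) κ = ‖κ‖ := by
          rw [real_inner_smul_left, real_inner_self_eq_norm_sq]; field_simp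
        have h4 : inner ℝ (‖κ‖⁻¹ • κ - b) κ ≤ 1 / 2 * ‖κ‖ :=
          (real_inner_le_norm _ _).trans (by gcongr)
        rw [inner_sub_left, h3] at h4
        linarith
      have h5 : ∑ i, |b i| ≤ d := by
        calc ∑ i, |b i| ≤ ∑ _i : Fin d, (1 : ℝ) := by
              refine Finset.sum_le_sum fun i _ => ?_
              exact (PiLp.norm_apply_le b i).trans (hF1 b hbF)
          _ = d := by simp
      have h6 : 1 / ((4 * d + 4 : ℕ) : ℝ) * ∑ i, |b i| ≤ 1 / 4 := by
        rw [one_div_mul_eq_div, div_le_iff₀ (by positivity)]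
        push_cast
        linarith
      rw [← h1]
      linarith
  -- Coefficients on vanishing pieces are arbitrary; they are replaced by zero so that the norm
  -- bound holds for all indices.
  set k' : Fin n → EuclideanSpace ℝ (Fin d) :=
    fun j => if w j = 0 then 0 else WithLp.toLp 2 (k j) with hk'
  have hk'w : ∀ j i, k' j i • w j = k j i • w j := by
    intro j i
    by_cases h : w j = 0
    · simp [h]
    · simp [hk', h]
  refine ⟨n, fun j => emb (k' j), (Fintype.linearCombination ℝ w), fun j => ?_, fun x hx => ?_,
    fun a ha => ?_⟩
  · rw [hemb]
    by_cases h : w j = 0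
    · simp [hk', h]
    · simp only [hk', if_neg h]; exact hkey j h
  · refine le_trans ?_ hunorm
    refine norm_le_norm_of_abs_le_abs ?_
    rw [abs_of_nonneg hu0, Fintype.linearCombination_apply, ← hwu]
    have hj : ∀ j, x j • w j ≤ w j ∧ -(x j • w j) ≤ w j := fun j => by
      have h1 := abs_le.1 (hx j)
      constructor
      · rw [← sub_nonneg]
        have : w j - x j • w j = (1 - x j) • w j := by module
        rw [this]; exact smul_nonneg (by linarith) (hw0 j)
      · rw [← sub_nonneg]
        have : w j - -(x j • w j) = (1 + x j) • w j := by module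
        rw [this]; exact smul_nonneg (by linarith) (hw0 j)
    refine sup_le (Finset.sum_le_sum fun j _ => (hj j).1) ?_
    rw [← Finset.sum_neg_distrib]
    exact Finset.sum_le_sum fun j _ => (hj j).2
  · have h1 : a = ∑ i, (inner ℝ (e i : H) a) • (e i : H) := by
      have := congrArg (Subtype.val) (e.sum_repr' ⟨a, ha⟩)
      simpa using this.symm
    rw [Fintype.linearCombination_apply]
    have h2 : T a = ∑ i, (inner ℝ (e i : H) a) • y i := by
      conv_lhs => rw [h1]
      simp [hy]
    rw [h2]
    simp_rw [← hwy, Finset.smul_sum]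
    rw [Finset.sum_comm]
    refine Finset.sum_congr rfl fun j _ => ?_
    have h3 : inner ℝ (emb (k' j)) a = ∑ i, k' j i * inner ℝ (e i : H) a := by
      simp [emb, sum_inner, real_inner_smul_left]
    rw [h3, Finset.sum_smul]
    refine Finset.sum_congr rfl fun i _ => ?_
    rw [← hk'w, smul_smul, mul_comm]

/-- On the span of the given vectors `T` is the map `a ↦ (⟨g_j, a⟩)` followed by an operator on
`ℓ_∞^m` dominated by a weight `μ` of mass at most one. Each `⟨g_j, ·⟩ / 3` lies in the dual unit
ball, so the weak `2p`-sum controls every coordinate, and averaging over `μ` finishes. -/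
theorem CotypeBound.summingBound_lattice {p : ℕ} (hp : p ≠ 0) {C : ℝ} (hZ : CotypeBound Z p C) :
    ∃ K : ℝ, 0 ≤ K ∧ ∀ {H : Type} [NormedAddCommGroup H] [InnerProductSpace ℝ H]
      (T : H →L[ℝ] Z) {c : ℝ}, 0 ≤ c → SummingBound 1 (adj T) c →
        SummingBound (2 * p) T (K * c) := by
  obtain ⟨K, hK, hw⟩ := hZ.exists_weight hp
  refine ⟨3 * K, by positivity, fun {H} _ _ T c hc hT n a M hM ha => ?_⟩
  have : FiniteDimensional ℝ (Submodule.span ℝ (Set.range a)) :=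
    FiniteDimensional.span_of_finite ℝ (Set.finite_range a)
  obtain ⟨m, g, L, hg, hL, hTL⟩ := exists_factorization_of_summingBound T hT
    (Submodule.span ℝ (Set.range a))
  obtain ⟨μ, hμ0, hμ1, hμ⟩ := hw m L c hc hL
  calc ∑ i, ‖T (a i)‖ ^ (2 * p)
      ≤ ∑ i, (K * c) ^ (2 * p) * ∑ j, μ j * |inner ℝ (g j) (a i)| ^ (2 * p) := by
        refine Finset.sum_le_sum fun i _ => ?_
        rw [hTL (a i) (Submodule.subset_span ⟨i, rfl⟩)]
        exact hμ _
    _ = (K * c) ^ (2 * p) * ∑ j, μ j * ∑ i, |inner ℝ (g j) (a i)| ^ (2 * p) := by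
        rw [← Finset.mul_sum, Finset.sum_comm]; simp_rw [Finset.mul_sum]
    _ ≤ (K * c) ^ (2 * p) * ∑ j, μ j * (3 * M) ^ (2 * p) := by
        gcongr with j
        · exact hμ0 j
        · have h1 := ha ((3 : ℝ)⁻¹ • innerSL ℝ (g j)) (by
            rw [norm_smul, innerSL_apply_norm, norm_inv, Real.norm_of_nonneg (by norm_num)]
            linarith [hg j])
          have h2 : ∀ i, |((3 : ℝ)⁻¹ • innerSL ℝ (g j)) (a i)| ^ (2 * p) =
              ((3 : ℝ) ^ (2 * p))⁻¹ * |inner ℝ (g j) (a i)| ^ (2 * p) := fun i => by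
            rw [← inv_pow, ← mul_pow]
            congr 1
            simp [abs_mul]
          simp_rw [h2] at h1
          rw [← Finset.mul_sum, inv_mul_le_iff₀ (by positivity)] at h1
          rw [mul_pow]; exact h1
    _ ≤ (K * c) ^ (2 * p) * (1 * (3 * M) ^ (2 * p)) := by
        rw [← Finset.sum_mul]; gcongr
    _ = (3 * K * c * M) ^ (2 * p) := by rw [one_mul, ← mul_pow]; ring

end BanachLattice

/-! ### Summing inequalities for integrals -/

section SummingIntegrals

theorem eLpNorm_le_ofReal_iff {X : Type*} [NormedAddCommGroup X] {Ω : Type*}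
    [MeasurableSpace Ω] {μ : Measure Ω} {F : Ω → X} {k : ℕ}
    (hk : k ≠ 0) (hF : MemLp F k μ) {M : ℝ} (hM : 0 ≤ M) :
    eLpNorm F k μ ≤ ENNReal.ofReal M ↔ ∫ ω, ‖F ω‖ ^ k ∂μ ≤ M ^ k := by
  have hk' : ((k : ℝ≥0∞)) ≠ 0 := by simpa using hk
  have hI : 0 ≤ ∫ ω, ‖F ω‖ ^ k ∂μ := integral_nonneg fun _ => by positivity
  rw [hF.eLpNorm_eq_integral_rpow_norm hk' (by simp), ENNReal.ofReal_le_ofReal_iff hM]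
  simp only [ENNReal.toReal_natCast, Real.rpow_natCast]
  rw [Real.rpow_inv_le_iff_of_pos hI hM (by positivity), Real.rpow_natCast]

variable {X E : Type*} [NormedAddCommGroup X] [NormedSpace ℝ X]
  [NormedAddCommGroup E] [NormedSpace ℝ E]

/-- The summing inequality extends to simple random variables. -/
theorem SummingBound.simpleFunc {k : ℕ} (hk : k ≠ 0) {T : E →L[ℝ] X} {c : ℝ}
    (h : SummingBound k T c) {Ω : Type*} [MeasurableSpace Ω] {μ : Measure Ω} [IsFiniteMeasure μ]
    (φ : SimpleFunc Ω E) {M : ℝ} (hM : 0 ≤ M)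
    (hφ : ∀ f : StrongDual ℝ E, ‖f‖ ≤ 1 → ∫ ω, |f (φ ω)| ^ k ∂μ ≤ M ^ k) :
    ∫ ω, ‖T (φ ω)‖ ^ k ∂μ ≤ (c * M) ^ k := by
  have hint : ∀ g : E → ℝ, g 0 = 0 →
      ∫ ω, g (φ ω) ∂μ = ∑ v ∈ φ.range, μ.real (φ ⁻¹' {v}) * g v := by
    intro g hg
    have h1 := SimpleFunc.map_integral (μ := μ) φ g
    have h2 : ∫ ω, g (φ ω) ∂μ = (φ.map g).integral μ := by
      rw [SimpleFunc.integral_eq_integral _ (SimpleFunc.integrable_of_isFiniteMeasure _)]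
      rfl
    rw [h2, h1 (SimpleFunc.integrable_of_isFiniteMeasure _) hg]
    rfl
  -- Scaling each value by the `k`-th root of the mass of its level set turns both integrals into
  -- finite `k`-sums.
  set r : φ.range → ℝ := fun v => (μ.real (φ ⁻¹' {(v : E)})) ^ ((k : ℝ)⁻¹) with hr
  have hr0 : ∀ v, 0 ≤ r v := fun v => by positivity
  have hrk : ∀ v, r v ^ k = μ.real (φ ⁻¹' {(v : E)}) := fun v =>
    Real.rpow_inv_natCast_pow (by positivity) hk
  have h1 := h.fintype (fun v : φ.range => r v • (v : E)) hM fun f hf => by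
    refine le_trans (le_of_eq ?_) (hφ f hf)
    rw [hint (fun v : E => |f v| ^ k) (by simp [hk]), ← Finset.sum_coe_sort φ.range]
    refine Finset.sum_congr rfl fun v _ => ?_
    rw [map_smul, smul_eq_mul, abs_mul, mul_pow, abs_of_nonneg (hr0 v), hrk]
  refine le_trans (le_of_eq ?_) h1
  rw [hint (fun v : E => ‖T v‖ ^ k) (by simp [hk]), ← Finset.sum_coe_sort φ.range]
  refine Finset.sum_congr rfl fun v _ => ?_
  rw [map_smul, norm_smul, mul_pow, Real.norm_of_nonneg (hr0 v), hrk]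

/-- The summing inequality extends to integrals. -/
theorem SummingBound.integral_le {k : ℕ} (hk : k ≠ 0) {T : E →L[ℝ] X} {c : ℝ} (hc : 0 ≤ c)
    (h : SummingBound k T c) {Ω : Type*} [MeasurableSpace Ω] {μ : Measure Ω} [IsFiniteMeasure μ]
    {F : Ω → E} (hF : MemLp F k μ) {M : ℝ} (hM : 0 ≤ M)
    (hFM : ∀ f : StrongDual ℝ E, ‖f‖ ≤ 1 → ∫ ω, |f (F ω)| ^ k ∂μ ≤ M ^ k) :
    ∫ ω, ‖T (F ω)‖ ^ k ∂μ ≤ (c * M) ^ k := by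
  have hk1 : (1 : ℝ≥0∞) ≤ k := by exact_mod_cast Nat.one_le_iff_ne_zero.2 hk
  have hTF : MemLp (fun ω => T (F ω)) k μ := T.comp_memLp' hF
  have key : ∀ δ : ℝ, 0 < δ → eLpNorm (fun ω => T (F ω)) k μ ≤
      ENNReal.ofReal (c * (M + δ) + ‖T‖ * δ) := by
    intro δ hδ
    obtain ⟨φ, hφ, hφL⟩ := hF.exists_simpleFunc_eLpNorm_sub_lt (by simp)
      (ε := ENNReal.ofReal δ) (by simpa using hδ)
    have h1 : ∫ ω, ‖T (φ ω)‖ ^ k ∂μ ≤ (c * (M + δ)) ^ k := by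
      refine h.simpleFunc hk φ (by positivity) fun f hf => ?_
      have h2 : MemLp (fun ω => f (φ ω)) k μ := f.comp_memLp' hφL
      have h3 := (eLpNorm_le_ofReal_iff hk h2 (by positivity : 0 ≤ M + δ)).1
      simp only [Real.norm_eq_abs] at h3
      refine h3 ?_
      have h4 : MemLp (fun ω => f (F ω)) k μ := f.comp_memLp' hF
      have h5 : eLpNorm (fun ω => f (F ω)) k μ ≤ ENNReal.ofReal M :=
        (eLpNorm_le_ofReal_iff hk h4 hM).2 (by simpa using hFM f hf)
      have h6 : eLpNorm (fun ω => f (F ω - φ ω)) k μ ≤ ENNReal.ofReal δ := by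
        refine le_trans (eLpNorm_mono fun ω => ?_) hφ.le
        calc ‖f (F ω - φ ω)‖ ≤ ‖f‖ * ‖F ω - φ ω‖ := f.le_opNorm _
          _ ≤ 1 * ‖F ω - φ ω‖ := by gcongr
          _ = ‖(F - ⇑φ) ω‖ := one_mul _
      have h7 : (fun ω => f (φ ω)) = (fun ω => f (F ω)) - fun ω => f (F ω - φ ω) := by
        ext ω; simp
      rw [h7, ENNReal.ofReal_add hM hδ.le]
      refine (eLpNorm_sub_le h4.1 (f.comp_memLp' (hF.sub hφL)).1 hk1).trans (add_le_add h5 h6)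
    have hTφ : MemLp (fun ω => T (φ ω)) k μ := T.comp_memLp' hφL
    have h8 := (eLpNorm_le_ofReal_iff hk hTφ (by positivity : 0 ≤ c * (M + δ))).2 h1
    have h9 : eLpNorm (fun ω => T (F ω - φ ω)) k μ ≤ ENNReal.ofReal (‖T‖ * δ) := by
      rw [ENNReal.ofReal_mul (norm_nonneg _)]
      refine le_trans (eLpNorm_le_mul_eLpNorm_of_ae_le_mul (f := fun ω => T (F ω - φ ω))
        (g := F - ⇑φ) (c := ‖T‖) ?_ k) ?_
      · exact Eventually.of_forall fun ω => T.le_opNorm _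
      · gcongr
    have h10 : (fun ω => T (F ω)) = (fun ω => T (φ ω)) + fun ω => T (F ω - φ ω) := by
      ext ω; simp
    rw [h10, ENNReal.ofReal_add (by positivity) (by positivity)]
    exact (eLpNorm_add_le hTφ.1 (T.comp_memLp' (hF.sub hφL)).1 hk1).trans (add_le_add h8 h9)
  rw [← eLpNorm_le_ofReal_iff hk hTF (by positivity)]
  have hlim : Tendsto (fun δ : ℝ => ENNReal.ofReal (c * (M + δ) + ‖T‖ * δ)) (𝓝[>] 0)
      (𝓝 (ENNReal.ofReal (c * (M + 0) + ‖T‖ * 0))) := by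
    refine (ENNReal.continuous_ofReal.comp ?_).continuousAt.tendsto.mono_left nhdsWithin_le_nhds
    fun_prop
  simp only [add_zero, mul_zero] at hlim
  exact ge_of_tendsto hlim (by filter_upwards [self_mem_nhdsWithin] with δ hδ using key δ hδ)

end SummingIntegrals

/-! ### Standard Gaussian vectors and the contraction principle -/

section Gaussian

open ProbabilityTheory

variable {X : Type*} [NormedAddCommGroup X] [NormedSpace ℝ X]

/-- The `k`-th absolute moment of a standard Gaussian variable. -/
def gaussMoment (k : ℕ) : ℝ := ∫ x, |x| ^ k ∂(gaussianReal 0 1)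

theorem gaussMoment_nonneg (k : ℕ) : 0 ≤ gaussMoment k := integral_nonneg fun _ => by positivity

/-- Under the standard Gaussian measure `L` is a centred Gaussian variable with standard deviation
`‖L‖`. -/
theorem integral_abs_dual_pow {E : Type*} [NormedAddCommGroup E] [InnerProductSpace ℝ E]
    [FiniteDimensional ℝ E] [MeasurableSpace E] [BorelSpace E] (L : StrongDual ℝ E) (k : ℕ) :
    ∫ g, |L g| ^ k ∂(stdGaussian E) = ‖L‖ ^ k * gaussMoment k := by
  have h1 : (stdGaussian E).map L = (gaussianReal 0 1).map (‖L‖ * ·) := by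
    rw [IsGaussian.map_eq_gaussianReal L, gaussianReal_map_const_mul,
      integral_strongDual_stdGaussian, variance_dual_stdGaussian]
    congr 1
    · simp
    · ext; simp
  have h2 : ∫ x, |x| ^ k ∂((stdGaussian E).map L) = ∫ g, |L g| ^ k ∂(stdGaussian E) :=
    integral_map (by fun_prop) (by fun_prop)
  rw [← h2, h1, integral_map (by fun_prop) (by fun_prop)]
  simp_rw [abs_mul, abs_norm, mul_pow]
  rw [integral_const_mul, gaussMoment]

theorem gaussMoment_two : gaussMoment 2 = 1 := by
  have h := variance_id_gaussianReal (μ := 0) (v := 1)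
  rw [variance_eq_integral (by fun_prop)] at h
  simpa [gaussMoment] using h

theorem gaussMoment_one_pos : 0 < gaussMoment 1 := by
  rw [gaussMoment, integral_pos_iff_support_of_nonneg (fun x => by positivity) (by
    simpa using ((memLp_one_iff_integrable.1 (memLp_id_gaussianReal' (μ := 0) (v := 1) 1
      (by simp))).norm))]
  have h1 : (Function.support fun x : ℝ => |x| ^ 1) = {0}ᶜ := by ext x; simp
  rw [h1, measure_compl (by simp) (by simp)]
  have := nullSingletonClass_gaussianReal (μ := 0) (v := 1) one_ne_zero
  simp

variable {m n : ℕ}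

theorem memLp_stdGaussian {E : Type*} [NormedAddCommGroup E] [InnerProductSpace ℝ E]
    [FiniteDimensional ℝ E] [MeasurableSpace E] [BorelSpace E] (S : E →L[ℝ] X) (k : ℕ) :
    MemLp S k (stdGaussian E) := by
  have := FiniteDimensional.proper ℝ E
  exact S.comp_memLp' (IsGaussian.memLp_id (stdGaussian E) k (by simp))

theorem integrable_norm_pow_stdGaussian {E : Type*} [NormedAddCommGroup E]
    [InnerProductSpace ℝ E] [FiniteDimensional ℝ E] [MeasurableSpace E] [BorelSpace E]
    (S : E →L[ℝ] X) (k : ℕ) : Integrable (fun g => ‖S g‖ ^ k) (stdGaussian E) := by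
  have h := (memLp_stdGaussian S k).integrable_norm_pow'
  simpa using h

/-- The Gaussian second moment `𝔼 ‖S g‖²`. -/
def gaussSq (S : EuclideanSpace ℝ (Fin n) →L[ℝ] X) : ℝ :=
  ∫ g, ‖S g‖ ^ 2 ∂(stdGaussian (EuclideanSpace ℝ (Fin n)))

theorem gaussSq_nonneg (S : EuclideanSpace ℝ (Fin n) →L[ℝ] X) : 0 ≤ gaussSq S :=
  integral_nonneg fun _ => by positivity

/-- A contraction of a standard Gaussian vector is completed to a standard Gaussian vector by an
independent centered Gaussian summand. -/
theorem exists_completing_gaussian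
    (A : EuclideanSpace ℝ (Fin n) →L[ℝ] EuclideanSpace ℝ (Fin m)) (hA : ‖A‖ ≤ 1) :
    ∃ ν : Measure (EuclideanSpace ℝ (Fin m)), IsGaussian ν ∧ ∫ y, y ∂ν = 0 ∧
      (((stdGaussian (EuclideanSpace ℝ (Fin n))).map A).prod ν).map (fun p => p.1 + p.2) =
        stdGaussian (EuclideanSpace ℝ (Fin m)) := by
  set B := ContinuousLinearMap.adjoint A with hB
  set e := EuclideanSpace.basisFun (Fin m) ℝ with he
  -- The matrix of `1 - A A*`, positive semidefinite because `A` is a contraction. Adding an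
  -- independent Gaussian with this covariance restores the identity covariance, as the
  -- characteristic functions show.
  set S : Matrix (Fin m) (Fin m) ℝ := fun i j => inner ℝ (e i) (e j) - inner ℝ (B (e i)) (B (e j))
    with hS
  have hquad : ∀ x : EuclideanSpace ℝ (Fin m),
      x.ofLp ⬝ᵥ (S.mulVec x.ofLp) = ‖x‖ ^ 2 - ‖B x‖ ^ 2 := by
    intro x
    have hx : x = ∑ i, x i • e i := by
      conv_lhs => rw [← e.sum_repr x]
      simp [he]
    have h1 : ‖x‖ ^ 2 - ‖B x‖ ^ 2 =
        inner ℝ (∑ i, x i • e i) (∑ i, x i • e i) -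
          inner ℝ (B (∑ i, x i • e i)) (B (∑ i, x i • e i)) := by
      rw [← hx, real_inner_self_eq_norm_sq, real_inner_self_eq_norm_sq]
    rw [h1]
    simp only [map_sum, map_smul, sum_inner, inner_sum, real_inner_smul_left,
      real_inner_smul_right, dotProduct, Matrix.mulVec, hS]
    rw [← Finset.sum_sub_distrib]
    refine Finset.sum_congr rfl fun i _ => ?_
    rw [Finset.mul_sum, ← Finset.sum_sub_distrib]
    refine Finset.sum_congr rfl fun j _ => ?_
    rw [real_inner_comm (e i) (e j), real_inner_comm (B (e i)) (B (e j))]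
    ring
  have hBn : ‖B‖ ≤ 1 := by rw [hB, LinearIsometryEquiv.norm_map]; exact hA
  have hpos : S.PosSemidef := by
    refine Matrix.PosSemidef.of_dotProduct_mulVec_nonneg ?_ fun x => ?_
    · ext i j
      rw [Matrix.conjTranspose_apply, star_trivial]
      simp only [hS]
      rw [real_inner_comm, real_inner_comm (B _)]
    · have h1 := hquad (WithLp.toLp 2 x)
      simp only [star_trivial]
      rw [h1, sub_nonneg]
      have h2 : ‖B (WithLp.toLp 2 x)‖ ≤ ‖(WithLp.toLp 2 x : EuclideanSpace ℝ (Fin m))‖ := by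
        calc _ ≤ ‖B‖ * ‖(WithLp.toLp 2 x : EuclideanSpace ℝ (Fin m))‖ := B.le_opNorm _
          _ ≤ 1 * _ := by gcongr
          _ = _ := one_mul _
      gcongr
  refine ⟨multivariateGaussian 0 S, inferInstance, integral_id_multivariateGaussian, ?_⟩
  have : IsProbabilityMeasure ((stdGaussian (EuclideanSpace ℝ (Fin n))).map A) :=
    Measure.isProbabilityMeasure_map (by fun_prop)
  refine Measure.ext_of_charFun ?_
  ext t
  rw [charFun_map_add_prod_eq_mul, Pi.mul_apply, charFun_multivariateGaussian hpos, hquad,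
    charFun_stdGaussian]
  have h1 : charFun ((stdGaussian (EuclideanSpace ℝ (Fin n))).map A) t =
      charFun (stdGaussian (EuclideanSpace ℝ (Fin n))) (B t) := by
    rw [charFun_apply, charFun_apply, integral_map (by fun_prop) (by fun_prop)]
    simp only [hB, ContinuousLinearMap.adjoint_inner_right]
  rw [h1, charFun_stdGaussian, ← Complex.exp_add]
  congr 1
  simp
  ring

/-- The contraction principle for Gaussian averages. -/
theorem gaussSq_comp_le_of_norm_le_one (S : EuclideanSpace ℝ (Fin m) →L[ℝ] X)
    (A : EuclideanSpace ℝ (Fin n) →L[ℝ] EuclideanSpace ℝ (Fin m)) (hA : ‖A‖ ≤ 1) :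
    gaussSq (S.comp A) ≤ gaussSq S := by
  obtain ⟨ν, hν, hν0, hsum⟩ := exists_completing_gaussian A hA
  have : IsProbabilityMeasure ((stdGaussian (EuclideanSpace ℝ (Fin n))).map A) :=
    Measure.isProbabilityMeasure_map (by fun_prop)
  have hSint := integrable_norm_pow_stdGaussian S 2
  rw [← hsum, integrable_map_measure (by fun_prop) (by fun_prop)] at hSint
  have h1 : gaussSq S = ∫ x, ∫ y, ‖S (x + y)‖ ^ 2 ∂ν
      ∂((stdGaussian (EuclideanSpace ℝ (Fin n))).map A) := by
    rw [gaussSq, ← hsum, integral_map (by fun_prop) (by fun_prop)]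
    exact integral_prod _ hSint
  have hνL : ∀ x, MemLp (fun y => ‖S (x + y)‖) 2 ν := fun x =>
    (S.comp_memLp' ((memLp_const x).add (IsGaussian.memLp_id ν 2 (by simp)))).norm
  -- Jensen's inequality: the added Gaussian is centred, so averaging over it can only increase the
  -- squared norm. The square of the mean is compared with the mean square through nonnegativity of
  -- the variance.
  have h2 : ∀ x, ‖S x‖ ^ 2 ≤ ∫ y, ‖S (x + y)‖ ^ 2 ∂ν := by
    intro x
    have hid : Integrable (fun y => y) ν := IsGaussian.integrable_id
    have h3 : S x = S (∫ y, (x + y) ∂ν) := by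
      rw [integral_add (integrable_const x) hid, hν0]; simp
    obtain ⟨f, hf, hfx⟩ := exists_dual_vector'' ℝ (S x)
    have hfx' : ‖S x‖ ≤ ∫ y, ‖S (x + y)‖ ∂ν := by
      have h4 : f (S x) = ∫ y, f (S (x + y)) ∂ν := by
        conv_lhs => rw [h3]
        exact ((f.comp S).integral_comp_comm ((integrable_const x).add hid)).symm
      have h5 : f (S x) = ‖S x‖ := hfx
      rw [← h5, h4]
      refine integral_mono ((f.comp S).integrable_comp ((integrable_const x).add hid))
        ((hνL x).integrable (by norm_num)) fun y => ?_
      calc f (S (x + y)) ≤ ‖f‖ * ‖S (x + y)‖ := (le_abs_self _).trans (f.le_opNorm _)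
        _ ≤ 1 * ‖S (x + y)‖ := by gcongr
        _ = _ := one_mul _
    refine (pow_le_pow_left₀ (norm_nonneg _) hfx' 2).trans ?_
    have h5 := variance_nonneg (fun y => ‖S (x + y)‖) ν
    rw [variance_eq_sub (hνL x)] at h5
    simpa using h5
  rw [h1, gaussSq]
  have h6 : ∫ g, ‖(S.comp A) g‖ ^ 2 ∂(stdGaussian (EuclideanSpace ℝ (Fin n))) =
      ∫ x, ‖S x‖ ^ 2 ∂((stdGaussian (EuclideanSpace ℝ (Fin n))).map A) := by
    rw [integral_map (by fun_prop) (by fun_prop)]; rfl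
  rw [h6]
  refine integral_mono ?_ hSint.integral_prod_left h2
  rw [integrable_map_measure (by fun_prop) (by fun_prop)]
  exact integrable_norm_pow_stdGaussian (S.comp A) 2

theorem gaussSq_smul (S : EuclideanSpace ℝ (Fin n) →L[ℝ] X) (c : ℝ) :
    gaussSq (c • S) = c ^ 2 * gaussSq S := by
  simp only [gaussSq, _root_.smul_apply, norm_smul, mul_pow, Real.norm_eq_abs, sq_abs]
  rw [integral_const_mul]

theorem gaussSq_comp_le (S : EuclideanSpace ℝ (Fin m) →L[ℝ] X)
    (A : EuclideanSpace ℝ (Fin n) →L[ℝ] EuclideanSpace ℝ (Fin m)) {c : ℝ} (hc : 0 ≤ c)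
    (hA : ‖A‖ ≤ c) : gaussSq (S.comp A) ≤ c ^ 2 * gaussSq S := by
  rcases hc.eq_or_lt with h0 | h0
  · have : A = 0 := norm_eq_zero.1 (le_antisymm (hA.trans h0.ge) (norm_nonneg _))
    rw [this, ← h0]; simp [gaussSq]
  · have h1 := gaussSq_comp_le_of_norm_le_one (c • S) (c⁻¹ • A) (by
      rw [norm_smul, norm_inv, Real.norm_of_nonneg hc, inv_mul_le_iff₀ h0, mul_one]; exact hA)
    have h2 : (c • S).comp (c⁻¹ • A) = S.comp A := by
      ext x; simp [smul_smul, h0.ne']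
    rwa [h2, gaussSq_smul] at h1

end Gaussian

/-! ### Gaussian averages of finite families, compared with sign averages -/

section GaussianAverages

open ProbabilityTheory

variable {X : Type*} [NormedAddCommGroup X] [NormedSpace ℝ X] {n : ℕ}

/-- The operator on Euclidean space mapping the unit vectors to a given family. -/
def comb (x : Fin n → X) : EuclideanSpace ℝ (Fin n) →L[ℝ] X :=
  ∑ i, (EuclideanSpace.proj i : EuclideanSpace ℝ (Fin n) →L[ℝ] ℝ).smulRight (x i)

theorem comb_apply (x : Fin n → X) (g : EuclideanSpace ℝ (Fin n)) :
    comb x g = ∑ i, g i • x i := by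
  simp [comb, _root_.sum_apply]

theorem euclidean_eq_sum (g : EuclideanSpace ℝ (Fin n)) :
    g = ∑ i, g i • EuclideanSpace.single i (1 : ℝ) := by
  ext j
  simp [Finset.sum_apply, Pi.single_apply]

theorem comp_comb {Y : Type*} [NormedAddCommGroup Y] [NormedSpace ℝ Y] (T : X →L[ℝ] Y)
    (x : Fin n → X) : T.comp (comb x) = comb fun i => T (x i) := by
  ext g; simp [comb_apply]

theorem eq_comb (S : EuclideanSpace ℝ (Fin n) →L[ℝ] X) :
    S = comb fun i => S (EuclideanSpace.single i 1) := by
  ext g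
  rw [comb_apply]
  conv_lhs => rw [euclidean_eq_sum g]
  simp

/-- Cauchy-Schwarz against a norming functional. This turns weak `ℓ₂`-bounds into bounded operators,
to which the contraction principle applies. -/
theorem norm_comb_le (x : Fin n → X) {M : ℝ} (hM : 0 ≤ M)
    (hx : ∀ f : StrongDual ℝ X, ‖f‖ ≤ 1 → ∑ i, |f (x i)| ^ 2 ≤ M ^ 2) : ‖comb x‖ ≤ M := by
  refine ContinuousLinearMap.opNorm_le_bound _ hM fun a => ?_
  obtain ⟨f, hf, hfx⟩ := exists_dual_vector'' ℝ (comb x a)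
  have hfx' : f (comb x a) = ‖comb x a‖ := hfx
  rw [← hfx', comb_apply]
  simp only [map_sum, map_smul, smul_eq_mul]
  refine (Real.sum_mul_le_sqrt_mul_sqrt _ _ _).trans ?_
  rw [EuclideanSpace.norm_eq, mul_comm]
  simp only [Real.norm_eq_abs, sq_abs]
  gcongr
  rw [Real.sqrt_le_left hM]
  simpa using hx f hf

theorem map_gaussianSeq (n : ℕ) :
    gaussianSeq.map (fun t : ℕ → ℝ => WithLp.toLp 2 (fun i : Fin n => t i)) =
      stdGaussian (EuclideanSpace ℝ (Fin n)) := by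
  rw [← map_pi_eq_stdGaussian]
  have h1 : Measure.pi (fun _ : Fin n => gaussianReal 0 1) =
      gaussianSeq.map (fun (t : ℕ → ℝ) (i : Fin n) => t i) := by
    refine Measure.pi_eq fun s hs => ?_
    rw [Measure.map_apply (by fun_prop) (MeasurableSet.univ_pi hs)]
    -- A box in the first `n` coordinates is a cylinder over `Finset.range n`, the form whose
    -- infinite product measure is known.
    have h2 : (fun (t : ℕ → ℝ) (i : Fin n) => t i) ⁻¹' (Set.univ.pi s) =
        Set.pi (Finset.range n) fun j => if h : j < n then s ⟨j, h⟩ else Set.univ := by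
      ext t
      simp only [Set.mem_preimage, Set.mem_pi, Set.mem_univ, true_imp_iff, Finset.coe_range,
        Set.mem_Iio]
      exact ⟨fun h j hj => by simpa [hj] using h ⟨j, hj⟩,
        fun h i => by simpa [i.2] using h i i.2⟩
    rw [h2, gaussianSeq, Measure.infinitePi_pi, ← Fin.prod_univ_eq_prod_range
      (fun j => gaussianReal 0 1 (if h : j < n then s ⟨j, h⟩ else Set.univ))]
    · simp
    · intro j hj
      rw [dif_pos (Finset.mem_range.1 hj)]
      exact hs _
  rw [h1, Measure.map_map (by fun_prop) (by fun_prop)]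
  rfl

theorem sum_range_eq_comb (x : ℕ → X) (n : ℕ) (t : ℕ → ℝ) :
    ∑ j ∈ Finset.range n, t j • x j =
      comb (fun i : Fin n => x i) (WithLp.toLp 2 fun i : Fin n => t i) := by
  rw [comb_apply, ← Fin.sum_univ_eq_sum_range (fun j => t j • x j)]

theorem memLp_sum_range (x : ℕ → X) (n : ℕ) :
    MemLp (fun t => ∑ j ∈ Finset.range n, t j • x j) 2 gaussianSeq := by
  have h := memLp_stdGaussian (comb fun i : Fin n => x i) 2
  rw [← map_gaussianSeq n] at h
  simp only [sum_range_eq_comb]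
  exact h.comp_of_map (by fun_prop : Measurable fun t : ℕ → ℝ =>
    WithLp.toLp 2 fun i : Fin n => t i).aemeasurable

theorem eLpNorm_sum_range (x : ℕ → X) (n : ℕ) :
    eLpNorm (fun t => ∑ j ∈ Finset.range n, t j • x j) 2 gaussianSeq =
      ENNReal.ofReal (√(gaussSq (comb fun i : Fin n => x i))) := by
  have h := memLp_stdGaussian (comb fun i : Fin n => x i) 2
  have h2 := h.eLpNorm_eq_integral_rpow_norm (by simp) (by simp)
  have h3 := h
  rw [← map_gaussianSeq n] at h3
  have h4 := eLpNorm_map_measure (p := 2) h3.1 (f := fun t : ℕ → ℝ => WithLp.toLp 2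
    fun i : Fin n => t i) (Measurable.aemeasurable (by fun_prop))
  rw [map_gaussianSeq] at h4
  simp only [sum_range_eq_comb]
  change eLpNorm ((comb fun i : Fin n => x i) ∘ fun t : ℕ → ℝ => WithLp.toLp 2
    fun i : Fin n => t i) 2 gaussianSeq = _
  rw [← h4]
  push_cast at h2
  rw [h2]
  simp [gaussSq, Real.sqrt_eq_rpow]

/-! ### Comparison with sign averages -/

theorem gaussSq_comb_smul_le (x : Fin n → X) (a : Fin n → ℝ) (ha : ∀ i, |a i| ≤ 1) :
    gaussSq (comb fun i => a i • x i) ≤ gaussSq (comb x) := by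
  have h1 : (comb fun i => a i • x i) =
      (comb x).comp (comb fun i => a i • EuclideanSpace.single i (1 : ℝ)) := by
    rw [comp_comb]
    congr 1
    ext i
    simp [comb_apply]
  rw [h1]
  refine gaussSq_comp_le_of_norm_le_one _ _ (ContinuousLinearMap.opNorm_le_bound _ zero_le_one
    fun g => ?_)
  rw [one_mul, ← sq_le_sq₀ (norm_nonneg _) (norm_nonneg _), EuclideanSpace.real_norm_sq_eq,
    EuclideanSpace.real_norm_sq_eq]
  refine Finset.sum_le_sum fun i _ => ?_
  have h2 : (comb (fun i => a i • EuclideanSpace.single i (1 : ℝ)) g) i = a i * g i := by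
    simp [comb_apply, Finset.sum_apply, Pi.single_apply, mul_comm]
  rw [h2, mul_pow]
  have := (sq_le_one_iff_abs_le_one _).2 (ha i)
  nlinarith [sq_nonneg (g i)]

theorem abs_units_le (u : ℤˣ) : |((u : ℤ) : ℝ)| ≤ 1 := by
  rcases Int.units_eq_one_or u with h | h <;> simp [h]

theorem units_mul_self (u : ℤˣ) : ((u : ℤ) : ℝ) * ((u : ℤ) : ℝ) = 1 := by
  rcases Int.units_eq_one_or u with h | h <;> simp [h]

theorem gaussSq_comb_sign (x : Fin n → X) (ε : Fin n → ℤˣ) :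
    gaussSq (comb fun i => ((ε i : ℤ) : ℝ) • x i) = gaussSq (comb x) := by
  refine le_antisymm (gaussSq_comb_smul_le x _ fun i => abs_units_le _) ?_
  have := gaussSq_comb_smul_le (fun i => ((ε i : ℤ) : ℝ) • x i) (fun i => ((ε i : ℤ) : ℝ))
    fun i => abs_units_le _
  simpa [smul_smul, units_mul_self] using this

theorem integrable_norm_comb_sq (x : Fin n → X) :
    Integrable (fun g => ‖∑ i, g i • x i‖ ^ 2) (stdGaussian (EuclideanSpace ℝ (Fin n))) := by
  simpa [comb_apply] using integrable_norm_pow_stdGaussian (comb x) 2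

theorem integral_signAvg {Ω : Type*} [MeasurableSpace Ω] {μ : Measure Ω}
    (F : (Fin n → ℤˣ) → Ω → ℝ) (hF : ∀ ε, Integrable (F ε) μ) :
    ∫ ω, signAvg (fun ε => F ε ω) ∂μ = signAvg fun ε => ∫ ω, F ε ω ∂μ := by
  simp only [signAvg]
  rw [integral_const_mul, integral_finsetSum _ fun ε _ => hF ε]

/-- The Gaussian average is unchanged by sign flips, so it equals its own average over all sign
patterns. Inner sign averages can then be estimated for fixed `g`. -/
theorem gaussSq_comb_eq_integral_signAvg (x : Fin n → X) :
    gaussSq (comb x) = ∫ g, signAvg (fun ε => ‖∑ i, ((ε i : ℤ) : ℝ) • g i • x i‖ ^ 2)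
      ∂(stdGaussian (EuclideanSpace ℝ (Fin n))) := by
  have h1 : ∀ ε : Fin n → ℤˣ, (fun g : EuclideanSpace ℝ (Fin n) =>
      ‖∑ i, ((ε i : ℤ) : ℝ) • g i • x i‖ ^ 2) =
        fun g => ‖∑ i, g i • ((ε i : ℤ) : ℝ) • x i‖ ^ 2 := fun ε => by
    ext g; simp_rw [smul_comm (_ : ℝ) (g.ofLp _)]
  rw [integral_signAvg (fun ε (g : EuclideanSpace ℝ (Fin n)) =>
    ‖∑ i, ((ε i : ℤ) : ℝ) • g i • x i‖ ^ 2) fun ε => by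
      rw [h1]; exact integrable_norm_comb_sq _]
  rw [← signAvg_const (n := n) (gaussSq (comb x))]
  congr 1
  ext ε
  rw [h1, ← gaussSq_comb_sign x ε, gaussSq]
  simp only [comb_apply]

theorem integral_coord_sq_le (i : Fin n) :
    ∫ g, (g i) ^ 2 ∂(stdGaussian (EuclideanSpace ℝ (Fin n))) ≤ 1 := by
  have h := integral_abs_dual_pow (EuclideanSpace.proj i : EuclideanSpace ℝ (Fin n) →L[ℝ] ℝ) 2
  simp only [sq_abs, gaussMoment_two, mul_one] at h
  refine (le_of_eq h).trans ?_
  refine pow_le_one₀ (norm_nonneg _) (ContinuousLinearMap.opNorm_le_bound _ zero_le_one fun g => ?_)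
  rw [one_mul]
  exact PiLp.norm_apply_le g i

theorem integrable_coord_sq (i : Fin n) :
    Integrable (fun g => (g i) ^ 2) (stdGaussian (EuclideanSpace ℝ (Fin n))) := by
  simpa using integrable_norm_pow_stdGaussian
    (EuclideanSpace.proj i : EuclideanSpace ℝ (Fin n) →L[ℝ] ℝ) 2

/-- For fixed `g`, type 2 is applied to the vectors `g i • x i`; integrating uses only that the
coordinates have second moment at most one. -/
theorem HasType.exists_gaussSq_comb_le (h : HasType X 2) :
    ∃ C : ℝ, 0 ≤ C ∧ ∀ (n : ℕ) (x : Fin n → X), gaussSq (comb x) ≤ C * ∑ i, ‖x i‖ ^ 2 := by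
  obtain ⟨C, hC⟩ := h
  refine ⟨C ^ 2, sq_nonneg _, fun n x => ?_⟩
  have h1 : ∀ g : EuclideanSpace ℝ (Fin n),
      signAvg (fun ε => ‖∑ i, ((ε i : ℤ) : ℝ) • g i • x i‖ ^ 2) ≤
        ∑ i, C ^ 2 * ‖x i‖ ^ 2 * (g i) ^ 2 := fun g => by
    have h2 := hC n fun i => g i • x i
    have h3 : 0 ≤ ∑ i, ‖g i • x i‖ ^ (2 : ℝ) := Finset.sum_nonneg fun i _ => by positivity
    rw [← sq_rademacherAverage]
    refine (pow_le_pow_left₀ (rademacherAverage_nonneg _) h2 2).trans (le_of_eq ?_)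
    rw [mul_pow, ← Real.sqrt_eq_rpow, Real.sq_sqrt h3, Finset.mul_sum]
    refine Finset.sum_congr rfl fun i _ => ?_
    rw [Real.rpow_ofNat, norm_smul, mul_pow, Real.norm_eq_abs, sq_abs]
    ring
  rw [gaussSq_comb_eq_integral_signAvg]
  have hint : ∀ i ∈ Finset.univ, Integrable (fun g : EuclideanSpace ℝ (Fin n) =>
      C ^ 2 * ‖x i‖ ^ 2 * (g i) ^ 2) (stdGaussian (EuclideanSpace ℝ (Fin n))) :=
    fun i _ => (integrable_coord_sq i).const_mul _
  calc _ ≤ ∫ g : EuclideanSpace ℝ (Fin n), ∑ i, C ^ 2 * ‖x i‖ ^ 2 * (g i) ^ 2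
        ∂(stdGaussian (EuclideanSpace ℝ (Fin n))) :=
        integral_mono_of_nonneg (Eventually.of_forall fun g =>
            signAvg_nonneg fun ε => by positivity)
          (integrable_finsetSum _ hint) (Eventually.of_forall h1)
    _ = ∑ i, C ^ 2 * ‖x i‖ ^ 2 *
          ∫ g, (g i) ^ 2 ∂(stdGaussian (EuclideanSpace ℝ (Fin n))) := by
        rw [integral_finsetSum _ hint]
        simp_rw [integral_const_mul]
    _ ≤ ∑ i, C ^ 2 * ‖x i‖ ^ 2 * 1 := by
        gcongr with i
        exact integral_coord_sq_le i
    _ = _ := by rw [Finset.mul_sum]; simp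

/-- Multiplication by the fixed sign pattern of `g` permutes the set of all sign patterns. -/
theorem signAvg_abs (x : Fin n → X) (g : Fin n → ℝ) :
    signAvg (fun ε => ‖∑ i, ((ε i : ℤ) : ℝ) • |g i| • x i‖ ^ 2) =
      signAvg (fun ε => ‖∑ i, ((ε i : ℤ) : ℝ) • g i • x i‖ ^ 2) := by
  simp only [signAvg]
  congr 1
  set s : Fin n → ℤˣ := fun i => if 0 ≤ g i then 1 else -1
  rw [← Equiv.sum_comp (Equiv.mulLeft s)]
  refine Finset.sum_congr rfl fun ε _ => ?_
  congr 3
  ext i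
  simp only [Equiv.coe_mulLeft, Pi.mul_apply, s]
  split_ifs with h
  · simp [abs_of_nonneg h]
  · simp [abs_of_neg (not_le.1 h)]

/-- By symmetry the Gaussian coordinates may be replaced by `ε i |g i|`. For fixed signs, Jensen's
inequality allows `|g i|` to be replaced by its mean `gaussMoment 1` inside the norm. -/
theorem sq_gaussMoment_one_mul_signAvg_le (x : Fin n → X) :
    gaussMoment 1 ^ 2 * signAvg (fun ε => ‖∑ i, ((ε i : ℤ) : ℝ) • x i‖ ^ 2) ≤
      gaussSq (comb x) := by
  set μ := stdGaussian (EuclideanSpace ℝ (Fin n))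
  have hcoord : ∀ i : Fin n, MemLp (fun g : EuclideanSpace ℝ (Fin n) => |g i|) 2 μ := fun i =>
    (memLp_stdGaussian (EuclideanSpace.proj i : EuclideanSpace ℝ (Fin n) →L[ℝ] ℝ) 2).norm
  have hL : ∀ y : Fin n → X, MemLp (fun g : EuclideanSpace ℝ (Fin n) => ∑ i, |g i| • y i) 2 μ :=
    fun y => memLp_finsetSum _ fun i _ =>
      ((ContinuousLinearMap.id ℝ ℝ).smulRight (y i)).comp_memLp' (hcoord i)
  have hone : ∀ i : Fin n, ∫ g, |g i| ∂μ = gaussMoment 1 := fun i => by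
    have h := integral_abs_dual_pow (EuclideanSpace.proj i : EuclideanSpace ℝ (Fin n) →L[ℝ] ℝ) 1
    simp only [pow_one] at h
    refine h.trans ?_
    have h1 : ‖(EuclideanSpace.proj i : EuclideanSpace ℝ (Fin n) →L[ℝ] ℝ)‖ = 1 := by
      refine le_antisymm (ContinuousLinearMap.opNorm_le_bound _ zero_le_one fun g => ?_) ?_
      · rw [one_mul]; exact PiLp.norm_apply_le g i
      · have := (EuclideanSpace.proj i : EuclideanSpace ℝ (Fin n) →L[ℝ] ℝ).le_opNorm
          (EuclideanSpace.single i 1)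
        simpa using this
    rw [h1, one_mul]
  have key : ∀ y : Fin n → X, gaussMoment 1 ^ 2 * ‖∑ i, y i‖ ^ 2 ≤
      ∫ g, ‖∑ i, |g i| • y i‖ ^ 2 ∂μ := by
    intro y
    obtain ⟨f, hf, hfx⟩ := exists_dual_vector'' ℝ (∑ i, y i)
    have hfx' : f (∑ i, y i) = ‖∑ i, y i‖ := hfx
    have h1 : gaussMoment 1 * ‖∑ i, y i‖ ≤ ∫ g, ‖∑ i, |g i| • y i‖ ∂μ := by
      have h2 : gaussMoment 1 * ‖∑ i, y i‖ = ∫ g, f (∑ i, |g i| • y i) ∂μ := by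
        rw [← hfx']
        simp only [map_sum, map_smul, smul_eq_mul]
        rw [integral_finsetSum _ fun i _ => ((hcoord i).integrable (by norm_num)).mul_const _,
          Finset.mul_sum]
        simp_rw [integral_mul_const, hone]
      rw [h2]
      refine integral_mono (f.integrable_comp ((hL y).integrable (by norm_num)))
        ((hL y).integrable (by norm_num)).norm fun g => ?_
      calc f (∑ i, |g i| • y i) ≤ ‖f‖ * ‖∑ i, |g i| • y i‖ :=
            (le_abs_self _).trans (f.le_opNorm _)
        _ ≤ 1 * ‖∑ i, |g i| • y i‖ := by gcongr
        _ = _ := one_mul _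
    have h3 := variance_nonneg (fun g : EuclideanSpace ℝ (Fin n) => ‖∑ i, |g i| • y i‖) μ
    rw [variance_eq_sub (hL y).norm] at h3
    rw [← mul_pow]
    refine (pow_le_pow_left₀ (mul_nonneg (gaussMoment_nonneg 1) (norm_nonneg _)) h1 2).trans ?_
    simpa using h3
  have hcomm : ∀ (ε : Fin n → ℤˣ) (g : EuclideanSpace ℝ (Fin n)),
      ∑ i, ((ε i : ℤ) : ℝ) • |g i| • x i = ∑ i, |g i| • ((ε i : ℤ) : ℝ) • x i := fun ε g => by
    simp_rw [smul_comm (_ : ℝ) |g.ofLp _|]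
  rw [gaussSq_comb_eq_integral_signAvg, ← signAvg_mul_left]
  have habs : ∀ g : EuclideanSpace ℝ (Fin n), signAvg (fun ε =>
      ‖∑ i, ((ε i : ℤ) : ℝ) • g i • x i‖ ^ 2) = signAvg (fun ε =>
        ‖∑ i, ((ε i : ℤ) : ℝ) • |g i| • x i‖ ^ 2) := fun g => (signAvg_abs x g).symm
  simp only [habs]
  rw [integral_signAvg (fun ε (g : EuclideanSpace ℝ (Fin n)) =>
    ‖∑ i, ((ε i : ℤ) : ℝ) • |g i| • x i‖ ^ 2)]
  · refine signAvg_mono fun ε => ?_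
    simp_rw [hcomm]
    exact key _
  · intro ε
    simp_rw [hcomm]
    exact (hL _).integrable_norm_pow (p := 2) (by norm_num)

/-- In spaces of cotype 2, the 2-summing norm is dominated by the Gaussian average. -/
theorem CotypeBound.summingBound_two {C : ℝ} (hX : CotypeBound X 2 C)
    (S : EuclideanSpace ℝ (Fin n) →L[ℝ] X) :
    SummingBound 2 S (C * (gaussMoment 1)⁻¹ * √(gaussSq S)) := by
  intro k b M hM hb
  have hm := gaussMoment_one_pos
  have h1 := hX.2 k fun i => S (b i)
  refine h1.trans ?_
  have hA := norm_comb_le b hM hb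
  -- The family `S (b i)` is `S` composed with an operator of norm at most `M`, so its Gaussian
  -- average is at most `M² gaussSq S`; cotype then needs only the comparison with signs.
  have h2 := gaussSq_comp_le S (comb b) hM hA
  rw [comp_comb] at h2
  have h3 := (sq_gaussMoment_one_mul_signAvg_le fun i => S (b i)).trans h2
  rw [mul_pow, sq_rademacherAverage]
  have h4 : signAvg (fun ε => ‖∑ i, ((ε i : ℤ) : ℝ) • S (b i)‖ ^ 2) ≤
      ((gaussMoment 1)⁻¹) ^ 2 * (M ^ 2 * gaussSq S) := by
    rw [inv_pow, ← div_eq_inv_mul, le_div_iff₀ (by positivity), mul_comm]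
    exact h3
  calc _ ≤ C ^ 2 * (((gaussMoment 1)⁻¹) ^ 2 * (M ^ 2 * gaussSq S)) := by
        gcongr
    _ = _ := by
        simp only [mul_pow, Real.sq_sqrt (gaussSq_nonneg S)]
        ring

/-- The Gaussian average of a summing operator. -/
theorem SummingBound.gaussSq_le {k : ℕ} (hk : 2 ≤ k) {S : EuclideanSpace ℝ (Fin n) →L[ℝ] X}
    {c : ℝ} (hc : 0 ≤ c) (h : SummingBound k S c) :
    gaussSq S ≤ (gaussMoment k ^ ((k : ℝ)⁻¹) * c) ^ 2 := by
  have hk0 : k ≠ 0 := by omega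
  set G := gaussMoment k ^ ((k : ℝ)⁻¹) with hG
  have hG0 : 0 ≤ G := Real.rpow_nonneg (gaussMoment_nonneg k) _
  have hGk : G ^ k = gaussMoment k := Real.rpow_inv_natCast_pow (gaussMoment_nonneg k) hk0
  -- The Gaussian vector itself is the random element: functionals of norm at most one have `k`-th
  -- moment at most `gaussMoment k`. Since the measure is a probability and `k ≥ 2`, the `L_k`-bound
  -- implies the `L₂`-bound.
  have h1 := h.integral_le hk0 hc (memLp_stdGaussian
    (ContinuousLinearMap.id ℝ (EuclideanSpace ℝ (Fin n))) k) hG0 fun f hf => by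
      simp only [ContinuousLinearMap.id_apply]
      rw [integral_abs_dual_pow, hGk]
      exact mul_le_of_le_one_left (gaussMoment_nonneg k) (pow_le_one₀ (norm_nonneg _) hf)
  simp only [ContinuousLinearMap.id_apply] at h1
  have h2 := (eLpNorm_le_ofReal_iff hk0 (memLp_stdGaussian S k) (by positivity)).2 h1
  have h3 : eLpNorm S 2 (stdGaussian (EuclideanSpace ℝ (Fin n))) ≤ ENNReal.ofReal (c * G) :=
    (eLpNorm_le_eLpNorm_of_exponent_le (by exact_mod_cast hk) (memLp_stdGaussian S k).1).trans h2
  have h4 := (eLpNorm_le_ofReal_iff (k := 2) (by norm_num) (memLp_stdGaussian S 2)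
    (by positivity : 0 ≤ c * G)).1 (by exact_mod_cast h3)
  rw [mul_comm]
  exact h4

end GaussianAverages

/-! ### Reduction of GAP to Euclidean domains -/

section FiniteDimensionalGAP

open ProbabilityTheory

variable {X : Type*} [NormedAddCommGroup X] [NormedSpace ℝ X]

theorem unitVec_apply (i j : ℕ) : (unitVec i : ell2) j = if j = i then 1 else 0 := by
  simp [unitVec, Pi.single_apply]

theorem inner_unitVec_left (i : ℕ) (a : ell2) : inner ℝ (unitVec i) a = a i := by
  rw [unitVec, lp.inner_single_left]; simp

theorem orthonormal_unitVec : Orthonormal ℝ unitVec := by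
  rw [orthonormal_iff_ite]
  intro i j
  rw [inner_unitVec_left, unitVec_apply]

/-- The embedding of Euclidean space into `ℓ₂`. -/
def toEll2 (n : ℕ) : EuclideanSpace ℝ (Fin n) →L[ℝ] ell2 := comb fun i => unitVec i

theorem norm_toEll2 {n : ℕ} (g : EuclideanSpace ℝ (Fin n)) : ‖toEll2 n g‖ = ‖g‖ := by
  have h : Orthonormal ℝ fun i : Fin n => unitVec i :=
    orthonormal_unitVec.comp _ Fin.val_injective
  rw [← sq_eq_sq₀ (norm_nonneg _) (norm_nonneg _), EuclideanSpace.real_norm_sq_eq,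
    ← real_inner_self_eq_norm_sq, toEll2, comb_apply, h.inner_sum]
  simp [sq]

theorem norm_toEll2_le (n : ℕ) : ‖toEll2 n‖ ≤ 1 :=
  ContinuousLinearMap.opNorm_le_bound _ zero_le_one fun g => by rw [norm_toEll2, one_mul]

theorem comp_toEll2 (T : ell2 →L[ℝ] X) (n : ℕ) :
    T.comp (toEll2 n) = comb fun i : Fin n => T (unitVec i) := comp_comb _ _

/-- The truncation of a sequence to its first coordinates. -/
def trunc (n : ℕ) : ell2 →L[ℝ] EuclideanSpace ℝ (Fin n) :=
  ContinuousLinearMap.adjoint (toEll2 n)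

theorem norm_trunc_le (n : ℕ) : ‖trunc n‖ ≤ 1 := by
  rw [trunc, LinearIsometryEquiv.norm_map]; exact norm_toEll2_le n

theorem trunc_apply {n : ℕ} (a : ell2) (i : Fin n) : trunc n a i = a i := by
  have h1 : trunc n a i = inner ℝ (EuclideanSpace.single i (1 : ℝ)) (trunc n a) := by
    rw [EuclideanSpace.inner_single_left]; simp
  have h2 : toEll2 n (EuclideanSpace.single i (1 : ℝ)) = unitVec i := by
    simp [toEll2, comb_apply]
  rw [h1, trunc, ContinuousLinearMap.adjoint_inner_right, h2, inner_unitVec_left]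

theorem trunc_unitVec (n j : ℕ) :
    trunc n (unitVec j) = if h : j < n then EuclideanSpace.single ⟨j, h⟩ 1 else 0 := by
  ext i
  rw [trunc_apply, unitVec_apply]
  split_ifs with h1 h2 h2
  · have : i = ⟨j, h2⟩ := Fin.ext h1
    simp [this]
  · exact absurd (h1 ▸ i.2) h2
  · have : i ≠ ⟨j, h2⟩ := fun h => h1 (by rw [h])
    simp [this]
  · simp

/-- The finite-dimensional form of `GAP`. -/
theorem HasGAP.exists_gaussSq_le (h : HasGAP X) :
    ∃ K : ℝ, 0 ≤ K ∧ ∀ (n : ℕ) (S : EuclideanSpace ℝ (Fin n) →L[ℝ] X) (c : ℝ), 0 ≤ c →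
      SummingBound 1 (adj S) c → gaussSq S ≤ (K * c) ^ 2 := by
  obtain ⟨K, hK⟩ := h
  refine ⟨K, K.2, fun n S c hc hS => ?_⟩
  set T := S.comp (trunc n) with hT
  have hfin : FiniteDimensional ℝ (LinearMap.range T.toLinearMap) :=
    Module.Finite.of_injective (Submodule.inclusion (LinearMap.range_comp_le_range
      (trunc n).toLinearMap S.toLinearMap)) (Submodule.inclusion_injective _)
  have hTS : SummingBound 1 (adj T) c := by
    have h1 : SummingBound 1 (adj T) (‖adj (trunc n)‖ * c) := hS.comp_left (adj (trunc n))
    exact h1.mono (by positivity)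
      (mul_le_of_le_one_left hc ((norm_adj_le _).trans (norm_trunc_le n)))
  have h1 : summingNorm 1 (adj T) ≤ ENNReal.ofReal c := by
    have := summingNorm_le_of_summingBound one_ne_zero hc hTS
    rwa [Nat.cast_one] at this
  have h2 : ellNorm T ≤ ENNReal.ofReal (K * c) := by
    refine (hK T hfin).trans ?_
    rw [ENNReal.ofReal_mul (NNReal.coe_nonneg K), ENNReal.ofReal_coe_nnreal]
    gcongr
  have h3 : ENNReal.ofReal (√(gaussSq S)) ≤ ellNorm T := by
    refine le_iInf₂ fun f hf => ?_
    -- For an operator precomposed with a truncation the Gaussian series is eventually constant, so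
    -- its sum is the `n`-th partial sum almost everywhere.
    have hconst : ∀ N, n ≤ N → ∀ t : ℕ → ℝ, ∑ j ∈ Finset.range N, t j • T (unitVec j) =
        ∑ j ∈ Finset.range n, t j • T (unitVec j) := by
      intro N hN t
      refine (Finset.sum_subset (Finset.range_subset_range.2 hN) fun j _ hj => ?_).symm
      rw [Finset.mem_range] at hj
      simp [hT, trunc_unitVec, hj]
    have hlim : Tendsto (fun _ : ℕ => eLpNorm (fun t => (∑ j ∈ Finset.range n,
        t j • T (unitVec j)) - f t) 2 gaussianSeq) atTop (𝓝 0) := by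
      refine hf.2.congr' ?_
      filter_upwards [eventually_ge_atTop n] with N hN
      simp_rw [hconst N hN]
    have h0 := tendsto_const_nhds_iff.1 hlim
    have hm := memLp_sum_range (fun j => T (unitVec j)) n
    replace h0 := (eLpNorm_eq_zero_iff (hm.1.sub hf.1.1) (by norm_num)).1 h0
    have h4 : (fun t : ℕ → ℝ => ∑ j ∈ Finset.range n, t j • T (unitVec j)) =ᵐ[gaussianSeq] f := by
      filter_upwards [h0] with t ht
      exact sub_eq_zero.1 ht
    rw [← eLpNorm_congr_ae h4, eLpNorm_sum_range]
    have h5 : (comb fun i : Fin n => T (unitVec i)) = S := by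
      conv_rhs => rw [eq_comb S]
      congr 1
      ext i
      simp [hT, trunc_unitVec]
    rw [h5]
  have h4 := (ENNReal.ofReal_le_ofReal_iff (mul_nonneg K.2 hc)).1 (h3.trans h2)
  exact (Real.sqrt_le_left (mul_nonneg K.2 hc)).1 h4

/-- By Riesz representation the coefficients are square summable. Differences of partial sums have
`L₂`-norm equal to the `ℓ₂`-norm of the corresponding block, so completeness of `L₂` provides the
limit. -/
theorem exists_isGaussianSum_real (φ : ell2 →L[ℝ] ℝ) : ∃ f, IsGaussianSum φ f := by
  set a := fun j => φ (unitVec j) with ha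
  have hsum : Summable fun j => a j ^ 2 := by
    set b := (InnerProductSpace.toDual ℝ ell2).symm φ
    have h1 : ∀ j, a j = b j := fun j => by
      rw [← inner_unitVec_left j b, real_inner_comm, InnerProductSpace.toDual_symm_apply]
    have := lp.summable_inner (𝕜 := ℝ) b b
    refine this.congr fun j => ?_
    rw [h1]; simp [sq]
  set u : ℕ → Lp ℝ 2 gaussianSeq := fun n => (memLp_sum_range a n).toLp _ with hu
  have hdist : ∀ M N, M ≤ N → ‖u N - u M‖ ^ 2 =
      ∑ j ∈ Finset.range N, a j ^ 2 - ∑ j ∈ Finset.range M, a j ^ 2 := by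
    intro M N hMN
    set d : ℕ → ℝ := fun j => if j < M then 0 else a j with hd
    have h1 : ∀ c : ℕ → ℝ, (∑ j ∈ Finset.range N, c j) =
        (∑ j ∈ Finset.range M, c j) + ∑ j ∈ Finset.range N, if j < M then 0 else c j := by
      intro c
      rw [← Finset.sum_range_add_sum_Ico _ hMN, ← Finset.sum_range_add_sum_Ico
        (fun j => if j < M then 0 else c j) hMN]
      congr 1
      rw [Finset.sum_congr rfl fun j hj => if_pos (Finset.mem_range.1 hj), Finset.sum_const_zero,
        zero_add]
      exact Finset.sum_congr rfl fun j hj => (if_neg (not_lt.2 (Finset.mem_Ico.1 hj).1)).symm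
    have h2 : u N - u M = (memLp_sum_range d N).toLp _ := by
      rw [hu, ← MemLp.toLp_sub]
      congr 1
      ext t
      simp only [Pi.sub_apply]
      rw [h1 fun j => t j • a j, add_sub_cancel_left]
      exact Finset.sum_congr rfl fun j _ => by simp only [hd]; split_ifs <;> simp
    rw [h2, Lp.norm_toLp, eLpNorm_sum_range, ENNReal.toReal_ofReal (Real.sqrt_nonneg _),
      Real.sq_sqrt (gaussSq_nonneg _), h1 fun j => a j ^ 2, add_sub_cancel_left]
    have h3 := integral_abs_dual_pow (comb fun i : Fin N => d i) 2
    rw [gaussMoment_two, mul_one] at h3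
    simp only [gaussSq, Real.norm_eq_abs]
    rw [h3]
    have h4 : (comb fun i : Fin N => d i) = innerSL ℝ (WithLp.toLp 2 fun i : Fin N => d i) := by
      ext g
      simp [comb_apply, PiLp.inner_apply]
    rw [h4, innerSL_apply_norm, EuclideanSpace.real_norm_sq_eq,
      ← Fin.sum_univ_eq_sum_range (fun j => if j < M then 0 else a j ^ 2)]
    refine Finset.sum_congr rfl fun i _ => ?_
    simp only [hd]
    split_ifs <;> simp
  have hcauchy : CauchySeq u := by
    have h1 := hsum.hasSum.tendsto_sum_nat.cauchySeq
    rw [Metric.cauchySeq_iff'] at h1 ⊢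
    intro ε hε
    obtain ⟨N, hN⟩ := h1 (ε ^ 2) (by positivity)
    refine ⟨N, fun n hn => ?_⟩
    have h2 := hN n hn
    rw [Real.dist_eq] at h2
    rw [dist_eq_norm, ← sq_lt_sq₀ (norm_nonneg _) hε.le, hdist N n hn]
    exact (le_abs_self _).trans_lt h2
  obtain ⟨f, hf⟩ := cauchySeq_tendsto_of_complete hcauchy
  refine ⟨f, Lp.memLp f, ?_⟩
  have h1 := (Lp.tendsto_Lp_iff_tendsto_eLpNorm' u f).1 hf
  refine h1.congr fun n => eLpNorm_congr_ae ?_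
  filter_upwards [(memLp_sum_range a n).coeFn_toLp] with t ht
  simp only [Pi.sub_apply, hu]
  rw [ht]

/-- Coordinates in a basis of the range reduce convergence to the scalar case, without using
completeness of `X`. An actual sum is needed because `ellNorm` is an infimum over sums and would
otherwise be `∞`. -/
theorem exists_isGaussianSum (T : ell2 →L[ℝ] X)
    (hT : FiniteDimensional ℝ (LinearMap.range T.toLinearMap)) : ∃ f, IsGaussianSum T f := by
  set R := LinearMap.range T.toLinearMap
  set b := Module.finBasis ℝ R
  set T' : ell2 →L[ℝ] R := T.codRestrict R fun x => ⟨x, rfl⟩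
  set φ : Fin (Module.finrank ℝ R) → ell2 →L[ℝ] ℝ := fun k =>
    (LinearMap.toContinuousLinearMap (b.coord k)).comp T' with hφ
  have hTφ : ∀ x, T x = ∑ k, φ k x • (b k : X) := by
    intro x
    have h1 := congrArg (Subtype.val : R → X) (b.sum_repr (T' x))
    simp only [Submodule.coe_sum, Submodule.coe_smul] at h1
    exact h1.symm
  choose w hw using fun k => exists_isGaussianSum_real (φ k)
  refine ⟨fun t => ∑ k, w k t • (b k : X), memLp_finsetSum _ fun k _ =>
    ((ContinuousLinearMap.id ℝ ℝ).smulRight (b k : X)).comp_memLp' (hw k).1, ?_⟩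
  have hlim : Tendsto (fun n : ℕ => ∑ k, ENNReal.ofReal ‖(b k : X)‖ *
      eLpNorm (fun t => (∑ j ∈ Finset.range n, t j • φ k (unitVec j)) - w k t) 2 gaussianSeq)
      atTop (𝓝 (∑ k : Fin (Module.finrank ℝ R), ENNReal.ofReal ‖(b k : X)‖ * 0)) :=
    tendsto_finsetSum _ fun k _ => ENNReal.Tendsto.const_mul (hw k).2 (Or.inr (by simp))
  simp only [mul_zero, Finset.sum_const_zero] at hlim
  refine tendsto_of_tendsto_of_tendsto_of_le_of_le tendsto_const_nhds hlim (fun _ => zero_le)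
    fun n => ?_
  have h1 : (fun t : ℕ → ℝ => (∑ j ∈ Finset.range n, t j • T (unitVec j)) -
      ∑ k, w k t • (b k : X)) = ∑ k, fun t : ℕ → ℝ =>
        ((∑ j ∈ Finset.range n, t j • φ k (unitVec j)) - w k t) • (b k : X) := by
    ext t
    simp only [Finset.sum_apply, sub_smul, Finset.sum_sub_distrib, Finset.sum_smul]
    rw [Finset.sum_comm]
    simp only [hTφ, Finset.smul_sum, smul_assoc]
  rw [h1]
  have hm : ∀ k, AEStronglyMeasurable (fun t : ℕ → ℝ =>
      (∑ j ∈ Finset.range n, t j • φ k (unitVec j)) - w k t) gaussianSeq := fun k =>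
    ((memLp_sum_range (fun j => φ k (unitVec j)) n).sub (hw k).1).1
  refine (eLpNorm_sum_le (fun k _ => (hm k).smul_const _) (by norm_num)).trans ?_
  refine Finset.sum_le_sum fun k _ => ?_
  refine eLpNorm_le_mul_eLpNorm_of_ae_le_mul (Eventually.of_forall fun t => ?_) 2
  rw [norm_smul, mul_comm]

/-- The partial sums of the Gaussian series are Gaussian averages of `T` restricted to the first
coordinates, a restriction that does not increase the constant of the adjoint; the bound survives
the limit. -/
theorem hasGAP_of_gaussSq_le {K : ℝ} (hK : 0 ≤ K)
    (h : ∀ (n : ℕ) (S : EuclideanSpace ℝ (Fin n) →L[ℝ] X) (c : ℝ), 0 ≤ c →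
      SummingBound 1 (adj S) c → gaussSq S ≤ (K * c) ^ 2) : HasGAP X := by
  -- The constant is increased by one to be nonzero, so that its product with an infinite summing
  -- norm is `∞` rather than `0`.
  refine ⟨Real.toNNReal (K + 1), fun T hT => ?_⟩
  rcases eq_top_or_lt_top (summingNorm 1 (adj T)) with htop | hlt
  · rw [htop, ENNReal.mul_top]
    · exact le_top
    · rw [ne_eq, ENNReal.coe_eq_zero]
      exact (Real.toNNReal_pos.2 (by positivity)).ne'
  obtain ⟨f, hf⟩ := exists_isGaussianSum T hT
  set c := (summingNorm 1 (adj T)).toReal with hc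
  have hc0 : 0 ≤ c := ENNReal.toReal_nonneg
  have hTc : SummingBound 1 (adj T) c := by
    have h1 : IsSumming ((1 : ℕ) : ℝ) (adj T) := by rw [Nat.cast_one]; exact hlt
    have := h1.summingBound one_ne_zero
    rwa [Nat.cast_one] at this
  have hpart : ∀ n, eLpNorm (fun t => ∑ j ∈ Finset.range n, t j • T (unitVec j)) 2 gaussianSeq ≤
      ENNReal.ofReal (K * c) := by
    intro n
    rw [eLpNorm_sum_range, ← comp_toEll2]
    refine ENNReal.ofReal_le_ofReal ((Real.sqrt_le_left (by positivity)).2 (h n _ c hc0 ?_))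
    have h1 : SummingBound 1 (adj (T.comp (toEll2 n))) (‖adj (toEll2 n)‖ * c) :=
      hTc.comp_left (adj (toEll2 n))
    exact h1.mono (by positivity)
      (mul_le_of_le_one_left hc0 ((norm_adj_le _).trans (norm_toEll2_le n)))
  have hf2 : eLpNorm f 2 gaussianSeq ≤ ENNReal.ofReal (K * c) := by
    have hlim := (tendsto_const_nhds (x := ENNReal.ofReal (K * c))).add hf.2
    rw [add_zero] at hlim
    refine ge_of_tendsto' hlim fun n => ?_
    have hm := memLp_sum_range (fun j => T (unitVec j)) n
    have h1 : f = (fun t => ∑ j ∈ Finset.range n, t j • T (unitVec j)) -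
        fun t => (∑ j ∈ Finset.range n, t j • T (unitVec j)) - f t := by
      ext t; simp
    conv_lhs => rw [h1]
    exact (eLpNorm_sub_le hm.1 (hm.sub hf.1).1 (by norm_num)).trans (add_le_add_left (hpart n) _)
  calc ellNorm T ≤ eLpNorm f 2 gaussianSeq := iInf₂_le f hf
    _ ≤ ENNReal.ofReal (K * c) := hf2
    _ ≤ ENNReal.ofReal ((K + 1) * c) := ENNReal.ofReal_le_ofReal (by nlinarith)
    _ = ENNReal.ofReal (K + 1) * summingNorm 1 (adj T) := by
        rw [ENNReal.ofReal_mul (by positivity), hc, ENNReal.ofReal_toReal hlt.ne]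
    _ = _ := rfl

/-- A uniform summing inequality for operators with 1-summing adjoint yields `GAP`. -/
theorem hasGAP_of_summingBound {k : ℕ} (hk : 2 ≤ k) {K : ℝ} (hK : 0 ≤ K)
    (h : ∀ (n : ℕ) (S : EuclideanSpace ℝ (Fin n) →L[ℝ] X) (c : ℝ), 0 ≤ c →
      SummingBound 1 (adj S) c → SummingBound k S (K * c)) : HasGAP X := by
  refine hasGAP_of_gaussSq_le (K := gaussMoment k ^ ((k : ℝ)⁻¹) * K)
    (mul_nonneg (Real.rpow_nonneg (gaussMoment_nonneg k) _) hK) fun n S c hc hS => ?_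
  rw [mul_assoc]
  exact (h n S c hc hS).gaussSq_le hk (mul_nonneg hK hc)

end FiniteDimensionalGAP

/-! ### Subspaces of lattices of finite cotype -/

section SubspacesOfLattices

variable {X : Type*} [NormedAddCommGroup X] [NormedSpace ℝ X]
  {Z : Type*} [NormedAddCommGroup Z] [NormedSpace ℝ Z]
  [Lattice Z] [IsOrderedAddMonoid Z] [PosSMulMono ℝ Z] [HasSolidNorm Z]

/-- The adjoint of `J ∘ T` is the adjoint of `T` after that of `J`, hence still 1-summing. The
lattice result applies to `J ∘ T`, and the lower bound on `J` returns the inequality to `T`. -/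
theorem CotypeBound.summingBound_of_embedding {p : ℕ} (hp : p ≠ 0) {C : ℝ}
    (hZ : CotypeBound Z p C) (J : X →L[ℝ] Z) {d : ℝ} (hd : 0 < d)
    (hJ : ∀ x, d * ‖x‖ ≤ ‖J x‖) :
    ∃ K : ℝ, 0 ≤ K ∧ ∀ {H : Type} [NormedAddCommGroup H] [InnerProductSpace ℝ H]
      (T : H →L[ℝ] X) {c : ℝ}, 0 ≤ c → SummingBound 1 (adj T) c →
        SummingBound (2 * p) T (K * c) := by
  obtain ⟨K, hK, h⟩ := hZ.summingBound_lattice hp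
  refine ⟨d⁻¹ * (K * ‖J‖), by positivity, fun T c hc hT => ?_⟩
  have h1 : SummingBound 1 (adj (J.comp T)) (c * ‖J‖) :=
    (hT.comp_right one_ne_zero (adj J)).mono (by positivity) (by gcongr; exact norm_adj_le J)
  have h2 := h (J.comp T) (by positivity) h1
  intro n x M hM hx
  have h3 := h2 n x M hM hx
  calc ∑ i, ‖T (x i)‖ ^ (2 * p) ≤ ∑ i, (d⁻¹ * ‖J (T (x i))‖) ^ (2 * p) := by
        gcongr with i
        rw [le_inv_mul_iff₀ hd]
        exact hJ _
    _ = d⁻¹ ^ (2 * p) * ∑ i, ‖J (T (x i))‖ ^ (2 * p) := by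
        rw [Finset.mul_sum]; simp_rw [mul_pow]
    _ ≤ d⁻¹ ^ (2 * p) * (K * (c * ‖J‖) * M) ^ (2 * p) := by gcongr; exact h3
    _ = _ := by rw [← mul_pow]; ring_nf

/-- Rounding the cotype up to a natural number `p` gives one `2p`-summing estimate. On `ℓ₂` it is
property `(S_{2p})`; on Euclidean spaces it yields GAP. -/
theorem HasFiniteCotype.hasS_and_hasGAP (hZ : HasFiniteCotype Z) (J : X →L[ℝ] Z)
    (hJ : ∃ c : ℝ, 0 < c ∧ ∀ x : X, c * ‖x‖ ≤ ‖J x‖) : HasS X ∧ HasGAP X := by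
  obtain ⟨q, hq, hcot⟩ := hZ
  obtain ⟨d, hd, hJd⟩ := hJ
  obtain ⟨p, hp⟩ := exists_nat_ge q
  have hp2 : (2 : ℝ) ≤ p := hq.trans hp
  have hp2' : 2 ≤ p := by exact_mod_cast hp2
  obtain ⟨C, hC⟩ := hcot.cotypeBound (by linarith) hp
  obtain ⟨K, hK, h⟩ := hC.summingBound_of_embedding (by omega) J hd hJd
  refine ⟨⟨((2 * p : ℕ) : ℝ), by exact_mod_cast (by omega : 1 ≤ 2 * p), Real.toNNReal K,
    fun T hT => ?_⟩, hasGAP_of_summingBound (k := 2 * p) (by omega) hK fun n S c hc hS => h S hc hS⟩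
  have hT1 : SummingBound 1 (adj T) (summingNorm 1 (adj T)).toReal := by
    have h1 : IsSumming ((1 : ℕ) : ℝ) (adj T) := by rw [Nat.cast_one]; exact hT
    have := h1.summingBound one_ne_zero
    rwa [Nat.cast_one] at this
  have h2 := summingNorm_le_of_summingBound (by omega)
    (mul_nonneg hK ENNReal.toReal_nonneg) (h T ENNReal.toReal_nonneg hT1)
  rw [ENNReal.ofReal_mul hK, ENNReal.ofReal_toReal (ne_of_lt hT)] at h2
  exact ⟨h2.trans_lt (ENNReal.mul_lt_top (by simp) hT), h2⟩

end SubspacesOfLattices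

/-! ### Pietsch domination and factorization through Hilbert space -/

section Domination

/-- The finite case of Pietsch's domination theorem for 2-summing maps. -/
theorem exists_pietsch_weights {W Y : Type*} [AddCommGroup W] [Module ℝ W]
    [NormedAddCommGroup Y] [NormedSpace ℝ Y] {m : ℕ} (g : Fin m → W →ₗ[ℝ] ℝ) (T : W →ₗ[ℝ] Y)
    {c : ℝ} (h : ∀ (n : ℕ) (w : Fin n → W) (B : ℝ), 0 ≤ B →
      (∀ j, ∑ k, (g j (w k)) ^ 2 ≤ B ^ 2) → ∑ k, ‖T (w k)‖ ^ 2 ≤ (c * B) ^ 2) :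
    ∃ μ : Fin m → ℝ, (∀ j, 0 ≤ μ j) ∧ ∑ j, μ j ≤ 1 ∧
      ∀ w, ‖T w‖ ^ 2 ≤ c ^ 2 * ∑ j, μ j * (g j w) ^ 2 := by
  rcases Nat.eq_zero_or_pos m with rfl | hm
  · refine ⟨0, fun j => j.elim0, by simp, fun w => ?_⟩
    simpa using h 1 (fun _ => w) 0 le_rfl fun j => j.elim0
  -- The summing hypothesis says that no `Q n w` is negative in all coordinates. These vectors form
  -- a convex cone (concatenate families, rescale by square roots), so a functional separates it
  -- from the open negative orthant; its coefficients, normalised, are the weights.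
  set Q : (n : ℕ) → (Fin n → W) → Fin m → ℝ := fun n w j =>
    c ^ 2 * ∑ k, (g j (w k)) ^ 2 - ∑ k, ‖T (w k)‖ ^ 2 with hQ
  set P : Set (Fin m → ℝ) := {v | ∃ (n : ℕ) (w : Fin n → W), v = Q n w}
  set O : Set (Fin m → ℝ) := {v | ∀ j, v j < 0}
  have hscale : ∀ (n : ℕ) (w : Fin n → W) (a : ℝ), 0 ≤ a →
      Q n (fun k => √a • w k) = a • Q n w := by
    intro n w a ha
    ext j
    simp only [hQ, map_smul, smul_eq_mul, mul_pow, Real.sq_sqrt ha, norm_smul,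
      Real.norm_of_nonneg (Real.sqrt_nonneg a), Pi.smul_apply, ← Finset.mul_sum]
    ring
  have happend : ∀ (n n' : ℕ) (w : Fin n → W) (w' : Fin n' → W),
      Q (n + n') (Fin.append w w') = Q n w + Q n' w' := by
    intro n n' w w'
    ext j
    simp only [hQ, Fin.sum_univ_add, Fin.append_left, Fin.append_right, Pi.add_apply]
    ring
  have hP : Convex ℝ P := by
    rintro _ ⟨n, w, rfl⟩ _ ⟨n', w', rfl⟩ a b ha hb -
    exact ⟨n + n', Fin.append (fun k => √a • w k) fun k => √b • w' k, by
      rw [happend, hscale n w a ha, hscale n' w' b hb]⟩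
  have hO : Convex ℝ O := by
    have : O = ⋂ j, {v : Fin m → ℝ | v j < 0} := by ext v; simp [O]
    rw [this]
    exact convex_iInter fun j => convex_halfSpace_lt (IsLinearMap.mk (by simp) (by simp)) 0
  have hOo : IsOpen O := by
    have : O = ⋂ j, {v : Fin m → ℝ | v j < 0} := by ext v; simp [O]
    rw [this]
    exact isOpen_iInter_of_finite fun j => isOpen_lt (continuous_apply j) continuous_const
  have hdisj : Disjoint O P := by
    rw [Set.disjoint_left]
    rintro _ hv ⟨n, w, rfl⟩
    have : Nonempty (Fin m) := ⟨⟨0, hm⟩⟩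
    obtain ⟨j₀, -, hj₀⟩ := Finset.exists_max_image Finset.univ
      (fun j => ∑ k, (g j (w k)) ^ 2) Finset.univ_nonempty
    have h0 : 0 ≤ ∑ k, (g j₀ (w k)) ^ 2 := Finset.sum_nonneg fun k _ => sq_nonneg _
    have h1 := h n w (√(∑ k, (g j₀ (w k)) ^ 2)) (Real.sqrt_nonneg _) fun j => by
      rw [Real.sq_sqrt h0]; exact hj₀ j (Finset.mem_univ j)
    rw [mul_pow, Real.sq_sqrt h0] at h1
    have h2 := hv j₀
    simp only [hQ] at h2
    linarith
  obtain ⟨f, u, hfO, hfP⟩ := geometric_hahn_banach_open hO hOo hP hdisj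
  set ν : Fin m → ℝ := fun j => f (Pi.single j 1) with hν
  have hf : ∀ v, f v = ∑ j, ν j * v j := by
    intro v
    have hv : v = ∑ j, v j • (Pi.single j 1 : Fin m → ℝ) := by
      ext j; simp [Finset.sum_apply, Pi.single_apply]
    conv_lhs => rw [hv]
    simp [hν, mul_comm]
  have hu : u ≤ 0 := by
    have := hfP (Q 0 Fin.elim0) ⟨0, Fin.elim0, rfl⟩
    have h0 : Q 0 Fin.elim0 = 0 := by ext j; simp [hQ]
    rwa [h0, map_zero] at this
  have hfQ : ∀ n w, 0 ≤ f (Q n w) := by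
    intro n w
    by_contra hneg
    push Not at hneg
    -- A negative value could be scaled inside the cone to `u - 1`, below the separating level.
    have h1 := hfP (Q n fun k => √((u - 1) / f (Q n w)) • w k) ⟨n, _, rfl⟩
    rw [hscale _ _ _ (div_nonneg_of_nonpos (by linarith) hneg.le), map_smul, smul_eq_mul,
      div_mul_cancel₀ _ hneg.ne] at h1
    linarith
  have hν0 : ∀ j, 0 ≤ ν j := by
    intro j
    by_contra hneg
    push Not at hneg
    -- The vector `-e_j` lies only on the boundary of the open orthant; subtracting `δ` in every
    -- coordinate moves it inside.
    have hδ : ∀ δ : ℝ, 0 < δ → ν j * (-1) - δ * ∑ i, ν i < 0 := by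
      intro δ hδ
      have h1 := (hfO (fun i => (-1) * (Pi.single j 1 : Fin m → ℝ) i - δ) fun i => by
        have : (0 : ℝ) ≤ (Pi.single j 1 : Fin m → ℝ) i := by
          rw [Pi.single_apply]; split_ifs <;> norm_num
        linarith).trans_le hu
      rw [hf] at h1
      simp only [mul_sub, Finset.sum_sub_distrib] at h1
      rw [Finset.sum_eq_single j (fun i _ hi => by simp [hi]) (by simp)] at h1
      simpa [mul_comm, Finset.mul_sum] using h1
    have hA : 0 < |∑ i, ν i| + 1 := by positivity
    have h2 := hδ (-ν j / (|∑ i, ν i| + 1)) (by apply div_pos <;> linarith)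
    have h3 : -ν j / (|∑ i, ν i| + 1) * ∑ i, ν i ≤ -ν j := by
      rw [div_mul_eq_mul_div, div_le_iff₀ hA]
      have := le_abs_self (∑ i, ν i)
      nlinarith
    linarith
  have hsum : 0 < ∑ j, ν j := by
    have h1 := (hfO (fun _ => -1) fun _ => by norm_num).trans_le hu
    rw [hf] at h1
    simpa using h1
  refine ⟨fun j => ν j / ∑ i, ν i, fun j => div_nonneg (hν0 j) hsum.le, ?_, fun w => ?_⟩
  · rw [← Finset.sum_div, div_self hsum.ne']
  · have h1 := hfQ 1 fun _ => w
    rw [hf] at h1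
    simp only [hQ, Finset.univ_unique, Finset.sum_singleton, mul_sub, Finset.sum_sub_distrib,
      ← Finset.sum_mul] at h1
    have h2 : c ^ 2 * ∑ j, ν j / (∑ i, ν i) * (g j w) ^ 2 =
        (∑ j, ν j * (c ^ 2 * (g j w) ^ 2)) / ∑ i, ν i := by
      rw [Finset.mul_sum, Finset.sum_div]
      exact Finset.sum_congr rfl fun j _ => by ring
    rw [h2, le_div_iff₀ hsum]
    linarith

theorem abs_apply_sum_smul_le {E : Type*} [AddCommGroup E] [Module ℝ E] (g : E →ₗ[ℝ] ℝ) {n : ℕ}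
    (w : Fin n → E) {B : ℝ} (hB : 0 ≤ B) (hw : ∑ k, g (w k) ^ 2 ≤ B ^ 2) (a : Fin n → ℝ) :
    |g (∑ k, a k • w k)| ≤ B * √(∑ k, a k ^ 2) := by
  simp only [map_sum, map_smul, smul_eq_mul]
  refine (Finset.abs_sum_le_sum_abs _ _).trans ?_
  simp only [abs_mul]
  refine (Real.sum_mul_le_sqrt_mul_sqrt _ _ _).trans ?_
  simp only [sq_abs]
  rw [mul_comm]
  gcongr
  rwa [Real.sqrt_le_left hB]

/-- Testing with the coefficients `f (w k)` themselves gives `s ≤ B √s`: the operator norm bound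
recovers the weak `ℓ₂`-bound. -/
theorem sum_sq_apply_le {E : Type*} [NormedAddCommGroup E] [NormedSpace ℝ E] {n : ℕ}
    (w : Fin n → E) {B : ℝ}
    (hw : ∀ a : Fin n → ℝ, ‖∑ k, a k • w k‖ ≤ B * √(∑ k, a k ^ 2)) {f : StrongDual ℝ E}
    (hf : ‖f‖ ≤ 1) : ∑ k, f (w k) ^ 2 ≤ B ^ 2 := by
  set s := ∑ k, f (w k) ^ 2 with hs
  have hs0 : 0 ≤ s := Finset.sum_nonneg fun k _ => sq_nonneg _
  have h2 : s ≤ B * √s := by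
    have h3 := (le_abs_self _).trans (f.le_opNorm (∑ k, f (w k) • w k))
    simp only [map_sum, map_smul, smul_eq_mul] at h3
    refine le_trans (le_of_eq (by simp [hs, sq])) (h3.trans ?_)
    exact (mul_le_of_le_one_left (norm_nonneg _) hf).trans (hw _)
  rcases (Real.sqrt_nonneg s).eq_or_lt with h0 | h0
  · rw [← Real.sq_sqrt hs0, ← h0, zero_pow two_ne_zero]; exact sq_nonneg B
  · rw [← Real.sq_sqrt hs0]
    refine pow_le_pow_left₀ (Real.sqrt_nonneg s) (le_of_mul_le_mul_right ?_ h0) 2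
    rw [Real.mul_self_sqrt hs0]; exact h2

/-- A norming set of functionals on a finite-dimensional space dominates 2-summing maps through
finitely many of its elements. -/
theorem exists_pietsch_weights_of_norming {W Y : Type*} [NormedAddCommGroup W] [NormedSpace ℝ W]
    [FiniteDimensional ℝ W] [NormedAddCommGroup Y] [NormedSpace ℝ Y] (G : Set (StrongDual ℝ W))
    (hG : ∀ g ∈ G, ‖g‖ ≤ 1) (hnorm : ∀ w M, 0 ≤ M → (∀ g ∈ G, |g w| ≤ M) → ‖w‖ ≤ M)
    (T : W →ₗ[ℝ] Y) {c : ℝ} (h : ∀ (n : ℕ) (w : Fin n → W) (B : ℝ), 0 ≤ B →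
      (∀ g ∈ G, ∑ k, (g (w k)) ^ 2 ≤ B ^ 2) → ∑ k, ‖T (w k)‖ ^ 2 ≤ (c * B) ^ 2) :
    ∃ (m : ℕ) (g : Fin m → StrongDual ℝ W) (μ : Fin m → ℝ), (∀ j, g j ∈ G) ∧ (∀ j, 0 ≤ μ j) ∧
      ∑ j, μ j ≤ 1 ∧ ∀ w, ‖T w‖ ^ 2 ≤ (c * 2) ^ 2 * ∑ j, μ j * (g j w) ^ 2 := by
  have : ProperSpace (StrongDual ℝ W) := FiniteDimensional.proper ℝ _
  have htot : TotallyBounded G :=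
    (isCompact_closedBall (0 : StrongDual ℝ W) 1).totallyBounded.subset fun g hg => by
      simpa using hG g hg
  obtain ⟨F, hFG, hFfin, hF⟩ := Metric.finite_approx_of_totallyBounded htot (1 / 2) (by norm_num)
  obtain ⟨m, e⟩ := hFfin.fin_param
  obtain ⟨g, -, hgF⟩ := e
  have hgmem : ∀ j, g j ∈ F := fun j => hgF ▸ ⟨j, rfl⟩
  obtain ⟨μ, hμ0, hμ1, hμ⟩ := exists_pietsch_weights (c := c * 2)
    (fun j => (g j).toLinearMap) T (fun n w B hB hw => by
      rw [mul_assoc]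
      refine h n w (2 * B) (by positivity) fun f hf => ?_
      have hv : ∀ a : Fin n → ℝ, ‖∑ k, a k • w k‖ ≤ 2 * (B * √(∑ k, a k ^ 2)) := by
        intro a
        set v := ∑ k, a k • w k
        -- Replacing a functional of `G` by a net point costs half the norm, which is absorbed on
        -- the left. So the net is norming up to the factor `2` appearing in the constant.
        have h1 : ‖v‖ ≤ B * √(∑ k, a k ^ 2) + 1 / 2 * ‖v‖ := by
          refine hnorm _ _ (by positivity) fun f hf => ?_
          obtain ⟨f', hf', hff'⟩ := Set.mem_iUnion₂.1 (hF hf)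
          rw [← hgF] at hf'
          obtain ⟨j, rfl⟩ := hf'
          rw [Metric.mem_ball, dist_eq_norm] at hff'
          have h2 : |g j v| ≤ B * √(∑ k, a k ^ 2) :=
            abs_apply_sum_smul_le (g j).toLinearMap w hB (hw j) a
          have h3 : |(f - g j) v| ≤ 1 / 2 * ‖v‖ :=
            ((f - g j).le_opNorm v).trans (by gcongr)
          have h4 : f v = g j v + (f - g j) v := by simp
          rw [h4]
          exact (abs_add_le _ _).trans (add_le_add h2 h3)
        linarith
      exact sum_sq_apply_le w (fun a => (hv a).trans_eq (mul_assoc _ _ _).symm)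
        (hG f hf))
  exact ⟨m, g, μ, fun j => hFG (hgmem j), hμ0, hμ1, hμ⟩

/-- The inequality makes `T` well defined on the range of `V`; composing with the orthogonal
projection extends it to all of `H` at no cost in norm. -/
theorem exists_factor_of_norm_le {W F H : Type*} [AddCommGroup W] [Module ℝ W]
    [NormedAddCommGroup F] [NormedSpace ℝ F] [NormedAddCommGroup H] [InnerProductSpace ℝ H]
    [FiniteDimensional ℝ H] (T : W →ₗ[ℝ] F) (V : W →ₗ[ℝ] H) {κ : ℝ} (hκ : 0 ≤ κ)
    (h : ∀ w, ‖T w‖ ≤ κ * ‖V w‖) : ∃ R : H →L[ℝ] F, ‖R‖ ≤ κ ∧ ∀ w, T w = R (V w) := by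
  obtain ⟨s, hs⟩ := V.rangeRestrict.exists_rightInverse_of_surjective V.range_rangeRestrict
  have hs' : ∀ y, V (s y) = y := fun y => congrArg Subtype.val (LinearMap.congr_fun hs y)
  set R₀ : LinearMap.range V →L[ℝ] F := (T.comp s).mkContinuous κ fun y => by
    have := h (s y)
    rwa [hs'] at this
  refine ⟨R₀.comp (LinearMap.range V).orthogonalProjectionOnto, ?_, fun w => ?_⟩
  · refine (ContinuousLinearMap.opNorm_comp_le _ _).trans ?_
    calc ‖R₀‖ * ‖(LinearMap.range V).orthogonalProjectionOnto‖ ≤ κ * 1 := by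
          gcongr
          · exact LinearMap.mkContinuous_norm_le _ hκ _
          · exact Submodule.orthogonalProjectionOnto_norm_le _
      _ = κ := mul_one κ
  · have h1 : (LinearMap.range V).orthogonalProjectionOnto (V w) = ⟨V w, w, rfl⟩ :=
      Submodule.orthogonalProjectionOnto_mem_subspace_eq_self (K := LinearMap.range V)
        ⟨V w, w, rfl⟩
    simp only [ContinuousLinearMap.comp_apply]
    rw [h1]
    have h2 : V (w - s ⟨V w, w, rfl⟩) = 0 := by rw [map_sub, hs', sub_self]
    have h3 := h (w - s ⟨V w, w, rfl⟩)
    rw [h2, norm_zero, mul_zero, map_sub] at h3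
    exact sub_eq_zero.1 (norm_le_zero_iff.1 h3)

end Domination

/-! ### Type 2 implies GAP -/

section TypeTwo

variable {X : Type*} [NormedAddCommGroup X] [NormedSpace ℝ X]

/-- A half-net of the dual ball of `R`, extended to `X` by Hahn-Banach, norms `R` up to a factor
two. -/
theorem exists_finite_norming (R : Submodule ℝ X) [FiniteDimensional ℝ R] :
    ∃ F : Finset (StrongDual ℝ X), (∀ f ∈ F, ‖f‖ ≤ 1) ∧ ∀ x ∈ R, ∃ f ∈ F, ‖x‖ ≤ 2 * |f x| := by
  classical
  obtain ⟨F, hF1, hF⟩ := exists_finite_half_net (StrongDual ℝ R)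
  choose φ hφ hφn using fun f : StrongDual ℝ R => exists_extension_norm_eq R f
  refine ⟨F.image φ, fun f hf => ?_, fun x hx => ?_⟩
  · obtain ⟨b, hb, rfl⟩ := Finset.mem_image.1 hf
    rw [hφn]; exact hF1 b hb
  obtain ⟨f, hf, hfx⟩ := exists_dual_vector'' ℝ (⟨x, hx⟩ : R)
  have hfx' : f ⟨x, hx⟩ = ‖x‖ := hfx
  obtain ⟨b, hbF, hb⟩ := hF f hf
  refine ⟨φ b, Finset.mem_image_of_mem _ hbF, ?_⟩
  have h1 : φ b x = b ⟨x, hx⟩ := hφ b ⟨x, hx⟩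
  have h2 : |(f - b) ⟨x, hx⟩| ≤ 1 / 2 * ‖x‖ := ((f - b).le_opNorm _).trans (by gcongr; rfl)
  rw [_root_.sub_apply, hfx'] at h2
  rw [h1]
  have h3 := le_abs_self (b ⟨x, hx⟩)
  have h4 := (abs_le.1 h2).2
  linarith

/-- Domination of 2-summing operators on a dual space by evaluations, on finite-dimensional
subspaces. -/
theorem SummingBound.exists_evaluations {W Y : Type*} [NormedAddCommGroup W] [NormedSpace ℝ W]
    [FiniteDimensional ℝ W] [NormedAddCommGroup Y] [NormedSpace ℝ Y]
    {R : StrongDual ℝ X →L[ℝ] Y} {c : ℝ} (hR : SummingBound 2 R c)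
    (e : W →ₗᵢ[ℝ] StrongDual ℝ X) :
    ∃ (m : ℕ) (x : Fin m → X) (μ : Fin m → ℝ), (∀ j, ‖x j‖ ≤ 1) ∧ (∀ j, 0 ≤ μ j) ∧
      ∑ j, μ j ≤ 1 ∧ ∀ w, ‖R (e w)‖ ^ 2 ≤ (c * 2) ^ 2 * ∑ j, μ j * (e w (x j)) ^ 2 := by
  set ev : X → StrongDual ℝ W := fun x =>
    (ContinuousLinearMap.apply ℝ ℝ x).comp e.toContinuousLinearMap with hev
  have hev_apply : ∀ x (w : W), ev x w = e w x := fun x w => rfl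
  have hnorm : ∀ (w : W) (M : ℝ), 0 ≤ M →
      (∀ g ∈ ev '' Metric.closedBall 0 1, |g w| ≤ M) → ‖w‖ ≤ M := by
    intro w M hM hw
    rw [← e.norm_map]
    refine ContinuousLinearMap.opNorm_le_of_unit_norm hM fun x hx => ?_
    exact hw (ev x) ⟨x, by simp [hx], rfl⟩
  have hev1 : ∀ g ∈ ev '' Metric.closedBall 0 1, ‖g‖ ≤ 1 := by
    rintro _ ⟨x, hx, rfl⟩
    refine ContinuousLinearMap.opNorm_le_bound _ zero_le_one fun w => ?_
    rw [one_mul, ← e.norm_map w]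
    exact ((e w).le_opNorm x).trans
      (mul_le_of_le_one_right (norm_nonneg _) (by simpa using hx))
  obtain ⟨m, g, μ, hg, hμ0, hμ1, hμ⟩ :=
    exists_pietsch_weights_of_norming (ev '' Metric.closedBall 0 1) hev1 hnorm
      (R.toLinearMap ∘ₗ e.toLinearMap) (c := c) fun k w B hB hw => by
      refine hR k (fun i => e (w i)) B hB fun φ hφ => ?_
      simp only [sq_abs]
      refine sum_sq_apply_le _ (fun a => ?_) hφ
      have h4 : ∑ i, a i • e (w i) = e (∑ i, a i • w i) := by simp
      rw [h4, e.norm_map]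
      exact hnorm _ _ (by positivity) fun g hg =>
        abs_apply_sum_smul_le g.toLinearMap w hB (hw g hg) a
  choose x hx hxg using hg
  refine ⟨m, x, μ, fun j => by simpa using hx j, hμ0, hμ1, fun w => ?_⟩
  simp only [← hev_apply, hxg]
  exact hμ w

/-- Spaces of type 2 have the Gaussian average property. -/
theorem HasType.hasGAP (hX : HasType X 2) : HasGAP X := by
  obtain ⟨C, hC, hCx⟩ := hX.exists_gaussSq_comb_le
  refine hasGAP_of_gaussSq_le (K := √(16 * C)) (Real.sqrt_nonneg _) fun n S c hc hS => ?_
  have hS2 := hS.two_of_one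
  obtain ⟨F, hF1, hF⟩ := exists_finite_norming (LinearMap.range S.toLinearMap)
  -- Finitely many functionals suffice to norm the range of `S`, so the adjoint is studied only on
  -- their finite-dimensional span.
  set W := Submodule.span ℝ (F : Set (StrongDual ℝ X)) with hW
  have : FiniteDimensional ℝ W := FiniteDimensional.span_finset ℝ F
  set T : W →ₗ[ℝ] EuclideanSpace ℝ (Fin n) :=
    (InnerProductSpace.toDual ℝ (EuclideanSpace ℝ (Fin n))).symm.toLinearEquiv.toLinearMap ∘ₗ
      (adj S).toLinearMap ∘ₗ W.subtype with hT
  have hTnorm : ∀ w : W, ‖T w‖ = ‖adj S w‖ := fun w =>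
    (InnerProductSpace.toDual ℝ (EuclideanSpace ℝ (Fin n))).symm.norm_map _
  have hTinner : ∀ (w : W) (a : EuclideanSpace ℝ (Fin n)),
      inner ℝ (T w) a = (w : StrongDual ℝ X) (S a) := fun w a =>
    InnerProductSpace.toDual_symm_apply
  obtain ⟨m, x, μ, hx, hμ0, hμ1, hμ⟩ := hS2.exists_evaluations (W := W)
    (W.subtypeₗᵢ : W →ₗᵢ[ℝ] StrongDual ℝ X)
  set V : W →ₗ[ℝ] EuclideanSpace ℝ (Fin m) :=
    (WithLp.linearEquiv 2 ℝ (Fin m → ℝ)).symm.toLinearMap ∘ₗ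
      LinearMap.pi fun j => √(μ j) •
        ((ContinuousLinearMap.apply ℝ ℝ (x j)).toLinearMap ∘ₗ W.subtype) with hV
  have hVj : ∀ w j, V w j = √(μ j) * (w : StrongDual ℝ X) (x j) := by
    intro w j
    simp [hV]
  have hTV : ∀ w, ‖T w‖ ≤ c * 2 * ‖V w‖ := by
    intro w
    rw [← sq_le_sq₀ (norm_nonneg _) (by positivity), mul_pow, hTnorm,
      EuclideanSpace.real_norm_sq_eq]
    refine (hμ w).trans (le_of_eq ?_)
    congr 1
    refine Finset.sum_congr rfl fun j _ => ?_
    rw [hVj, mul_pow, Real.sq_sqrt (hμ0 j)]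
    rfl
  obtain ⟨R, hR, hRV⟩ := exists_factor_of_norm_le (W := W) T V
    (by positivity : 0 ≤ c * 2) hTV
  set R' := ContinuousLinearMap.adjoint R
  set U := comb fun j => √(μ j) • x j with hU
  -- Dualising the factorization `T = R ∘ V`: functionals in `W` do not distinguish `S` from `U ∘
  -- R'`.
  have hkey : ∀ (w : W) a, (w : StrongDual ℝ X) (S a) = (w : StrongDual ℝ X) (U (R' a)) := by
    intro w a
    rw [← hTinner, hRV, ← ContinuousLinearMap.adjoint_inner_right]
    simp only [PiLp.inner_apply, hU, comb_apply, map_sum, map_smul, hVj, R']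
    refine Finset.sum_congr rfl fun j _ => ?_
    simp
  have hSU : ∀ a, ‖S a‖ ^ 2 ≤ 4 * ‖(U.comp R') a‖ ^ 2 := by
    intro a
    obtain ⟨f, hf, hfS⟩ := hF (S a) ⟨a, rfl⟩
    rw [hkey ⟨f, Submodule.subset_span hf⟩ a] at hfS
    have h1 : |f (U (R' a))| ≤ ‖U (R' a)‖ :=
      (f.le_opNorm _).trans (mul_le_of_le_one_left (norm_nonneg _) (hF1 f hf))
    calc ‖S a‖ ^ 2 ≤ (2 * ‖U (R' a)‖) ^ 2 := by
          refine pow_le_pow_left₀ (norm_nonneg _) (hfS.trans ?_) 2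
          gcongr
      _ = _ := by rw [mul_pow]; norm_num
  have hR' : ‖R'‖ ≤ c * 2 := by
    rw [LinearIsometryEquiv.norm_map]; exact hR
  -- The factor `4` comes from the norming set and another `4` from `‖R'‖² ≤ (2c)²`, which explains
  -- `16 C`. Type 2 is applied to the vectors `√μ_j x_j`, whose squared norms sum to at most one.
  calc gaussSq S ≤ 4 * gaussSq (U.comp R') := by
        rw [gaussSq, gaussSq, ← integral_const_mul]
        exact integral_mono (integrable_norm_pow_stdGaussian S 2)
          ((integrable_norm_pow_stdGaussian (U.comp R') 2).const_mul 4) hSU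
    _ ≤ 4 * ((c * 2) ^ 2 * (C * ∑ j, ‖√(μ j) • x j‖ ^ 2)) := by
        gcongr
        exact (gaussSq_comp_le U R' (by positivity) hR').trans (by gcongr; exact hCx m _)
    _ ≤ 4 * ((c * 2) ^ 2 * (C * 1)) := by
        gcongr
        refine le_trans (Finset.sum_le_sum fun j _ => ?_) hμ1
        rw [norm_smul, mul_pow, Real.norm_of_nonneg (Real.sqrt_nonneg _), Real.sq_sqrt (hμ0 j)]
        refine mul_le_of_le_one_right (hμ0 j) (pow_le_one₀ (norm_nonneg _) ?_)
        exact hx j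
    _ = _ := by
        rw [mul_pow (√_), Real.sq_sqrt (by positivity)]; ring

end TypeTwo

/-! ### In cotype 2, 2-summing operators are 1-summing -/

section CotypeTwo

variable {X : Type*} [NormedAddCommGroup X] [NormedSpace ℝ X]

/-- On spaces of cotype 2, 2-summing operators are 1-summing. -/
theorem CotypeBound.exists_one_summing {C : ℝ} (hX : CotypeBound X 2 C) :
    ∃ K : ℝ, 0 ≤ K ∧ ∀ {Y : Type*} [NormedAddCommGroup Y] [NormedSpace ℝ Y] (T : X →L[ℝ] Y)
      (c : ℝ), 0 ≤ c → SummingBound 2 T c →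
      SummingBound 1 T (K * c) := by
  obtain ⟨K, hK, hu⟩ := hX.exists_two_summing
  refine ⟨K, hK, fun {Y} _ _ T c hc hT n x M hM hx => ?_⟩
  set u : (Fin n → ℝ) →ₗ[ℝ] X := Fintype.linearCombination ℝ x with hu_def
  have huM : ∀ a : Fin n → ℝ, (∀ j, |a j| ≤ 1) → ‖u a‖ ≤ M := by
    intro a ha
    obtain ⟨f, hf, hfx⟩ := exists_dual_vector'' ℝ (u a)
    have hfx' : f (u a) = ‖u a‖ := hfx
    rw [← hfx']
    simp only [hu_def, Fintype.linearCombination_apply, map_sum, map_smul, smul_eq_mul]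
    have h1 := hx f hf
    simp only [pow_one] at h1
    refine le_trans (Finset.sum_le_sum fun j _ => ?_) h1
    calc a j * f (x j) ≤ |a j| * |f (x j)| := by rw [← abs_mul]; exact le_abs_self _
      _ ≤ 1 * |f (x j)| := by gcongr; exact ha j
      _ = _ := one_mul _
  -- The map `e_j ↦ x j` on `ℓ_∞^n` is 2-summing by cotype 2. Its Pietsch weights split `x j` as
  -- `√μ_j` times a family of weak `ℓ₂`-norm at most `K M`, so the 2-summing inequality and
  -- Cauchy-Schwarz give the 1-summing one.
  obtain ⟨μ, hμ0, hμ1, hμ⟩ := exists_pietsch_weights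
    (fun j => (LinearMap.proj j : (Fin n → ℝ) →ₗ[ℝ] ℝ)) u
    (c := K * M) fun k y B hB hy => hu n u M hM huM k y B hB hy
  set y : Fin n → X := fun j => (√(μ j))⁻¹ • x j with hy
  have hxy : ∀ j, x j = √(μ j) • y j := by
    intro j
    -- A vanishing weight forces `x j = 0`, so the convention for the inverse of zero is harmless.
    by_cases h0 : √(μ j) = 0
    · have h1 := hμ (Pi.single j 1)
      have h2 : ∑ i, μ i * ((LinearMap.proj i : (Fin n → ℝ) →ₗ[ℝ] ℝ) (Pi.single j 1)) ^ 2 =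
          μ j := by
        rw [Finset.sum_eq_single j (fun i _ hi => by simp [hi]) (by simp)]
        simp
      rw [h2, (Real.sqrt_eq_zero (hμ0 j)).1 h0, mul_zero] at h1
      have h3 : u (Pi.single j 1) = x j := by
        simp [hu_def, Fintype.linearCombination_apply, Pi.single_apply]
      rw [h3] at h1
      rw [h0, zero_smul]
      exact norm_eq_zero.1 (pow_eq_zero_iff two_ne_zero |>.1 (le_antisymm h1 (sq_nonneg _)))
    · rw [hy, smul_smul, mul_inv_cancel₀ h0, one_smul]
  have hweak : ∀ f : StrongDual ℝ X, ‖f‖ ≤ 1 → ∑ j, |f (y j)| ^ 2 ≤ (K * M) ^ 2 := by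
    intro f hf
    set s := ∑ j, |f (y j)| ^ 2 with hs
    have hs0 : 0 ≤ s := Finset.sum_nonneg fun i _ => by positivity
    -- Chosen so that `f (u a) = s`, while the weighted square sum of `a` is at most `s`.
    set a : Fin n → ℝ := fun j => (√(μ j))⁻¹ * f (y j) with ha
    have h1 : f (u a) = s := by
      simp only [hu_def, Fintype.linearCombination_apply, map_sum, map_smul, smul_eq_mul, hs, ha]
      refine Finset.sum_congr rfl fun j _ => ?_
      have : f (y j) = (√(μ j))⁻¹ * f (x j) := by simp [hy]
      rw [sq_abs, this]; ring
    have h2 : ‖u a‖ ^ 2 ≤ (K * M) ^ 2 * s := by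
      refine (hμ a).trans ?_
      gcongr
      refine Finset.sum_le_sum fun j _ => ?_
      simp only [LinearMap.proj_apply, ha, mul_pow, sq_abs]
      rw [← mul_assoc]
      refine mul_le_of_le_one_left (sq_nonneg _) ?_
      rw [inv_pow, Real.sq_sqrt (hμ0 j)]
      exact mul_inv_le_one
    have h3 : s ≤ ‖u a‖ := by
      rw [← h1]
      exact (le_abs_self _).trans ((f.le_opNorm _).trans (mul_le_of_le_one_left (norm_nonneg _) hf))
    rcases hs0.eq_or_lt with h0 | h0
    · rw [← h0]; positivity
    · have h4 : s * s ≤ (K * M) ^ 2 * s := by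
        refine le_trans ?_ h2
        rw [sq]; exact mul_self_le_mul_self hs0 h3
      exact le_of_mul_le_mul_right h4 h0
  have h1 := hT n y (K * M) (by positivity) hweak
  simp only [pow_one]
  calc ∑ j, ‖T (x j)‖ = ∑ j, √(μ j) * ‖T (y j)‖ := by
        refine Finset.sum_congr rfl fun j _ => ?_
        conv_lhs => rw [hxy j]
        rw [map_smul, norm_smul, Real.norm_of_nonneg (Real.sqrt_nonneg _)]
    _ ≤ √(∑ j, √(μ j) ^ 2) * √(∑ j, ‖T (y j)‖ ^ 2) := Real.sum_mul_le_sqrt_mul_sqrt _ _ _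
    _ ≤ 1 * (c * (K * M)) := by
        gcongr
        · rw [Real.sqrt_le_one]
          simpa only [Real.sq_sqrt (hμ0 _)] using hμ1
        · rw [Real.sqrt_le_left (by positivity)]; exact h1
    _ = _ := by ring

end CotypeTwo

/-! ### Trace inequality for operators factoring through `L₁` -/

section TraceInequality

variable {X : Type*} [NormedAddCommGroup X] [NormedSpace ℝ X] {Ω : Type*} [MeasurableSpace Ω]
  {ν : Measure Ω} {N : ℕ}

/-- The trace pairing of an operator `B : L₁ → ℓ₂ᴺ` with the elements of `L₁(ℓ₂ᴺ)`. -/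
def traceL1 (B : Lp ℝ 1 ν →L[ℝ] EuclideanSpace ℝ (Fin N)) :
    Lp (EuclideanSpace ℝ (Fin N)) 1 ν →L[ℝ] ℝ :=
  ∑ k, (EuclideanSpace.proj k : EuclideanSpace ℝ (Fin N) →L[ℝ] ℝ).comp
    (B.comp ((EuclideanSpace.proj k : EuclideanSpace ℝ (Fin N) →L[ℝ] ℝ).compLpL 1 ν))

theorem traceL1_apply (B : Lp ℝ 1 ν →L[ℝ] EuclideanSpace ℝ (Fin N))
    (F : Lp (EuclideanSpace ℝ (Fin N)) 1 ν) :
    traceL1 B F = ∑ k, B ((EuclideanSpace.proj k : EuclideanSpace ℝ (Fin N) →L[ℝ] ℝ).compLpL 1 ν F)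
      k := by
  simp [traceL1, _root_.sum_apply]

/-- On a vector-valued indicator with value `c` the trace is the inner product of `c` with the image
of the scalar indicator. The `L₁`-norm is additive over disjoint supports, so the bound passes to
simple functions and, by density, to all of `L₁`. -/
theorem abs_traceL1_le (B : Lp ℝ 1 ν →L[ℝ] EuclideanSpace ℝ (Fin N))
    (F : Lp (EuclideanSpace ℝ (Fin N)) 1 ν) : |traceL1 B F| ≤ ‖B‖ * ‖F‖ := by
  refine Lp.induction (p := 1) ENNReal.one_ne_top (motive := fun F => |traceL1 B F| ≤ ‖B‖ * ‖F‖)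
    ?_ ?_ ?_ F
  · intro c s hs hμs
    rw [Lp.simpleFunc.coe_indicatorConst]
    set I : Lp ℝ 1 ν := indicatorConstLp 1 hs hμs.ne (1 : ℝ) with hI
    have h1 : ∀ k, (EuclideanSpace.proj k : EuclideanSpace ℝ (Fin N) →L[ℝ] ℝ).compLpL 1 ν
        (indicatorConstLp 1 hs hμs.ne c) = c k • I := by
      intro k
      refine Lp.ext ?_
      filter_upwards [ContinuousLinearMap.coeFn_compLpL (p := 1) (μ := ν)
        (EuclideanSpace.proj k : EuclideanSpace ℝ (Fin N) →L[ℝ] ℝ)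
        (indicatorConstLp 1 hs hμs.ne c),
        indicatorConstLp_coeFn (p := 1) (hs := hs) (hμs := hμs.ne) (c := c),
        Lp.coeFn_smul (c k) I,
        indicatorConstLp_coeFn (p := 1) (hs := hs) (hμs := hμs.ne) (c := (1 : ℝ))]
        with ω h1 h2 h3 h4
      rw [h1, h2, h3, Pi.smul_apply, hI, h4]
      by_cases hω : ω ∈ s <;> simp [hω]
    rw [traceL1_apply]
    simp only [h1, map_smul, PiLp.smul_apply, smul_eq_mul]
    calc |∑ k, c k * B I k| ≤ ‖B I‖ * ‖c‖ := by
          have := abs_real_inner_le_norm (B I) c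
          simpa [PiLp.inner_apply] using this
      _ ≤ (‖B‖ * ‖I‖) * ‖c‖ := by gcongr; exact B.le_opNorm I
      _ = _ := by
          rw [hI, norm_indicatorConstLp one_ne_zero ENNReal.one_ne_top,
            norm_indicatorConstLp one_ne_zero ENNReal.one_ne_top]
          simp; ring
  · intro f g hf hg hfg h1 h2
    have hnorm : ‖hf.toLp f + hg.toLp g‖ = ‖hf.toLp f‖ + ‖hg.toLp g‖ := by
      rw [← MemLp.toLp_add, L1.norm_eq_integral_norm, L1.norm_eq_integral_norm,
        L1.norm_eq_integral_norm, ← integral_add (L1.integrable_coeFn _).norm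
          (L1.integrable_coeFn _).norm]
      refine integral_congr_ae ?_
      filter_upwards [hf.coeFn_toLp, hg.coeFn_toLp, (hf.add hg).coeFn_toLp] with ω e1 e2 e3
      rw [e1, e2, e3, Pi.add_apply]
      by_cases h0 : f ω = 0
      · simp [h0]
      · have h3 : g ω = 0 := by
          by_contra h4
          exact Set.disjoint_left.1 hfg h0 h4
        simp [h3]
    rw [map_add, hnorm, mul_add]
    exact (abs_add_le _ _).trans (add_le_add h1 h2)
  · exact isClosed_le (by fun_prop) (by fun_prop)

/-- The functional `f ↦ ∫ₛ f` on `L₁`. -/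
def setIntegralL1 (ν : Measure Ω) (s : Set Ω) : StrongDual ℝ (Lp ℝ 1 ν) :=
  LinearMap.mkContinuous
    { toFun := fun f => ∫ ω in s, f ω ∂ν
      map_add' := fun f g => by
        rw [← integral_add (L1.integrable_coeFn f).integrableOn
          (L1.integrable_coeFn g).integrableOn]
        exact integral_congr_ae (ae_restrict_of_ae (Lp.coeFn_add f g))
      map_smul' := fun c f => by
        rw [RingHom.id_apply, ← integral_smul]
        exact integral_congr_ae (ae_restrict_of_ae (Lp.coeFn_smul c f)) } 1 fun f => by
    rw [one_mul, L1.norm_eq_integral_norm]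
    exact (norm_integral_le_integral_norm _).trans
      (setIntegral_le_integral (L1.integrable_coeFn f).norm
        (Eventually.of_forall fun _ => norm_nonneg _))

theorem setIntegralL1_apply (s : Set Ω) (f : Lp ℝ 1 ν) :
    setIntegralL1 ν s f = ∫ ω in s, f ω ∂ν := rfl

/-- The vector-valued function whose coordinates are the images of the unit vectors. -/
def coordFun (U : EuclideanSpace ℝ (Fin N) →L[ℝ] Lp ℝ 1 ν) (ω : Ω) : EuclideanSpace ℝ (Fin N) :=
  ∑ k, U (EuclideanSpace.single k 1) ω • EuclideanSpace.single k 1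

theorem coordFun_apply (U : EuclideanSpace ℝ (Fin N) →L[ℝ] Lp ℝ 1 ν) (ω : Ω) (k : Fin N) :
    coordFun U ω k = U (EuclideanSpace.single k 1) ω := by
  simp [coordFun, Finset.sum_apply, Pi.single_apply]

theorem integrable_coordFun (U : EuclideanSpace ℝ (Fin N) →L[ℝ] Lp ℝ 1 ν) :
    Integrable (coordFun U) ν :=
  integrable_finsetSum _ fun k _ =>
    (L1.integrable_coeFn (U (EuclideanSpace.single k 1))).smul_const _

/-- On the level sets of a simple approximation the integral of the norm is nearly the sum of the
norms of the integrals. Each such integral represents the adjoint of `S` applied to `x ↦ ∫_E A x`,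
and disjointness of the sets bounds all signed sums of these functionals by `‖A‖`. -/
theorem integral_coordFun_le {S : EuclideanSpace ℝ (Fin N) →L[ℝ] X} {c : ℝ}
    (hS : SummingBound 1 (adj S) c) (A : X →L[ℝ] Lp ℝ 1 ν) :
    ∫ ω, ‖coordFun (A.comp S) ω‖ ∂ν ≤ c * ‖A‖ := by
  set F := coordFun (A.comp S) with hF
  have hFi : Integrable F ν := integrable_coordFun _
  refine le_of_forall_pos_le_add fun ε hε => ?_
  obtain ⟨G, hG, hGL⟩ := (memLp_one_iff_integrable.2 hFi).exists_simpleFunc_eLpNorm_sub_lt (by simp)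
    (ε := ENNReal.ofReal (ε / 2)) (by simpa using hε)
  have hGi : Integrable G ν := memLp_one_iff_integrable.1 hGL
  have hFG : ∫ ω, ‖F ω - G ω‖ ∂ν ≤ ε / 2 := by
    rw [eLpNorm_one_eq_lintegral_enorm, ← ofReal_integral_norm_eq_lintegral_enorm (hFi.sub hGi)]
      at hG
    exact ((ENNReal.ofReal_lt_ofReal_iff (by positivity)).1 hG).le
  set E : G.range → Set Ω := fun v => G ⁻¹' {(v : EuclideanSpace ℝ (Fin N))} with hE
  have hEm : ∀ v, MeasurableSet (E v) := fun v => G.measurableSet_preimage _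
  have hEd : Pairwise (Function.onFun Disjoint E) := by
    intro v w hvw
    rw [Function.onFun, Set.disjoint_left]
    intro ω h1 h2
    exact hvw (Subtype.ext (h1.symm.trans h2))
  have hEu : ⋃ v, E v = Set.univ := by
    refine Set.eq_univ_of_forall fun ω =>
      Set.mem_iUnion.2 ⟨⟨G ω, SimpleFunc.mem_range_self G ω⟩, rfl⟩
  have hsplit : ∀ f : Ω → ℝ, Integrable f ν → ∫ ω, f ω ∂ν = ∑ v, ∫ ω in E v, f ω ∂ν := by
    intro f hf
    rw [← integral_iUnion_fintype hEm hEd fun v => hf.integrableOn, hEu, setIntegral_univ]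
  set φ : G.range → StrongDual ℝ X := fun v => (setIntegralL1 ν (E v)).comp A with hφ
  have h1 : ∑ v, ‖adj S (φ v)‖ ≤ c * ‖A‖ := by
    refine hS.sum_norm_le φ (norm_nonneg _) fun a ha => ?_
    refine ContinuousLinearMap.opNorm_le_bound _ (norm_nonneg _) fun x => ?_
    refine le_trans ?_ (A.le_opNorm x)
    simp only [_root_.sum_apply, _root_.smul_apply, smul_eq_mul, hφ,
      ContinuousLinearMap.comp_apply, setIntegralL1_apply, Real.norm_eq_abs]
    rw [L1.norm_eq_integral_norm, hsplit _ (L1.integrable_coeFn _).norm]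
    refine (Finset.abs_sum_le_sum_abs _ _).trans (Finset.sum_le_sum fun v _ => ?_)
    rw [abs_mul]
    exact (mul_le_of_le_one_left (abs_nonneg _) (ha v)).trans
      (norm_integral_le_integral_norm (A x))
  have h2 : ∀ v, ‖∫ ω in E v, F ω ∂ν‖ ≤ ‖adj S (φ v)‖ := by
    intro v
    set y := ∫ ω in E v, F ω ∂ν with hy
    have h3 : ∀ a, inner ℝ y a = adj S (φ v) a := by
      intro a
      have h4 : ∀ k, y k = setIntegralL1 ν (E v) (A (S (EuclideanSpace.single k 1))) := by
        intro k
        have h5 := ((EuclideanSpace.proj k : EuclideanSpace ℝ (Fin N) →L[ℝ] ℝ).integral_comp_comm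
          (hFi.integrableOn (s := E v))).symm
        refine h5.trans ?_
        rw [setIntegralL1_apply]
        refine integral_congr_ae (Eventually.of_forall fun ω => ?_)
        exact coordFun_apply _ ω k
      conv_rhs => rw [euclidean_eq_sum a]
      simp only [map_sum, map_smul, adj_apply, hφ, ContinuousLinearMap.comp_apply, ← h4]
      simp [PiLp.inner_apply]
    rcases (norm_nonneg y).eq_or_lt with h0 | h0
    · rw [← h0]; exact norm_nonneg _
    · refine le_of_mul_le_mul_right ?_ h0
      rw [← real_inner_self_eq_norm_mul_norm, h3]
      exact (le_abs_self _).trans ((adj S (φ v)).le_opNorm y)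
  have h3 : ∀ v, ∫ ω in E v, ‖G ω‖ ∂ν = ‖∫ ω in E v, G ω ∂ν‖ := by
    intro v
    rw [setIntegral_congr_fun (g := fun _ => ‖(v : EuclideanSpace ℝ (Fin N))‖) (hEm v)
      fun ω hω => by rw [show G ω = v from hω],
      setIntegral_congr_fun (f := G) (g := fun _ => (v : EuclideanSpace ℝ (Fin N))) (hEm v)
      fun ω hω => hω, setIntegral_const, setIntegral_const, norm_smul, smul_eq_mul,
      Real.norm_of_nonneg measureReal_nonneg]
  have h4 : ∫ ω, ‖G ω‖ ∂ν ≤ c * ‖A‖ + ε / 2 := by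
    rw [hsplit _ hGi.norm]
    calc ∑ v, ∫ ω in E v, ‖G ω‖ ∂ν
        ≤ ∑ v, (‖adj S (φ v)‖ + ∫ ω in E v, ‖F ω - G ω‖ ∂ν) := by
          refine Finset.sum_le_sum fun v _ => ?_
          rw [h3]
          have h5 : ∫ ω in E v, G ω ∂ν = ∫ ω in E v, F ω ∂ν - ∫ ω in E v, (F ω - G ω) ∂ν := by
            rw [integral_sub hFi.integrableOn hGi.integrableOn, sub_sub_cancel]
          rw [h5]
          exact (norm_sub_le _ _).trans (add_le_add (h2 v) (norm_integral_le_integral_norm _))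
      _ ≤ c * ‖A‖ + ε / 2 := by
          rw [Finset.sum_add_distrib, ← hsplit (fun ω => ‖F ω - G ω‖) (hFi.sub hGi).norm]
          exact add_le_add h1 hFG
  calc ∫ ω, ‖F ω‖ ∂ν ≤ ∫ ω, (‖G ω‖ + ‖F ω - G ω‖) ∂ν := by
        refine integral_mono hFi.norm (hGi.norm.add (hFi.sub hGi).norm) fun ω => ?_
        have := norm_add_le (G ω) (F ω - G ω)
        rwa [add_sub_cancel] at this
    _ = ∫ ω, ‖G ω‖ ∂ν + ∫ ω, ‖F ω - G ω‖ ∂ν := integral_add hGi.norm (hFi.sub hGi).norm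
    _ ≤ c * ‖A‖ + ε := by linarith

/-- The trace inequality for operators factoring through `L₁`. -/
theorem abs_trace_le_of_factorization {S : EuclideanSpace ℝ (Fin N) →L[ℝ] X} {c : ℝ}
    (hS : SummingBound 1 (adj S) c) (A : X →L[ℝ] Lp ℝ 1 ν)
    (B : Lp ℝ 1 ν →L[ℝ] EuclideanSpace ℝ (Fin N)) :
    |∑ k, B (A (S (EuclideanSpace.single k 1))) k| ≤ ‖B‖ * (c * ‖A‖) := by
  have hFi := integrable_coordFun (A.comp S)
  set F := (memLp_one_iff_integrable.2 hFi).toLp _ with hF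
  have hFc : F =ᵐ[ν] coordFun (A.comp S) := MemLp.coeFn_toLp _
  have h1 : ∀ k, (EuclideanSpace.proj k : EuclideanSpace ℝ (Fin N) →L[ℝ] ℝ).compLpL 1 ν F =
      A (S (EuclideanSpace.single k 1)) := by
    intro k
    refine Lp.ext ?_
    filter_upwards [ContinuousLinearMap.coeFn_compLpL (p := 1) (μ := ν)
      (EuclideanSpace.proj k : EuclideanSpace ℝ (Fin N) →L[ℝ] ℝ) F, hFc] with ω e1 e2
    rw [e1, e2]
    exact coordFun_apply _ ω k
  have h2 := abs_traceL1_le B F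
  rw [traceL1_apply] at h2
  simp only [h1] at h2
  refine h2.trans (mul_le_mul_of_nonneg_left ?_ (norm_nonneg _))
  rw [L1.norm_eq_integral_norm]
  refine le_trans (le_of_eq (integral_congr_ae ?_)) (integral_coordFun_le hS A)
  filter_upwards [hFc] with ω e
  rw [e]

end TraceInequality

/-! ### Quantitative GL₂ by gluing, and GAP from GL₂ in cotype 2 -/

section GordonLewis

variable {X : Type*} [NormedAddCommGroup X] [NormedSpace ℝ X]

/-- The embedding of Euclidean space into `ℓ₂` as the `m`-th block of coordinates. -/
def blockEmb (m N : ℕ) : EuclideanSpace ℝ (Fin N) →L[ℝ] ell2 :=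
  comb fun k => unitVec (Nat.pair m k)

theorem norm_blockEmb {m N : ℕ} (g : EuclideanSpace ℝ (Fin N)) : ‖blockEmb m N g‖ = ‖g‖ := by
  have h : Orthonormal ℝ fun k : Fin N => unitVec (Nat.pair m k) :=
    orthonormal_unitVec.comp _ fun i j hij => Fin.ext (Nat.pair_eq_pair.1 hij).2
  rw [← sq_eq_sq₀ (norm_nonneg _) (norm_nonneg _), EuclideanSpace.real_norm_sq_eq,
    ← real_inner_self_eq_norm_sq, blockEmb, comb_apply, h.inner_sum]
  simp [sq]

theorem norm_blockEmb_le (m N : ℕ) : ‖blockEmb m N‖ ≤ 1 :=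
  ContinuousLinearMap.opNorm_le_bound _ zero_le_one fun g => by rw [norm_blockEmb, one_mul]

/-- The projection onto the `m`-th block of coordinates. -/
def blockProj (m N : ℕ) : ell2 →L[ℝ] EuclideanSpace ℝ (Fin N) :=
  ContinuousLinearMap.adjoint (blockEmb m N)

theorem norm_blockProj_le (m N : ℕ) : ‖blockProj m N‖ ≤ 1 := by
  rw [blockProj, LinearIsometryEquiv.norm_map]; exact norm_blockEmb_le m N

theorem blockProj_apply {m N : ℕ} (a : ell2) (k : Fin N) :
    blockProj m N a k = a (Nat.pair m k) := by
  have h1 : blockProj m N a k = inner ℝ (EuclideanSpace.single k (1 : ℝ)) (blockProj m N a) := by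
    rw [EuclideanSpace.inner_single_left]; simp
  have h2 : blockEmb m N (EuclideanSpace.single k (1 : ℝ)) = unitVec (Nat.pair m k) := by
    simp [blockEmb, comb_apply]
  rw [h1, blockProj, ContinuousLinearMap.adjoint_inner_right, h2, inner_unitVec_left]

theorem blockEmb_apply {m N : ℕ} (g : EuclideanSpace ℝ (Fin N)) (j : ℕ) :
    blockEmb m N g j = ∑ k, g k * if j = Nat.pair m k then 1 else 0 := by
  rw [← inner_unitVec_left j, blockEmb, comb_apply, inner_sum]
  refine Finset.sum_congr rfl fun k _ => ?_
  rw [real_inner_smul_right, inner_unitVec_left, unitVec_apply]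

theorem blockProj_comp_blockEmb_self (m N : ℕ) (g : EuclideanSpace ℝ (Fin N)) :
    blockProj m N (blockEmb m N g) = g := by
  ext k
  rw [blockProj_apply, blockEmb_apply, Finset.sum_eq_single k]
  · simp
  · intro i _ hi
    rw [if_neg, mul_zero]
    exact fun h => hi (Fin.ext (Nat.pair_eq_pair.1 h).2.symm)
  · simp

theorem blockProj_comp_blockEmb_of_ne {m m' : ℕ} (hm : m ≠ m') (N N' : ℕ)
    (g : EuclideanSpace ℝ (Fin N')) : blockProj m N (blockEmb m' N' g) = 0 := by
  ext k
  rw [blockProj_apply, blockEmb_apply]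
  refine Finset.sum_eq_zero fun i _ => ?_
  rw [if_neg, mul_zero]
  exact fun h => hm (Nat.pair_eq_pair.1 h).1

theorem hasSum_tsum_apply {Y : Type*} [NormedAddCommGroup Y] [NormedSpace ℝ Y]
    {G : ℕ → X →L[ℝ] Y} (hG : Summable G) (x : X) : HasSum (fun m => G m x) ((∑' m, G m) x) :=
  (ContinuousLinearMap.apply ℝ Y x).hasSum hG.hasSum

/-- Block diagonal gluing of a sequence of finite-dimensional 1-summing operators. -/
theorem exists_glued_operator (N : ℕ → ℕ) (T : ∀ m, X →L[ℝ] EuclideanSpace ℝ (Fin (N m)))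
    (hT : ∀ m, SummingBound 1 (T m) 1) :
    ∃ R : X →L[ℝ] ell2, SummingBound 1 R 2 ∧
      ∀ m x, blockProj m (N m) (R x) = (1 / 2 : ℝ) ^ m • T m x := by
  set G : ℕ → X →L[ℝ] ell2 := fun m => (1 / 2 : ℝ) ^ m • (blockEmb m (N m)).comp (T m) with hG
  have hGx : ∀ m x, ‖G m x‖ = (1 / 2) ^ m * ‖T m x‖ := by
    intro m x
    rw [hG]
    simp only [_root_.smul_apply, ContinuousLinearMap.comp_apply, norm_smul, norm_blockEmb]
    simp
  have hTx : ∀ m x, ‖T m x‖ ≤ ‖x‖ := fun m x => by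
    simpa using (hT m).norm_le one_ne_zero zero_le_one x
  have hG1 : ∀ m, ‖G m‖ ≤ (1 / 2) ^ m := by
    intro m
    refine ContinuousLinearMap.opNorm_le_bound _ (by positivity) fun x => ?_
    rw [hGx]
    gcongr
    exact hTx m x
  have hsum : Summable G := Summable.of_norm_bounded summable_geometric_two hG1
  have hRx : ∀ x, HasSum (fun m => G m x) ((∑' m, G m) x) := fun x =>
    hasSum_tsum_apply hsum x
  refine ⟨∑' m, G m, fun n x M hM hx => ?_, fun m x => ?_⟩
  · have hs : ∀ i, Summable fun m => (1 / 2 : ℝ) ^ m * ‖T m (x i)‖ := fun i => by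
      refine Summable.of_nonneg_of_le (fun m => by positivity) (fun m => ?_)
        (summable_geometric_two.mul_right ‖x i‖)
      gcongr
      exact hTx m _
    calc ∑ i, ‖(∑' m, G m) (x i)‖ ^ 1 ≤ ∑ i, ∑' m, (1 / 2 : ℝ) ^ m * ‖T m (x i)‖ := by
          refine Finset.sum_le_sum fun i _ => ?_
          rw [pow_one, ← (hRx (x i)).tsum_eq]
          simp_rw [← hGx]
          refine norm_tsum_le_tsum_norm ?_
          simp_rw [hGx]
          exact hs i
      _ = ∑' m, ∑ i, (1 / 2 : ℝ) ^ m * ‖T m (x i)‖ := (Summable.tsum_finsetSum fun i _ => hs i).symm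
      _ ≤ ∑' m, (1 / 2 : ℝ) ^ m * M := by
          refine Summable.tsum_le_tsum (fun m => ?_) (summable_sum fun i _ => hs i)
            (summable_geometric_two.mul_right M)
          rw [← Finset.mul_sum]
          gcongr
          have := hT m n x M hM hx
          simpa using this
      _ = (2 * M) ^ 1 := by rw [tsum_mul_right, tsum_geometric_two, pow_one]
  · have h1 := (blockProj m (N m)).hasSum (hRx x)
    rw [← h1.tsum_eq, tsum_eq_single m]
    · simp [hG, blockProj_comp_blockEmb_self]
    · intro m' hm'
      simp [hG, blockProj_comp_blockEmb_of_ne hm'.symm]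

/-- The quantitative form of the Gordon-Lewis property `GL₂`. -/
theorem HasGL2.exists_trace_bound (h : HasGL2 X) :
    ∃ K : ℝ, 0 ≤ K ∧ ∀ (N : ℕ) (T : X →L[ℝ] EuclideanSpace ℝ (Fin N))
      (S : EuclideanSpace ℝ (Fin N) →L[ℝ] X) (c : ℝ), 0 ≤ c → SummingBound 1 T 1 →
        SummingBound 1 (adj S) c → |∑ k, T (S (EuclideanSpace.single k 1)) k| ≤ K * c := by
  by_contra hcon
  push Not at hcon
  -- Violations of size `4^m` are glued with weights `2^{-m}`. A factorization of the glued operator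
  -- would give `2^m ≤ ‖B‖ ‖A‖` for every `m`.
  choose N T S c hc hT hS hlt using fun m : ℕ => hcon (4 ^ m) (by positivity)
  obtain ⟨R, hR, hproj⟩ := exists_glued_operator N T hT
  have hR1 : IsSumming 1 R := by
    have := summingNorm_le_of_summingBound one_ne_zero zero_le_two hR
    rw [Nat.cast_one] at this
    exact this.trans_lt ENNReal.ofReal_lt_top
  obtain ⟨Ω, _, ν, A, B, hRAB⟩ := h R hR1
  have key : ∀ m, (2 : ℝ) ^ m ≤ ‖B‖ * ‖A‖ := by
    intro m
    have h1 := abs_trace_le_of_factorization (hS m) A ((blockProj m (N m)).comp B)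
    have h2 : ∀ x, ((blockProj m (N m)).comp B) (A x) = (1 / 2 : ℝ) ^ m • T m x := by
      intro x
      rw [← hproj, hRAB]; rfl
    simp only [h2, PiLp.smul_apply, smul_eq_mul, ← Finset.mul_sum, abs_mul] at h1
    have h3 : ‖(blockProj m (N m)).comp B‖ ≤ ‖B‖ :=
      (ContinuousLinearMap.opNorm_comp_le _ _).trans
        (mul_le_of_le_one_left (norm_nonneg _) (norm_blockProj_le _ _))
    rw [abs_of_nonneg (by positivity : (0 : ℝ) ≤ (1 / 2) ^ m)] at h1
    have h4 : (1 / 2 : ℝ) ^ m * (4 ^ m * c m) < ‖B‖ * (c m * ‖A‖) := by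
      refine (mul_lt_mul_of_pos_left (hlt m) (by positivity)).trans_le (h1.trans ?_)
      gcongr
      exact mul_nonneg (hc m) (norm_nonneg _)
    have h5 : (1 / 2 : ℝ) ^ m * 4 ^ m = 2 ^ m := by rw [← mul_pow]; norm_num
    rw [← mul_assoc, h5] at h4
    rcases (hc m).eq_or_lt with h0 | h0
    · rw [← h0] at h4; simp at h4
    · refine le_of_mul_le_mul_right ?_ h0
      linarith
  obtain ⟨m, hm⟩ := pow_unbounded_of_one_lt (‖B‖ * ‖A‖) one_lt_two
  exact absurd (key m) (not_le.2 hm)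

/-- The operator into Euclidean space with coordinates `a k • f k`. -/
def diagonal {N : ℕ} (f : Fin N → StrongDual ℝ X) (a : Fin N → ℝ) :
    X →L[ℝ] EuclideanSpace ℝ (Fin N) :=
  ∑ k, (f k).smulRight (EuclideanSpace.single k (a k))

theorem diagonal_apply {N : ℕ} (f : Fin N → StrongDual ℝ X) (a : Fin N → ℝ) (x : X) (k : Fin N) :
    diagonal f a x k = f k x * a k := by
  simp [diagonal, _root_.sum_apply, Finset.sum_apply, Pi.single_apply]

/-- Interchanging the sums, each coordinate contributes at most `a k ^ 2` times the weak bound. -/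
theorem summingBound_diagonal {N : ℕ} (f : Fin N → StrongDual ℝ X) (hf : ∀ k, ‖f k‖ ≤ 1)
    (a : Fin N → ℝ) : SummingBound 2 (diagonal f a) (√(∑ k, a k ^ 2)) := by
  intro n x M hM hx
  simp only [EuclideanSpace.real_norm_sq_eq, diagonal_apply, mul_pow]
  rw [Finset.sum_comm, Real.sq_sqrt (Finset.sum_nonneg fun k _ => sq_nonneg _), Finset.sum_mul]
  refine Finset.sum_le_sum fun k _ => ?_
  rw [← Finset.sum_mul, mul_comm]
  gcongr
  simpa using hx (f k) (hf k)

/-- A space of cotype 2 with the Gordon-Lewis property has the Gaussian average property. -/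
theorem HasGL2.hasGAP {C : ℝ} (hX : CotypeBound X 2 C) (h : HasGL2 X) : HasGAP X := by
  obtain ⟨K, hK, htr⟩ := h.exists_trace_bound
  obtain ⟨K₁, hK₁, hone⟩ := hX.exists_one_summing
  have key : ∀ (N : ℕ) (S : EuclideanSpace ℝ (Fin N) →L[ℝ] X) (c : ℝ), 0 ≤ c →
      SummingBound 1 (adj S) c →
        ∑ k, ‖S (EuclideanSpace.single k 1)‖ ^ 2 ≤ (K * (K₁ + 1) * c) ^ 2 := by
    intro N S c hc hS
    set s := ∑ k, ‖S (EuclideanSpace.single k 1)‖ ^ 2 with hs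
    have hs0 : 0 ≤ s := Finset.sum_nonneg fun k _ => by positivity
    rcases hs0.eq_or_lt with h0 | h0
    · rw [← h0]; positivity
    choose f hf hfS using fun k => exists_dual_vector'' ℝ (S (EuclideanSpace.single k 1))
    have hfS' : ∀ k, f k (S (EuclideanSpace.single k 1)) = ‖S (EuclideanSpace.single k 1)‖ := hfS
    -- This scale makes the 2-summing constant of the diagonal operator `1 / (K₁ + 1)`, hence a
    -- 1-summing constant at most one; adding one to `K₁` avoids division by zero. The trace against
    -- `S` is then `t s = √s / (K₁ + 1)`.
    set t := (√s * (K₁ + 1))⁻¹ with ht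
    have hsq : 0 < √s := Real.sqrt_pos.2 h0
    have ht0 : 0 < t := by positivity
    set a : Fin N → ℝ := fun k => t * ‖S (EuclideanSpace.single k 1)‖ with ha
    set T := diagonal f a with hT
    have h1 := summingBound_diagonal f hf a
    have h2 : √(∑ k, a k ^ 2) = (K₁ + 1)⁻¹ := by
      simp only [ha, mul_pow]
      rw [← Finset.mul_sum, ← hs, Real.sqrt_mul (sq_nonneg _), Real.sqrt_sq ht0.le, ht]
      field_simp
    rw [h2] at h1
    have h3 : SummingBound 1 T 1 := (hone T _ (by positivity) h1).mono (by positivity) (by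
      rw [← div_eq_mul_inv, div_le_one (by positivity)]; linarith)
    have h4 := htr N T S c hc h3 hS
    have h5 : ∑ k, T (S (EuclideanSpace.single k 1)) k = t * s := by
      rw [hs, Finset.mul_sum]
      refine Finset.sum_congr rfl fun k _ => ?_
      rw [hT, diagonal_apply, hfS', ha]; ring
    rw [h5, abs_of_nonneg (by positivity)] at h4
    have h6 : t * s = √s / (K₁ + 1) := by
      rw [ht]
      nth_rw 2 [← Real.mul_self_sqrt hs0]
      field_simp
    rw [h6, div_le_iff₀ (by positivity)] at h4
    rw [← Real.sqrt_le_left (by positivity)]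
    linarith
  refine hasGAP_of_summingBound le_rfl (by positivity : 0 ≤ K * (K₁ + 1)) fun n S c hc hS => ?_
  intro N b M hM hb
  have hA := norm_comb_le b hM hb
  -- A weakly 2-bounded family is the image of the unit vectors under `comb b`, so the estimate on
  -- unit vectors for `S ∘ comb b` is the 2-summing inequality for `S`.
  have h1 : SummingBound 1 (adj (S.comp (comb b))) (M * c) :=
    (hS.comp_left (adj (comb b))).mono (by positivity)
      (by gcongr; exact (norm_adj_le _).trans hA)
  have h2 := key N _ _ (by positivity) h1
  simp only [ContinuousLinearMap.comp_apply, comb_apply] at h2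
  simp only [PiLp.single_apply] at h2
  simp only [ite_smul, one_smul, zero_smul, Finset.sum_ite_eq', Finset.mem_univ, if_true] at h2
  refine h2.trans (le_of_eq (by ring))

end GordonLewis

/-! ### Trace duality for 2-summing operators -/

section TraceDuality

variable {X : Type*} [NormedAddCommGroup X] [NormedSpace ℝ X]

/-- Domination of 2-summing operators by functionals, on finite-dimensional subspaces. -/
theorem SummingBound.exists_functionals {W Y : Type*} [NormedAddCommGroup W] [NormedSpace ℝ W]
    [FiniteDimensional ℝ W] [NormedAddCommGroup Y] [NormedSpace ℝ Y] {R : X →L[ℝ] Y} {c : ℝ}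
    (hR : SummingBound 2 R c) (e : W →ₗᵢ[ℝ] X) :
    ∃ (m : ℕ) (f : Fin m → StrongDual ℝ X) (μ : Fin m → ℝ), (∀ j, ‖f j‖ ≤ 1) ∧
      (∀ j, 0 ≤ μ j) ∧ ∑ j, μ j ≤ 1 ∧
        ∀ w, ‖R (e w)‖ ^ 2 ≤ (c * 2) ^ 2 * ∑ j, μ j * (f j (e w)) ^ 2 := by
  set res : StrongDual ℝ X → StrongDual ℝ W := fun f => f.comp e.toContinuousLinearMap with hres
  have hres_apply : ∀ f (w : W), res f w = f (e w) := fun f w => rfl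
  obtain ⟨m, g, μ, hg, hμ0, hμ1, hμ⟩ :=
    exists_pietsch_weights_of_norming (res '' Metric.closedBall 0 1) (by
      rintro _ ⟨f, hf, rfl⟩
      refine ContinuousLinearMap.opNorm_le_bound _ zero_le_one fun w => ?_
      rw [one_mul, ← e.norm_map w]
      exact (f.le_opNorm _).trans (mul_le_of_le_one_left (norm_nonneg _) (by simpa using hf)))
      (fun w M hM hw => by
        obtain ⟨f, hf, hfw⟩ := exists_dual_vector'' ℝ (e w)
        have hfw' : f (e w) = ‖e w‖ := hfw
        have h1 := hw (res f) ⟨f, by simpa using hf, rfl⟩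
        rw [hres_apply, hfw', abs_norm, e.norm_map] at h1
        exact h1)
      (R.toLinearMap ∘ₗ e.toLinearMap) (c := c) fun k w B hB hw =>
        hR k (fun i => e (w i)) B hB fun φ hφ => by
          simp only [sq_abs]
          exact hw (res φ) ⟨φ, by simpa using hφ, rfl⟩
  choose f hf hfg using hg
  refine ⟨m, f, μ, fun j => by simpa using hf j, hμ0, hμ1, fun w => ?_⟩
  simp only [← hres_apply, hfg]
  exact hμ w

theorem sum_apply_comp_comm {m n : ℕ}
    (R : EuclideanSpace ℝ (Fin m) →L[ℝ] EuclideanSpace ℝ (Fin n))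
    (H : EuclideanSpace ℝ (Fin n) →L[ℝ] EuclideanSpace ℝ (Fin m)) :
    ∑ k, R (H (EuclideanSpace.single k 1)) k = ∑ j, H (R (EuclideanSpace.single j 1)) j := by
  have h1 : ∀ k, R (H (EuclideanSpace.single k 1)) k =
      ∑ j, H (EuclideanSpace.single k 1) j * R (EuclideanSpace.single j 1) k := by
    intro k
    conv_lhs => rw [euclidean_eq_sum (H (EuclideanSpace.single k 1))]
    simp [Finset.sum_apply]
  have h2 : ∀ j, H (R (EuclideanSpace.single j 1)) j =
      ∑ k, R (EuclideanSpace.single j 1) k * H (EuclideanSpace.single k 1) j := by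
    intro j
    conv_lhs => rw [euclidean_eq_sum (R (EuclideanSpace.single j 1))]
    simp [Finset.sum_apply]
  simp only [h1, h2]
  rw [Finset.sum_comm]
  simp only [mul_comm]

/-- Trace duality for 2-summing operators. -/
theorem abs_trace_le_of_two_summing {n : ℕ} {V : X →L[ℝ] EuclideanSpace ℝ (Fin n)}
    {S : EuclideanSpace ℝ (Fin n) →L[ℝ] X} {c d : ℝ} (hd : 0 ≤ d) (hc : 0 ≤ c)
    (hV : SummingBound 2 V d) (hS : SummingBound 2 S c) :
    |∑ k, V (S (EuclideanSpace.single k 1)) k| ≤ c * (d * 2) := by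
  obtain ⟨m, f, μ, hf, hμ0, hμ1, hμ⟩ :=
    hV.exists_functionals (LinearMap.range S.toLinearMap).subtypeₗᵢ
  set H : EuclideanSpace ℝ (Fin n) →L[ℝ] EuclideanSpace ℝ (Fin m) :=
    (diagonal f fun j => √(μ j)).comp S with hH
  have hHj : ∀ a j, H a j = f j (S a) * √(μ j) := fun a j => diagonal_apply _ _ _ _
  obtain ⟨R, hR, hRH⟩ := exists_factor_of_norm_le (V.comp S).toLinearMap H.toLinearMap
    (κ := d * 2) (by positivity) (fun a => by
      rw [← sq_le_sq₀ (norm_nonneg _) (by positivity), mul_pow]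
      refine (hμ ⟨S a, a, rfl⟩).trans (le_of_eq ?_)
      congr 1
      refine (Finset.sum_congr rfl fun j _ => ?_).trans (EuclideanSpace.real_norm_sq_eq _).symm
      have h1 : (H.toLinearMap a) j = f j (S a) * √(μ j) := hHj a j
      rw [h1, mul_pow, Real.sq_sqrt (hμ0 j), mul_comm]
      rfl)
  have h1 : ∀ a, V (S a) = R (H a) := hRH
  simp only [h1]
  -- Cyclicity of the trace moves `R` in front of `S`. The vectors `R e_j` have weak `ℓ₂`-norm at
  -- most `2d`, so the 2-summing inequality for `S` and Cauchy-Schwarz with `√μ_j` conclude.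
  rw [sum_apply_comp_comm]
  simp only [hHj]
  have hRsum : ∑ j, ‖S (R (EuclideanSpace.single j 1))‖ ^ 2 ≤ (c * (d * 2)) ^ 2 := by
    refine hS m (fun j => R (EuclideanSpace.single j 1)) (d * 2) (by positivity) fun g hg => ?_
    simp only [sq_abs]
    refine sum_sq_apply_le _ (fun a => ?_) hg
    have h2 : ∑ k, a k • R (EuclideanSpace.single k 1) = R (WithLp.toLp 2 a) := by
      conv_rhs => rw [euclidean_eq_sum (WithLp.toLp 2 a)]
      simp
    rw [h2]
    refine (R.le_opNorm _).trans ?_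
    rw [EuclideanSpace.norm_eq]
    simp only [Real.norm_eq_abs, sq_abs]
    gcongr
  calc |∑ j, f j (S (R (EuclideanSpace.single j 1))) * √(μ j)|
      ≤ ∑ j, ‖S (R (EuclideanSpace.single j 1))‖ * √(μ j) := by
        refine (Finset.abs_sum_le_sum_abs _ _).trans (Finset.sum_le_sum fun j _ => ?_)
        rw [abs_mul, abs_of_nonneg (Real.sqrt_nonneg _)]
        gcongr
        exact ((f j).le_opNorm _).trans (mul_le_of_le_one_left (norm_nonneg _) (hf j))
    _ ≤ √(∑ j, ‖S (R (EuclideanSpace.single j 1))‖ ^ 2) * √(∑ j, √(μ j) ^ 2) :=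
        Real.sum_mul_le_sqrt_mul_sqrt _ _ _
    _ ≤ c * (d * 2) * 1 := by
        gcongr
        · rw [Real.sqrt_le_left (by positivity)]; exact hRsum
        · rw [Real.sqrt_le_one]
          simpa only [Real.sq_sqrt (hμ0 _)] using hμ1
    _ = _ := mul_one _

/-- GAP bounds the Gaussian average of `S`, cotype 2 converts it into a 2-summing constant, and
trace duality pairs this with `V`. -/
theorem HasGAP.exists_trace_bound {C : ℝ} (hX : CotypeBound X 2 C) (h : HasGAP X) :
    ∃ K : ℝ, 0 ≤ K ∧ ∀ (n : ℕ) (V : X →L[ℝ] EuclideanSpace ℝ (Fin n))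
      (S : EuclideanSpace ℝ (Fin n) →L[ℝ] X) (c d : ℝ), 0 ≤ c → 0 ≤ d → SummingBound 2 V d →
        SummingBound 1 (adj S) c → |∑ k, V (S (EuclideanSpace.single k 1)) k| ≤ K * d * c := by
  obtain ⟨K, hK, hgap⟩ := h.exists_gaussSq_le
  have hC := hX.1
  have hm := gaussMoment_one_pos
  refine ⟨C * (gaussMoment 1)⁻¹ * K * 2, by positivity, fun n V S c d hc hd hV hS => ?_⟩
  have h1 : √(gaussSq S) ≤ K * c := (Real.sqrt_le_left (by positivity)).2 (hgap n S c hc hS)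
  have h2 : SummingBound 2 S (C * (gaussMoment 1)⁻¹ * (K * c)) :=
    (hX.summingBound_two S).mono (by positivity) (by gcongr)
  refine (abs_trace_le_of_two_summing hd (by positivity) hV h2).trans (le_of_eq (by ring))

end TraceDuality

/-! ### Projective size of formal tensors -/

section TensorSize

variable {K X : Type*} [TopologicalSpace K] [CompactSpace K] [NormedAddCommGroup X]

/-- The projective size of a formal combination of elementary tensors. -/
def tensorSize (u : C(K, ℝ) × X →₀ ℝ) : ℝ :=
  ∑ q ∈ u.support, |u q| * (‖q.1‖ * ‖q.2‖)

theorem tensorSize_nonneg (u : C(K, ℝ) × X →₀ ℝ) : 0 ≤ tensorSize u :=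
  Finset.sum_nonneg fun q _ => by positivity

theorem tensorSize_smul {c : ℝ} (hc : 0 < c)
    (u : C(K, ℝ) × X →₀ ℝ) : tensorSize (c • u) = c * tensorSize u := by
  simp only [tensorSize]
  rw [Finsupp.support_smul_eq hc.ne', Finset.mul_sum]
  refine Finset.sum_congr rfl fun q _ => ?_
  rw [Finsupp.smul_apply, smul_eq_mul, abs_mul, abs_of_pos hc]
  ring

theorem tensorSize_add_le (u v : C(K, ℝ) × X →₀ ℝ) :
    tensorSize (u + v) ≤ tensorSize u + tensorSize v := by
  classical
  have h : ∀ w : C(K, ℝ) × X →₀ ℝ, ∀ s, w.support ⊆ s →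
      tensorSize w = ∑ q ∈ s, |w q| * (‖q.1‖ * ‖q.2‖) := fun w s hs =>
    Finset.sum_subset hs fun q _ hq => by rw [Finsupp.notMem_support_iff.1 hq]; simp
  rw [h (u + v) _ Finsupp.support_add, h u _ Finset.subset_union_left,
    h v _ Finset.subset_union_right, ← Finset.sum_add_distrib]
  refine Finset.sum_le_sum fun q _ => ?_
  rw [← add_mul, Finsupp.add_apply]
  gcongr
  exact abs_add_le _ _

end TensorSize

/-! ### Extending the trace functional to a bilinear form -/

section BilinearExtension

variable {X : Type*} [NormedAddCommGroup X] [NormedSpace ℝ X]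

/-- The closed unit ball of `ℓ₂`, as a compact subset of `ℝ^ℕ`. -/
def ballSeq : Set (ℕ → ℝ) := {t | ∀ N, ∑ k ∈ Finset.range N, t k ^ 2 ≤ 1}

theorem abs_le_one_of_mem_ballSeq {t : ℕ → ℝ} (ht : t ∈ ballSeq) (k : ℕ) : |t k| ≤ 1 := by
  rw [← sq_le_one_iff_abs_le_one]
  exact (Finset.single_le_sum (f := fun k => t k ^ 2) (fun i _ => sq_nonneg _)
    (Finset.mem_range.2 (Nat.lt_succ_self k))).trans (ht (k + 1))

theorem isClosed_ballSeq : IsClosed ballSeq := by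
  have : ballSeq = ⋂ N, {t : ℕ → ℝ | ∑ k ∈ Finset.range N, t k ^ 2 ≤ 1} := by
    ext t; simp [ballSeq]
  rw [this]
  exact isClosed_iInter fun N => isClosed_le (by fun_prop) continuous_const

instance : CompactSpace ballSeq := by
  rw [← isCompact_iff_compactSpace]
  refine (isCompact_univ_pi (s := fun _ : ℕ => Set.Icc (-1 : ℝ) 1) fun _ =>
    isCompact_Icc).of_isClosed_subset
    isClosed_ballSeq fun t ht k _ => abs_le.1 (abs_le_one_of_mem_ballSeq ht k)

theorem sum_sq_le_norm_sq (a : ell2) (N : ℕ) :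
    ∑ k ∈ Finset.range N, a k ^ 2 ≤ ‖a‖ ^ 2 := by
  have h1 : ‖trunc N a‖ ≤ ‖a‖ :=
    ((trunc N).le_opNorm a).trans (mul_le_of_le_one_left (norm_nonneg _) (norm_trunc_le N))
  have h2 := pow_le_pow_left₀ (norm_nonneg _) h1 2
  rw [EuclideanSpace.real_norm_sq_eq] at h2
  simp only [trunc_apply] at h2
  rwa [Fin.sum_univ_eq_sum_range (fun k => a k ^ 2) N] at h2

theorem mem_ballSeq_of_norm_le {a : ell2} (ha : ‖a‖ ≤ 1) : (fun k => a k) ∈ ballSeq := fun N =>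
  (sum_sq_le_norm_sq a N).trans (pow_le_one₀ (norm_nonneg _) ha)

/-- The coordinate functions on the unit ball. -/
def coord (k : ℕ) : C(ballSeq, ℝ) :=
  ⟨fun t => (t : ℕ → ℝ) k, (continuous_apply k).comp continuous_subtype_val⟩

theorem coord_apply (k : ℕ) (t : ballSeq) : coord k t = (t : ℕ → ℝ) k := rfl

theorem toEll2_apply {n : ℕ} (g : EuclideanSpace ℝ (Fin n)) (k : Fin n) : toEll2 n g k = g k := by
  have h : Orthonormal ℝ fun i : Fin n => unitVec i :=
    orthonormal_unitVec.comp _ Fin.val_injective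
  rw [← inner_unitVec_left, toEll2, comb_apply]
  exact h.inner_right_fintype (fun i => g i) k

/-- Evaluation of a formal combination of elementary tensors as a function. -/
def evalTensor (K X : Type*) [TopologicalSpace K] [NormedAddCommGroup X] [NormedSpace ℝ X] :
    (C(K, ℝ) × X →₀ ℝ) →ₗ[ℝ] K → X :=
  Finsupp.linearCombination ℝ fun q t => q.1 t • q.2

theorem evalTensor_apply {K : Type*} [TopologicalSpace K] (u : C(K, ℝ) × X →₀ ℝ) (t : K) :
    evalTensor K X u t = ∑ q ∈ u.support, u q • q.1 t • q.2 := by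
  simp [evalTensor, Finsupp.linearCombination_apply, Finsupp.sum, Finset.sum_apply]

/-- The linear functions `t ↦ ∑ tₖ xₖ` on the unit ball. -/
def linearFun (X : Type*) [NormedAddCommGroup X] [NormedSpace ℝ X] : (ℕ →₀ X) →ₗ[ℝ] ballSeq → X :=
  Finsupp.lsum ℝ fun k => LinearMap.pi fun t => coord k t • LinearMap.id

theorem linearFun_apply (x : ℕ →₀ X) (t : ballSeq) :
    linearFun X x t = ∑ k ∈ x.support, coord k t • x k := by
  simp [linearFun, Finsupp.sum, Finset.sum_apply]

/-- Evaluation at a unit vector recovers the coefficient, so a functional of the coefficients is a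
functional of the linear function. -/
theorem linearFun_injective : Function.Injective (linearFun X) := by
  rw [← LinearMap.ker_eq_bot, LinearMap.ker_eq_bot']
  intro x hx
  ext k
  have h1 := congrFun hx ⟨fun j => (unitVec k : ell2) j,
    mem_ballSeq_of_norm_le (orthonormal_unitVec.1 k).le⟩
  rw [linearFun_apply] at h1
  simp only [coord_apply, unitVec_apply] at h1
  by_contra hk
  rw [Finset.sum_eq_single_of_mem k (Finsupp.mem_support_iff.2 hk) fun j _ hj => by simp [hj]] at h1
  exact hk (by simpa using h1)

/-- The adjoint of the operator `g ↦ ∑ gₖ xₖ` is 1-summing with constant any projective size of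
the function `t ↦ ∑ tₖ xₖ`. -/
theorem summingBound_adj_of_tensor {x : ℕ →₀ X} {u : C(ballSeq, ℝ) × X →₀ ℝ}
    (hu : evalTensor ballSeq X u = linearFun X x) {n : ℕ} (hn : x.support ⊆ Finset.range n) :
    SummingBound 1 (adj (comb fun k : Fin n => x k)) (tensorSize u) := by
  intro N f M hM hf
  have hS : ∀ g : EuclideanSpace ℝ (Fin n), ∀ hg : ‖g‖ ≤ 1, comb (fun k : Fin n => x k) g =
      ∑ q ∈ u.support, u q • q.1 ⟨fun k => toEll2 n g k,
        mem_ballSeq_of_norm_le ((norm_toEll2 g).trans_le hg)⟩ • q.2 := by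
    intro g hg
    rw [← evalTensor_apply, hu, linearFun_apply, Finset.sum_subset hn fun k _ hk => by
      rw [Finsupp.notMem_support_iff.1 hk, smul_zero], comb_apply,
      ← Fin.sum_univ_eq_sum_range (fun k => coord k _ • x k)]
    refine Finset.sum_congr rfl fun k _ => ?_
    rw [coord_apply]
    simp only [toEll2_apply]
  have h1 : ∀ i, ‖adj (comb fun k : Fin n => x k) (f i)‖ ≤
      ∑ q ∈ u.support, |u q| * (‖q.1‖ * |f i q.2|) := by
    intro i
    refine ContinuousLinearMap.opNorm_le_of_unit_norm
      (Finset.sum_nonneg fun q _ => by positivity) fun g hg => ?_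
    rw [adj_apply, hS g hg.le, map_sum]
    refine (norm_sum_le _ _).trans (Finset.sum_le_sum fun q _ => ?_)
    rw [map_smul, map_smul, norm_smul, norm_smul, Real.norm_eq_abs, Real.norm_eq_abs (f i q.2)]
    gcongr
    exact q.1.norm_coe_le_norm _
  -- Points of `X` act on its dual as functionals of norm at most their own, so the weak bound
  -- applies to evaluations.
  have h2 : ∀ y : X, ∑ i, |f i y| ≤ M * ‖y‖ := by
    intro y
    rcases (norm_nonneg y).eq_or_lt with h0 | h0
    · have : y = 0 := norm_eq_zero.1 h0.symm
      simp [this]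
    · have h3 := hf (‖y‖⁻¹ • NormedSpace.inclusionInDoubleDual ℝ X y) (by
        rw [norm_smul, norm_inv, norm_norm, inv_mul_le_iff₀ h0, mul_one]
        exact NormedSpace.double_dual_bound ℝ X y)
      simp only [_root_.smul_apply, NormedSpace.dual_def, smul_eq_mul, abs_mul, pow_one,
        abs_inv, abs_norm, ← Finset.mul_sum] at h3
      rw [inv_mul_le_iff₀ h0] at h3
      linarith
  simp only [pow_one]
  calc ∑ i, ‖adj (comb fun k : Fin n => x k) (f i)‖
      ≤ ∑ i, ∑ q ∈ u.support, |u q| * (‖q.1‖ * |f i q.2|) := Finset.sum_le_sum fun i _ => h1 i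
    _ = ∑ q ∈ u.support, |u q| * (‖q.1‖ * ∑ i, |f i q.2|) := by
        rw [Finset.sum_comm]; simp only [Finset.mul_sum]
    _ ≤ ∑ q ∈ u.support, |u q| * (‖q.1‖ * (M * ‖q.2‖)) := by
        gcongr with q
        exact h2 _
    _ = _ := by
        rw [tensorSize, Finset.sum_mul]
        exact Finset.sum_congr rfl fun q _ => by ring

/-- A functional on linear functions bounded by the projective size extends to a bounded bilinear
form. -/
theorem exists_bilinear_extension (τ : ℕ → X →ₗ[ℝ] ℝ) {C : ℝ} (hC0 : 0 ≤ C)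
    (hC : ∀ (x : ℕ →₀ X) (u : C(ballSeq, ℝ) × X →₀ ℝ), evalTensor ballSeq X u = linearFun X x →
      ∑ k ∈ x.support, τ k (x k) ≤ C * tensorSize u) :
    ∃ Ψ : X →ₗ[ℝ] C(ballSeq, ℝ) →ₗ[ℝ] ℝ, (∀ x φ, |Ψ x φ| ≤ C * (‖φ‖ * ‖x‖)) ∧
      ∀ k x, Ψ x (coord k) = τ k x := by
  set ι := linearFun X
  set ev := evalTensor ballSeq X
  set L₀ : (ℕ →₀ X) →ₗ[ℝ] ℝ := Finsupp.lsum ℝ τ with hL₀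
  have hL₀x : ∀ x, L₀ x = ∑ k ∈ x.support, τ k (x k) := fun x => by simp [hL₀, Finsupp.sum]
  set D : Submodule ℝ (C(ballSeq, ℝ) × X →₀ ℝ) := (LinearMap.range ι).comap ev
  set inv := (LinearEquiv.ofInjective ι linearFun_injective).symm
  set L : D →ₗ[ℝ] ℝ := L₀ ∘ₗ inv.toLinearMap ∘ₗ ev.restrict (q := LinearMap.range ι) fun u hu => hu
    with hL
  have hLu : ∀ (u : D) (x : ℕ →₀ X), ev u = ι x → L u = L₀ x := by
    intro u x hux
    have h1 : ev.restrict (q := LinearMap.range ι) (fun u hu => hu) u =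
        LinearEquiv.ofInjective ι linearFun_injective x := Subtype.ext hux
    simp only [hL, LinearMap.comp_apply, h1]
    congr 1
    exact LinearEquiv.symm_apply_apply _ x
  obtain ⟨G, hG, hGle⟩ := exists_extension_of_le_sublinear ⟨D, L⟩ (fun u => C * tensorSize u)
    (fun c hc u => by rw [tensorSize_smul hc]; ring) (fun u v => by
      rw [← mul_add]
      exact mul_le_mul_of_nonneg_left (tensorSize_add_le u v) hC0) (by
      rintro ⟨u, x, hx⟩
      refine le_trans (le_of_eq ?_) (hC x u hx.symm)
      rw [← hL₀x]
      exact hLu _ x hx.symm)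
  -- The extension lives on formal combinations. A difference that evaluates to zero lies in `D`,
  -- where `G` is already known to vanish on it; hence `G` depends only on the function, which
  -- supplies bilinearity.
  have hrel : ∀ u v, ev u = ev v → G u = G v := by
    intro u v huv
    have h1 : ev (u - v) = ι 0 := by rw [map_sub, huv, sub_self, map_zero]
    have h2 := hG ⟨u - v, 0, h1.symm⟩
    have h3 := hLu ⟨u - v, 0, h1.symm⟩ 0 h1
    replace h3 := h3.trans (map_zero L₀)
    rw [← sub_eq_zero, ← map_sub]
    exact h2.trans h3
  have hsingle : ∀ φ x (r : ℝ) t, ev (Finsupp.single (φ, x) r) t = r • φ t • x := by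
    intro φ x r t
    simp [ev, evalTensor]
  refine ⟨LinearMap.mk₂ ℝ (fun x φ => G (Finsupp.single (φ, x) 1)) ?_ ?_ ?_ ?_, ?_, ?_⟩
  · intro x y φ
    rw [← map_add]
    refine hrel _ _ (funext fun t => ?_)
    simp [hsingle]
  · intro c x φ
    rw [← map_smul]
    refine hrel _ _ (funext fun t => ?_)
    simp [hsingle, smul_comm c]
  · intro x φ ψ
    rw [← map_add]
    refine hrel _ _ (funext fun t => ?_)
    simp [hsingle, add_smul]
  · intro c x φ
    rw [← map_smul]
    refine hrel _ _ (funext fun t => ?_)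
    simp [hsingle, smul_smul]
  · intro x φ
    have h1 : ∀ r : ℝ, |r| = 1 → tensorSize (Finsupp.single (φ, x) r) = ‖φ‖ * ‖x‖ := by
      intro r hr
      have hr0 : r ≠ 0 := by rintro rfl; simp at hr
      simp [tensorSize, Finsupp.support_single _ hr0, hr]
    rw [LinearMap.mk₂_apply, abs_le']
    constructor
    · have := hGle (Finsupp.single (φ, x) 1)
      rwa [h1 1 (by simp)] at this
    · have := hGle (Finsupp.single (φ, x) (-1))
      rw [h1 (-1) (by simp), Finsupp.single_neg, map_neg] at this
      exact this
  · intro k x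
    have h1 : ev (Finsupp.single (coord k, x) 1) = ι (Finsupp.single k x) := by
      ext t
      rw [hsingle]
      simp [ι, linearFun]
    have h2 := hG ⟨Finsupp.single (coord k, x) 1, _, h1.symm⟩
    rw [LinearMap.mk₂_apply]
    refine h2.trans ((hLu _ _ h1).trans ?_)
    simp [hL₀]

end BilinearExtension

/-! ### Functionals on continuous functions as differences of finite measures -/

section Measures

/-- A bounded functional on the continuous functions on a compact space is the difference of two
finite measures. -/
theorem exists_measures_of_functional {K : Type*} [TopologicalSpace K] [CompactSpace K] [T2Space K]
    [MeasurableSpace K] [BorelSpace K] (L : C(K, ℝ) →ₗ[ℝ] ℝ) {c : ℝ}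
    (hc : 0 ≤ c) (hL : ∀ φ, |L φ| ≤ c * ‖φ‖) :
    ∃ m : Bool → Measure K, (∀ b, IsFiniteMeasure (m b)) ∧
      (m true).real Set.univ + (m false).real Set.univ ≤ c * 2 ∧
        ∀ φ : C(K, ℝ), L φ = ∫ t, φ t ∂(m true) - ∫ t, φ t ∂(m false) := by
  -- On pairs `(φ, -φ)` this is `c ‖φ‖`, since `|φ| = φ⁺ + (-φ)⁺`, so it dominates `L`. It vanishes
  -- on nonpositive pairs, so both components of the extension are positive; evaluation at `(1, 1)`
  -- bounds the total mass by `2c`.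
  set q : C(K, ℝ) × C(K, ℝ) → ℝ := fun p => c * ‖p.1 ⊔ 0 + p.2 ⊔ 0‖ with hq
  have happ : ∀ (p : C(K, ℝ) × C(K, ℝ)) t,
      (p.1 ⊔ 0 + p.2 ⊔ 0) t = max (p.1 t) 0 + max (p.2 t) 0 := fun p t => rfl
  have happ0 : ∀ (p : C(K, ℝ) × C(K, ℝ)) t, 0 ≤ max (p.1 t) 0 + max (p.2 t) 0 := fun p t => by
    positivity
  have hle : ∀ (p : C(K, ℝ) × C(K, ℝ)) t,
      max (p.1 t) 0 + max (p.2 t) 0 ≤ ‖p.1 ⊔ 0 + p.2 ⊔ 0‖ := fun p t => by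
    have := (p.1 ⊔ 0 + p.2 ⊔ 0).norm_coe_le_norm t
    rwa [happ, Real.norm_of_nonneg (happ0 p t)] at this
  have hnorm_le : ∀ (p : C(K, ℝ) × C(K, ℝ)) {M : ℝ}, 0 ≤ M →
      (∀ t, max (p.1 t) 0 + max (p.2 t) 0 ≤ M) → ‖p.1 ⊔ 0 + p.2 ⊔ 0‖ ≤ M := by
    intro p M hM h
    rw [ContinuousMap.norm_le _ hM]
    intro t
    rw [happ, Real.norm_of_nonneg (happ0 p t)]
    exact h t
  set D : Submodule ℝ (C(K, ℝ) × C(K, ℝ)) :=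
    LinearMap.ker (LinearMap.fst ℝ C(K, ℝ) C(K, ℝ) + LinearMap.snd ℝ C(K, ℝ) C(K, ℝ))
  obtain ⟨G, hG, hGle⟩ := exists_extension_of_le_sublinear
    ⟨D, L ∘ₗ LinearMap.fst ℝ C(K, ℝ) C(K, ℝ) ∘ₗ D.subtype⟩ q (by
      intro r hr p
      have : ‖(r • p).1 ⊔ 0 + (r • p).2 ⊔ 0‖ = r * ‖p.1 ⊔ 0 + p.2 ⊔ 0‖ := by
        have h1 : (r • p).1 ⊔ 0 + (r • p).2 ⊔ 0 = r • (p.1 ⊔ 0 + p.2 ⊔ 0) := by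
          ext t
          rw [happ, ContinuousMap.smul_apply, happ, smul_eq_mul, mul_add,
            mul_max_of_nonneg _ _ hr.le, mul_max_of_nonneg _ _ hr.le, mul_zero]
          rfl
        rw [h1, norm_smul, Real.norm_of_nonneg hr.le]
      simp only [hq, this]
      ring) (by
      intro p p'
      simp only [hq]
      rw [← mul_add]
      refine mul_le_mul_of_nonneg_left (hnorm_le _ (by positivity) fun t => ?_) hc
      have h1 := hle p t
      have h2 := hle p' t
      have h3 : max ((p + p').1 t) 0 ≤ max (p.1 t) 0 + max (p'.1 t) 0 :=
        max_le (add_le_add (le_max_left _ _) (le_max_left _ _)) (by positivity)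
      have h4 : max ((p + p').2 t) 0 ≤ max (p.2 t) 0 + max (p'.2 t) 0 :=
        max_le (add_le_add (le_max_left _ _) (le_max_left _ _)) (by positivity)
      linarith) (by
      rintro ⟨p, hp⟩
      have hp2 : p.1 + p.2 = 0 := hp
      refine (le_abs_self _).trans ((hL p.1).trans ?_)
      refine mul_le_mul_of_nonneg_left ?_ hc
      rw [ContinuousMap.norm_le _ (norm_nonneg _)]
      intro t
      have h1 : p.2 t = -p.1 t := by
        have := congrArg (fun f : C(K, ℝ) => f t) hp2
        simp only [ContinuousMap.add_apply, ContinuousMap.zero_apply] at this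
        linarith
      refine le_trans (le_of_eq ?_) (hle p t)
      rw [h1, Real.norm_eq_abs]
      rcases le_total 0 (p.1 t) with h | h
      · rw [abs_of_nonneg h, max_eq_left h, max_eq_right (by linarith), add_zero]
      · rw [abs_of_nonpos h, max_eq_right h, max_eq_left (by linarith), zero_add])
  set ℓ : Bool → C(K, ℝ) →ₗ[ℝ] ℝ := fun b => G ∘ₗ
    (bif b then LinearMap.inl ℝ C(K, ℝ) C(K, ℝ) else LinearMap.inr ℝ C(K, ℝ) C(K, ℝ)) with hℓ
  have hpos : ∀ b (φ : C(K, ℝ)), 0 ≤ φ → 0 ≤ ℓ b φ := by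
    intro b φ hφ
    have h1 : ℓ b (-φ) ≤ 0 := by
      have hφt : ∀ t, max (-φ t) 0 = 0 := fun t => max_eq_right (neg_nonpos.2 (hφ t))
      have h2 : ∀ p : C(K, ℝ) × C(K, ℝ), (∀ t, max (p.1 t) 0 + max (p.2 t) 0 ≤ 0) → G p ≤ 0 :=
        fun p hp => (hGle p).trans (mul_nonpos_of_nonneg_of_nonpos hc (hnorm_le p le_rfl hp))
      cases b
      · exact h2 (0, -φ) fun t => by simp [hφt]
      · exact h2 (-φ, 0) fun t => by simp [hφt]
    rw [map_neg] at h1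
    linarith
  have hdiff : ∀ φ, L φ = ℓ true φ - ℓ false φ := by
    intro φ
    have h1 := hG ⟨(φ, -φ), by simp [D]⟩
    have h2 : (φ, -φ) = ((φ, 0) : C(K, ℝ) × C(K, ℝ)) - (0, φ) := by simp
    have h3 : G (φ, -φ) = L φ := h1
    rw [← h3, h2, map_sub]
    rfl
  have hone : ℓ true 1 + ℓ false 1 ≤ c * 2 := by
    have h1 : ℓ true 1 + ℓ false 1 = G (1, 1) := by
      have h2 : ((1, 1) : C(K, ℝ) × C(K, ℝ)) = (1, 0) + (0, 1) := by simp
      rw [h2, map_add]; rfl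
    rw [h1]
    refine (hGle _).trans (mul_le_mul_of_nonneg_left (hnorm_le _ zero_le_two fun t => ?_) hc)
    simp; norm_num
  set toC : CompactlySupportedContinuousMap K ℝ →ₗ[ℝ] C(K, ℝ) :=
    { toFun := fun f => f.toContinuousMap, map_add' := fun _ _ => rfl, map_smul' := fun _ _ => rfl }
    with htoC
  set Λ : Bool → (CompactlySupportedContinuousMap K ℝ →ₚ[ℝ] ℝ) := fun b =>
    PositiveLinearMap.mk₀ (ℓ b ∘ₗ toC) fun f hf => hpos b _ hf with hΛ
  have hint : ∀ b (φ : C(K, ℝ)), ∫ t, φ t ∂(RealRMK.rieszMeasure (Λ b)) = ℓ b φ := fun b φ =>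
    RealRMK.integral_rieszMeasure (Λ b) (CompactlySupportedContinuousMap.continuousMapEquiv φ)
  refine ⟨fun b => RealRMK.rieszMeasure (Λ b), fun b => inferInstance, ?_, fun φ => ?_⟩
  · have h1 : ∀ b, (RealRMK.rieszMeasure (Λ b)).real Set.univ = ℓ b 1 := by
      intro b
      rw [← hint b 1]
      simp
    rw [h1, h1]
    exact hone
  · rw [hint, hint]
    exact hdiff φ

theorem measure_eq_of_integral_eq {K : Type*} [TopologicalSpace K] [CompactSpace K]
    [TopologicalSpace.PseudoMetrizableSpace K] [MeasurableSpace K] [BorelSpace K]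
    {μ ν : Measure K} [IsFiniteMeasure μ] [IsFiniteMeasure ν]
    (h : ∀ φ : C(K, ℝ), ∫ t, φ t ∂μ = ∫ t, φ t ∂ν) : μ = ν :=
  ext_of_forall_integral_eq_of_IsFiniteMeasure fun f => h f.toContinuousMap

end Measures

/-! ### Factorization through `ℓ₁` from absolutely summable coefficients -/

section Factorization

universe u

/-- An operator into `ℓ₂` that is represented by absolutely summable coefficients factors through
an `L₁`-space. -/
theorem factorsThroughL1_of_hasSum {X : Type u} [NormedAddCommGroup X] [NormedSpace ℝ X]
    {T : X →L[ℝ] ell2} {I : Type u} [Countable I] (d : I → ell2) (hd : ∀ i, ‖d i‖ ≤ 1)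
    (θ : X → I → ℝ) (hadd : ∀ x y i, θ (x + y) i = θ x i + θ y i) {R : ℝ}
    (hs : ∀ x, Summable fun i => |θ x i|) (hR : ∀ x, ∑' i, |θ x i| ≤ R * ‖x‖)
    (hT : ∀ x k, HasSum (fun i => θ x i * d i k) (T x k)) : FactorsThroughL1 T := by
  let _ : MeasurableSpace I := ⊤
  have hint : ∀ x, Integrable (θ x) (Measure.count : Measure I) := fun x =>
    integrable_count_iff.2 (hs x)
  have hcount : ∀ {E : Type} [NormedAddCommGroup E] [NormedSpace ℝ E] [CompleteSpace E] (f : I → E),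
      Integrable f (Measure.count : Measure I) → HasSum f (∫ i, f i ∂Measure.count) := by
    intro E _ _ _ f hf
    have h1 : ∫ i, f i ∂Measure.count = ∑' i, f i := by
      rw [integral_countable hf]
      simp
    rw [h1]
    exact (integrable_count_iff.1 hf).of_norm.hasSum
  have hae : ∀ {f g : I → ℝ}, f =ᵐ[Measure.count] g → f = g := fun h => by
    rwa [Filter.EventuallyEq, Measure.ae_count_iff, ← funext_iff] at h
  set A : X →+ Lp ℝ 1 (Measure.count : Measure I) :=
    { toFun := fun x => (hint x).toL1 (θ x)
      map_zero' := by
        have h0 : θ 0 = 0 := by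
          ext i
          have := hadd 0 0 i
          rw [add_zero] at this
          simpa using this
        exact (Integrable.toL1_eq_toL1_iff _ _ (hint 0) (integrable_zero _ _ _)).2
          (by rw [h0]) |>.trans (Integrable.toL1_zero _)
      map_add' := fun x y => by
        rw [← Integrable.toL1_add]
        exact (Integrable.toL1_eq_toL1_iff _ _ _ _).2
          (Eventually.of_forall fun i => hadd x y i) } with hA
  have hAx : ∀ x, (A x : I → ℝ) = θ x := fun x => hae (Integrable.coeFn_toL1 (hint x))
  have hAbound : ∀ x, ‖A x‖ ≤ R * ‖x‖ := by
    intro x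
    rw [L1.norm_eq_integral_norm, hAx, ← (hcount _ (hint x).norm).tsum_eq]
    exact hR x
  have hdint : ∀ f : Lp ℝ 1 (Measure.count : Measure I),
      Integrable (fun i => f i • d i) Measure.count := fun f => by
    refine integrable_count_iff.2 ?_
    refine Summable.of_nonneg_of_le (fun i => norm_nonneg _) (fun i => ?_)
      (integrable_count_iff.1 (L1.integrable_coeFn f))
    rw [norm_smul]
    exact mul_le_of_le_one_right (norm_nonneg _) (hd i)
  set B : Lp ℝ 1 (Measure.count : Measure I) →L[ℝ] ell2 := LinearMap.mkContinuous
    { toFun := fun f => ∫ i, f i • d i ∂Measure.count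
      map_add' := fun f g => by
        rw [← integral_add (hdint f) (hdint g)]
        refine integral_congr_ae ?_
        filter_upwards [Lp.coeFn_add f g] with i hi
        rw [hi, Pi.add_apply, add_smul]
      map_smul' := fun r f => by
        rw [RingHom.id_apply, ← integral_smul]
        refine integral_congr_ae ?_
        filter_upwards [Lp.coeFn_smul r f] with i hi
        rw [hi, Pi.smul_apply, smul_eq_mul, mul_smul] } 1 fun f => by
    rw [one_mul, L1.norm_eq_integral_norm]
    refine (norm_integral_le_integral_norm _).trans ?_
    refine integral_mono (hdint f).norm (L1.integrable_coeFn f).norm fun i => ?_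
    simp only [norm_smul]
    exact mul_le_of_le_one_right (norm_nonneg _) (hd i)
  have hB : ∀ f, B f = ∫ i, f i • d i ∂Measure.count := fun f => rfl
  -- Only additivity of the coefficients is assumed; real homogeneity follows from continuity.
  refine ⟨I, inferInstance, Measure.count, A.toRealLinearMap
    (AddMonoidHomClass.continuous_of_bound A R hAbound), B, ?_⟩
  ext x k
  have h1 : HasSum (fun i => θ x i • d i) (B (A x)) := by
    have := hcount _ (hdint (A x))
    rw [hAx] at this
    rw [hB, hAx]
    exact this
  have h2 := (innerSL ℝ (unitVec k)).hasSum h1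
  simp only [innerSL_apply_apply, real_inner_smul_right, inner_unitVec_left]
    at h2
  exact (hT x k).unique h2

end Factorization

/-! ### Measurable expansion of points of the unit ball along a countable net -/

section GreedyExpansion

instance : TopologicalSpace.SeparableSpace ell2 := by
  rw [← TopologicalSpace.isSeparable_univ_iff]
  have h1 : TopologicalSpace.IsSeparable
      (closure (Submodule.span ℝ (Set.range unitVec) : Set ell2)) :=
    (TopologicalSpace.IsSeparable.span (Set.countable_range unitVec).isSeparable).closure
  refine h1.mono fun a _ => ?_
  refine mem_closure_of_tendsto (lp.hasSum_single (by norm_num) a)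
    (Eventually.of_forall fun s => ?_)
  refine Submodule.sum_mem _ fun k _ => ?_
  have h2 : lp.single 2 k (a k) = a k • unitVec k := by
    rw [unitVec, ← lp.single_smul, smul_eq_mul, mul_one]
  rw [h2]
  exact Submodule.smul_mem _ _ (Submodule.subset_span ⟨k, rfl⟩)

theorem exists_seq_near : ∃ d : ℕ → ell2, (∀ i, ‖d i‖ ≤ 1) ∧
    ∀ a : ell2, ‖a‖ ≤ 1 → ∃ i, ‖a - d i‖ ≤ 2⁻¹ := by
  have : Nonempty (Metric.closedBall (0 : ell2) 1) := ⟨⟨0, by simp⟩⟩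
  refine ⟨fun i => TopologicalSpace.denseSeq (Metric.closedBall (0 : ell2) 1) i, fun i =>
    mem_closedBall_zero_iff.1 (TopologicalSpace.denseSeq (Metric.closedBall (0 : ell2) 1) i).2,
    fun a ha => ?_⟩
  obtain ⟨i, hi⟩ := (TopologicalSpace.denseRange_denseSeq
    (Metric.closedBall (0 : ell2) 1)).exists_dist_lt
    ⟨a, by simpa using ha⟩ (show (0 : ℝ) < 2⁻¹ by norm_num)
  exact ⟨i, by rw [← dist_eq_norm]; exact hi.le⟩

theorem exists_ell2_of_mem_ballSeq {t : ℕ → ℝ} (ht : t ∈ ballSeq) :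
    ∃ a : ell2, ‖a‖ ≤ 1 ∧ ∀ k, a k = t k := by
  have h1 : ∀ s : Finset ℕ, ∑ k ∈ s, ‖t k‖ ^ (2 : ℝ≥0∞).toReal ≤ 1 := by
    intro s
    obtain ⟨N, hN⟩ := s.exists_nat_subset_range
    refine le_trans ?_ (ht N)
    refine (Finset.sum_le_sum_of_subset_of_nonneg hN fun _ _ _ => by positivity).trans_eq ?_
    simp
  refine ⟨⟨t, memℓp_gen' h1⟩, lp.norm_le_of_forall_sum_le (by norm_num) zero_le_one fun s => ?_,
    fun k => rfl⟩
  rw [Real.one_rpow]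
  exact h1 s

/-- A measurable choice of half-scale approximations in the unit ball of `ℓ₂`. -/
theorem exists_greedy_step : ∃ (d : ℕ → ell2) (idx : ballSeq → ℕ) (step : ballSeq → ballSeq),
    (∀ i, ‖d i‖ ≤ 1) ∧ Measurable idx ∧ Measurable step ∧
      ∀ (t : ballSeq) k, (t : ℕ → ℝ) k = d (idx t) k + 2⁻¹ * (step t : ℕ → ℝ) k := by
  classical
  obtain ⟨d, hd, hnear⟩ := exists_seq_near
  have hex : ∀ t : ballSeq, ∃ i, (fun k => 2 * ((t : ℕ → ℝ) k - d i k)) ∈ ballSeq := by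
    intro t
    obtain ⟨a, ha, hat⟩ := exists_ell2_of_mem_ballSeq t.2
    obtain ⟨i, hi⟩ := hnear a ha
    refine ⟨i, ?_⟩
    have h1 : ‖(2 : ℝ) • (a - d i)‖ ≤ 1 := by
      rw [norm_smul, Real.norm_eq_abs, abs_two]; linarith
    have h2 := mem_ballSeq_of_norm_le h1
    have h3 : ∀ k, ((2 : ℝ) • (a - d i)) k = 2 * ((t : ℕ → ℝ) k - d i k) := fun k => by
      rw [lp.coeFn_smul, Pi.smul_apply, lp.coeFn_sub, Pi.sub_apply, hat, smul_eq_mul]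
    simpa only [h3] using h2
  have hmeas : ∀ i, Measurable fun t : ballSeq => fun k => 2 * ((t : ℕ → ℝ) k - d i k) := by
    intro i
    refine measurable_pi_lambda _ fun k => ?_
    exact (((measurable_pi_apply k).comp measurable_subtype_coe).sub_const _).const_mul _
  -- The least admissible index is measurable because each admissibility condition defines a
  -- measurable set. The remainder, doubled, is again in the ball, so the step can be iterated.
  have hidx : Measurable fun t : ballSeq => Nat.find (hex t) :=
    measurable_find hex fun i => hmeas i isClosed_ballSeq.measurableSet
  refine ⟨d, fun t => Nat.find (hex t), fun t => ⟨_, Nat.find_spec (hex t)⟩, hd, hidx, ?_, ?_⟩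
  · refine Measurable.subtype_mk (measurable_pi_lambda _ fun k => ?_)
    refine Measurable.const_mul (Measurable.sub
      ((measurable_pi_apply k).comp measurable_subtype_coe) ?_) _
    exact (measurable_of_countable fun i => d i k).comp hidx
  · intro t k
    simp only
    ring

/-- The integral of a function of a discrete variable. -/
theorem hasSum_measureReal_mul {Ω : Type*} [MeasurableSpace Ω] (m : Measure Ω) [IsFiniteMeasure m]
    {f : Ω → ℕ} (hf : Measurable f) (v : ℕ → ℝ) {M : ℝ} (hv : ∀ i, |v i| ≤ M) :
    HasSum (fun i => m.real (f ⁻¹' {i}) * v i) (∫ t, v (f t) ∂m) := by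
  have hu : ⋃ i, f ⁻¹' {i} = Set.univ := by ext; simp
  have hint : Integrable (fun t => v (f t)) m :=
    Integrable.of_bound ((measurable_of_countable v).comp hf).aestronglyMeasurable M
      (Eventually.of_forall fun t => hv _)
  have h := hasSum_integral_iUnion (μ := m) (s := fun i => f ⁻¹' {i}) (f := fun t => v (f t))
    (fun i => hf (measurableSet_singleton i))
    (fun i j hij => Disjoint.preimage f (by simpa using hij)) hint.integrableOn
  rw [hu, setIntegral_univ] at h
  refine h.congr_fun fun i => ?_
  rw [setIntegral_congr_fun (g := fun _ => v i) (hf (measurableSet_singleton i))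
    fun t ht => congrArg v ht, setIntegral_const, smul_eq_mul]

/-- The coefficients of a finite measure in the expansion of the coordinate functions along
iterated approximations. -/
theorem hasSum_coord_expansion {d : ℕ → ell2} {idx : ballSeq → ℕ} {step : ballSeq → ballSeq}
    (hd : ∀ i, ‖d i‖ ≤ 1) (hidx : Measurable idx) (hstep : Measurable step)
    (h : ∀ (t : ballSeq) k, (t : ℕ → ℝ) k = d (idx t) k + 2⁻¹ * (step t : ℕ → ℝ) k)
    (m : Measure ballSeq) [IsFiniteMeasure m] :
    HasSum (fun p : ℕ × ℕ => 2⁻¹ ^ p.1 * m.real ((fun t => idx (step^[p.1] t)) ⁻¹' {p.2}))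
        (2 * m.real Set.univ) ∧
      ∀ k, HasSum (fun p : ℕ × ℕ =>
          2⁻¹ ^ p.1 * m.real ((fun t => idx (step^[p.1] t)) ⁻¹' {p.2}) * d p.2 k)
        (∫ t, coord k t ∂m) := by
  have hmeas : ∀ n, Measurable fun t => idx (step^[n] t) := fun n => hidx.comp (hstep.iterate n)
  set w : ℕ × ℕ → ℝ := fun p => 2⁻¹ ^ p.1 * m.real ((fun t => idx (step^[p.1] t)) ⁻¹' {p.2}) with hw
  have hw0 : ∀ p, 0 ≤ w p := fun p => by positivity
  have hdk : ∀ i k, |d i k| ≤ 1 := fun i k =>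
    abs_le_one_of_mem_ballSeq (mem_ballSeq_of_norm_le (hd i)) k
  have hfib : ∀ n, HasSum (fun i => w (n, i)) (2⁻¹ ^ n * m.real Set.univ) := by
    intro n
    have h1 := hasSum_measureReal_mul m (hmeas n) (fun _ => 1) (M := 1) (by simp)
    simpa only [mul_one, integral_const, smul_eq_mul] using h1.mul_left (2⁻¹ ^ n)
  have hgeo : HasSum (fun n : ℕ => (2⁻¹ : ℝ) ^ n * m.real Set.univ) (2 * m.real Set.univ) := by
    refine HasSum.mul_right _ ?_
    simpa only [one_div] using hasSum_geometric_two
  have hsw : Summable w := (summable_prod_of_nonneg hw0).2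
    ⟨fun n => (hfib n).summable, hgeo.summable.congr fun n => (hfib n).tsum_eq.symm⟩
  refine ⟨?_, fun k => ?_⟩
  · have := hsw.hasSum.prod_fiberwise hfib
    rw [← this.unique hgeo]
    exact hsw.hasSum
  have hswd : Summable fun p => w p * d p.2 k := by
    refine Summable.of_norm_bounded hsw fun p => ?_
    rw [Real.norm_eq_abs, abs_mul, abs_of_nonneg (hw0 p)]
    exact mul_le_of_le_one_right (hw0 p) (hdk _ _)
  have hfibd : ∀ n, HasSum (fun i => w (n, i) * d i k)
      (2⁻¹ ^ n * ∫ t, d (idx (step^[n] t)) k ∂m) := by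
    intro n
    have h1 := hasSum_measureReal_mul m (hmeas n) (fun i => d i k) (hdk · k)
    simpa only [hw, mul_assoc] using h1.mul_left (2⁻¹ ^ n)
  have hsum := hswd.hasSum.prod_fiberwise hfibd
  -- After `N` steps the remainder is `2^{-N}` times a point of the ball, so its integral tends to
  -- zero.
  have hexp : ∀ N (t : ballSeq), coord k t =
      ∑ n ∈ Finset.range N, 2⁻¹ ^ n * d (idx (step^[n] t)) k + 2⁻¹ ^ N * coord k (step^[N] t) := by
    intro N t
    induction N with
    | zero => simp
    | succ N ih =>
      rw [ih, Finset.sum_range_succ, Function.iterate_succ_apply', coord_apply k (step^[N] t),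
        h (step^[N] t) k, coord_apply]
      ring
  have hi1 : ∀ n, Integrable (fun t => d (idx (step^[n] t)) k) m := fun n =>
    Integrable.of_bound ((measurable_of_countable fun i => d i k).comp
      (hmeas n)).aestronglyMeasurable 1 (Eventually.of_forall fun t => hdk _ _)
  have hi2 : ∀ N, Integrable (fun t => coord k (step^[N] t)) m := fun N =>
    Integrable.of_bound ((coord k).continuous.measurable.comp
      (hstep.iterate N)).aestronglyMeasurable 1
      (Eventually.of_forall fun t => abs_le_one_of_mem_ballSeq (step^[N] t).2 k)
  have hpart : ∀ N, ∑ n ∈ Finset.range N, 2⁻¹ ^ n * ∫ t, d (idx (step^[n] t)) k ∂m =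
      ∫ t, coord k t ∂m - 2⁻¹ ^ N * ∫ t, coord k (step^[N] t) ∂m := by
    intro N
    rw [integral_congr_ae (Eventually.of_forall (hexp N)), integral_add
      (integrable_finsetSum _ fun n _ => (hi1 n).const_mul _) ((hi2 N).const_mul _),
      integral_finsetSum _ fun n _ => (hi1 n).const_mul _]
    simp only [integral_const_mul]
    ring
  have hlim : Tendsto (fun N : ℕ => ∫ t, coord k t ∂m - 2⁻¹ ^ N * ∫ t, coord k (step^[N] t) ∂m)
      atTop (𝓝 (∫ t, coord k t ∂m)) := by
    have h0 : Tendsto (fun N : ℕ => (2⁻¹ : ℝ) ^ N * ∫ t, coord k (step^[N] t) ∂m) atTop (𝓝 0) := by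
      refine squeeze_zero_norm (a := fun N : ℕ => (2⁻¹ : ℝ) ^ N * m.real Set.univ) (fun N => ?_) ?_
      · rw [norm_mul, Real.norm_of_nonneg (by positivity)]
        refine mul_le_mul_of_nonneg_left ?_ (by positivity)
        refine (norm_integral_le_of_norm_le_const (C := 1) (Eventually.of_forall fun t =>
          abs_le_one_of_mem_ballSeq (step^[N] t).2 k)).trans_eq (one_mul _)
      · simpa using (tendsto_pow_atTop_nhds_zero_of_lt_one (r := (2⁻¹ : ℝ)) (by norm_num)
          (by norm_num)).mul_const (m.real Set.univ)
    simpa using tendsto_const_nhds.sub h0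
  have := hsum.tendsto_sum_nat
  simp only [hpart] at this
  rw [← tendsto_nhds_unique this hlim]
  exact hswd.hasSum

end GreedyExpansion

/-! ### From bilinear forms to GL₂ -/

section GordonLewis

universe u

variable {X : Type u} [NormedAddCommGroup X] [NormedSpace ℝ X]

/-- An operator into `ℓ₂` whose coordinates extend to a bounded bilinear form on
`X × C(ballSeq)` factors through an `L₁`-space. -/
theorem factorsThroughL1_of_bilinear {T : X →L[ℝ] ell2} (Ψ : X →ₗ[ℝ] C(ballSeq, ℝ) →ₗ[ℝ] ℝ) {C : ℝ}
    (hC : 0 ≤ C) (hΨ : ∀ x φ, |Ψ x φ| ≤ C * (‖φ‖ * ‖x‖)) (hT : ∀ k x, Ψ x (coord k) = T x k) :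
    FactorsThroughL1 T := by
  obtain ⟨d, idx, step, hd, hidx, hstep, h⟩ := exists_greedy_step
  choose m hm hmass hrep using fun x => exists_measures_of_functional (Ψ x) (c := C * ‖x‖)
    (by positivity) (fun φ => (hΨ x φ).trans_eq (by ring))
  obtain ⟨w, hw⟩ : ∃ w : Measure ballSeq → ℕ × ℕ → ℝ, w = fun μ p =>
    2⁻¹ ^ p.1 * μ.real ((fun t => idx (step^[p.1] t)) ⁻¹' {p.2}) := ⟨_, rfl⟩
  have hw0 : ∀ μ p, 0 ≤ w μ p := fun μ p => by rw [hw]; positivity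
  have hwadd : ∀ (μ ν : Measure ballSeq) [IsFiniteMeasure μ] [IsFiniteMeasure ν] p,
      w (μ + ν) p = w μ p + w ν p := by
    intro μ ν _ _ p
    simp only [hw]
    rw [measureReal_add_apply, mul_add]
  have hws : ∀ x b, HasSum (w (m x b)) (2 * (m x b).real Set.univ) ∧
      ∀ k, HasSum (fun p => w (m x b) p * d p.2 k) (∫ t, coord k t ∂(m x b)) := by
    intro x b
    rw [hw]
    exact hasSum_coord_expansion hd hidx hstep h (m x b)
  have hint : ∀ (φ : C(ballSeq, ℝ)) (μ : Measure ballSeq) [IsFiniteMeasure μ], Integrable φ μ :=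
    fun φ μ _ => Integrable.of_bound φ.continuous.aestronglyMeasurable ‖φ‖
      (Eventually.of_forall φ.norm_coe_le_norm)
  -- The chosen measures need not be additive in `x`; only their differences are. Moving the
  -- negative parts across gives an identity of positive measures, determined by continuous
  -- functions.
  have hmadd : ∀ x y, m (x + y) true + (m x false + m y false) =
      m (x + y) false + (m x true + m y true) := by
    intro x y
    refine measure_eq_of_integral_eq fun φ => ?_
    rw [integral_add_measure (hint _ _) (hint _ _), integral_add_measure (hint _ _) (hint _ _),
      integral_add_measure (hint _ _) (hint _ _), integral_add_measure (hint _ _) (hint _ _)]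
    have h1 := hrep (x + y) φ
    rw [map_add, LinearMap.add_apply, hrep x, hrep y] at h1
    linarith
  have hle : ∀ x p, |w (m x true) p - w (m x false) p| ≤ w (m x true) p + w (m x false) p :=
    fun x p => (abs_sub _ _).trans_eq (by rw [abs_of_nonneg (hw0 _ _), abs_of_nonneg (hw0 _ _)])
  have hsum : ∀ x, HasSum (fun i : ULift.{u} (ℕ × ℕ) => w (m x true) i.down + w (m x false) i.down)
      (2 * (m x true).real Set.univ + 2 * (m x false).real Set.univ) := fun x =>
    (Equiv.ulift.hasSum_iff (f := fun p => w (m x true) p + w (m x false) p)).2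
      ((hws x true).1.add (hws x false).1)
  have habs : ∀ x, Summable fun i : ULift.{u} (ℕ × ℕ) =>
      |w (m x true) i.down - w (m x false) i.down| := fun x =>
    Summable.of_nonneg_of_le (fun _ => abs_nonneg _) (fun i => hle x i.down) (hsum x).summable
  -- The index set is lifted to the universe of `X`. The constant `4 C` combines the factor `2` of
  -- the geometric series with the mass bound `2 C ‖x‖`.
  refine factorsThroughL1_of_hasSum (I := ULift.{u} (ℕ × ℕ)) (fun i => d i.down.2)
    (fun i => hd _) (fun x i => w (m x true) i.down - w (m x false) i.down) ?_ (R := 4 * C)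
    habs ?_ ?_
  · intro x y i
    have h1 := congrArg (fun μ => w μ i.down) (hmadd x y)
    simp only [hwadd] at h1
    linarith
  · intro x
    have h1 := hasSum_le (fun i : ULift.{u} (ℕ × ℕ) => hle x i.down) (habs x).hasSum (hsum x)
    linarith [hmass x]
  · intro x k
    rw [← hT k x, hrep x (coord k)]
    refine (Equiv.ulift.hasSum_iff
      (f := fun p => (w (m x true) p - w (m x false) p) * d p.2 k)).2 ?_
    simp only [sub_mul]
    exact ((hws x true).2 k).sub ((hws x false).2 k)

/-- A representation of `t ↦ ∑ t_k x_k` by tensors bounds the 1-summing constant of the adjoint of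
`e_k ↦ x_k` by its projective size. The trace inequality against truncations of `T` therefore bounds
`∑ (T x_k)_k` by that size, which is exactly what the bilinear extension requires. -/
theorem HasGAP.hasGL2 {C : ℝ} (hX : CotypeBound X 2 C) (h : HasGAP X) : HasGL2 X := by
  intro T hT
  obtain ⟨K, hK, htr⟩ := h.exists_trace_bound hX
  obtain ⟨c, hc, hTc⟩ : ∃ c : ℝ, 0 ≤ c ∧ SummingBound 1 T c :=
    ⟨_, ENNReal.toReal_nonneg, IsSumming.summingBound one_ne_zero (by rwa [Nat.cast_one])⟩
  have hT2 : ∀ n, SummingBound 2 ((trunc n).comp T) c := fun n =>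
    (hTc.two_of_one.comp_left (trunc n)).mono (by positivity)
      (mul_le_of_le_one_left hc (norm_trunc_le n))
  obtain ⟨Ψ, hΨ, hΨT⟩ := exists_bilinear_extension
    (fun k => ((innerSL ℝ (unitVec k)).comp T).toLinearMap) (C := K * c) (by positivity)
    (fun x u hu => by
      obtain ⟨n, hn⟩ := x.support.exists_nat_subset_range
      have h1 := htr n ((trunc n).comp T) (comb fun k : Fin n => x k) (tensorSize u) c
        (tensorSize_nonneg u) hc (hT2 n) (summingBound_adj_of_tensor hu hn)
      refine le_trans (le_of_eq ?_) ((le_abs_self _).trans h1)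
      rw [Finset.sum_subset hn fun k _ hk => by rw [Finsupp.notMem_support_iff.1 hk, map_zero],
        ← Fin.sum_univ_eq_sum_range]
      refine Finset.sum_congr rfl fun k _ => ?_
      simp [trunc_apply, comb_apply, inner_unitVec_left])
  exact factorsThroughL1_of_bilinear Ψ (by positivity) hΨ fun k x => by
    rw [hΨT]
    simp [inner_unitVec_left]

end GordonLewis

end GaussianAverage

end

open GaussianAverage in
theorem theorem1p3 {X : Type*} [NormedAddCommGroup X] [NormedSpace ℝ X] [CompleteSpace X] :
    (HasCotype X 2 → (HasGAP X ↔ HasGL2 X)) ∧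
    (HasType X 2 → HasGAP X) ∧
    (∀ {Z : Type*} [NormedAddCommGroup Z] [NormedSpace ℝ Z] [CompleteSpace Z]
        [Lattice Z] [IsOrderedAddMonoid Z] [PosSMulMono ℝ Z] [HasSolidNorm Z],
      HasFiniteCotype Z →
      ∀ J : X →L[ℝ] Z, (∃ c : ℝ, 0 < c ∧ ∀ x : X, c * ‖x‖ ≤ ‖J x‖) →
        HasS X ∧ HasGAP X) := by
  refine ⟨fun hX => ?_, fun hX => hX.hasGAP, fun hZ J hJ => hZ.hasS_and_hasGAP J hJ⟩
  obtain ⟨C, hC⟩ := hX.cotypeBound (by norm_num : (0 : ℝ) < 2) (p := 2) (by norm_num)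
  exact ⟨fun h => h.hasGL2 hC, fun h => h.hasGAP hC⟩
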